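/- All matroids are finite. Write $r$ and $r^*$ for the rank functions of $M$ and of its dual $M^*$, and $E$ for the ground set. Two matroids are *isomorphic* if a bijection of their ground sets maps the bases of one exactly onto the bases of the other. A matroid is *2-connected* if any two distinct elements lie on a common circuit; the 2-connected components of $M$ are the classes of the relation "equal or on a common circuit". If $M$ is 2-connected, a set $L\subseteq E$ is *locked* in $M$ if $M|L$ and $M^*|(E\setminus L)$ are 2-connected and $\min\{r(L),r^*(E\setminus L)\}\ge 2$; the locked subsets of an arbitrary matroid are those of its 2-connected components. $\mathcal L_0$ is the class of matroids without locked subsets. Elements $e,f$ are parallel if $e=f$ or $\{e,f\}$ is a circuit, and coparallel if they are parallel in $M^*$; the classes of these two relations are the *parallel* and the *coparallel closures*. The *locked lattice* of a 2-connected matroid $M$ is the directed graph whose vertices are a root (representing $\varnothing$), the coparallel closures, the parallel closures, the locked subsets, and a sink (representing $E$), each vertex being labelled by the cardinality and the rank of the set it represents. Its arcs go from the root to every coparallel closure, from a coparallel closure $S$ to every parallel closure $P$ with $S\cap P\neq\varnothing$, and, above the parallel closures, along the covering pairs of inclusion among parallel closures, locked subsets and $E$ (arcs between two parallel closures excluded).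 **Theorem 3.4.** (1) Isomorphism of matroids in $\mathcal L_0$ is decidable in linear, hence polynomial, time, when a matroid is represented by its locked structure, that is, by a list giving for every element arbitrary names of its 2-connected component, of its parallel closure and of its coparallel closure, together with the rank of its component. Precisely: there are a random access machine program (operations: constants, addition, truncated subtraction, indirect load and store, reading the input, branches, loops; each step has unit cost) and a constant $c$ such that for all $M_1,M_2\in\mathcal L_0$ with $n_1,n_2$ elements and all such representations of them, the program stops after at most $c\,(n_1+n_2+1)$ steps, stores only numbers at most $c\,(n_1+n_2+1)^c$, and outputs $1$ if $M_1$ and $M_2$ are isomorphic and $0$ otherwise. (2) Let $M_1,M_2\in\mathcal L_0$ be 2-connected. Then $M_1$ and $M_2$ are isomorphic if and only if their locked lattices are isomorphic as labelled directed graphs, and also if and only if they have the same rank, the same multiset of sizes of parallel closures, and the same multiset of sizes of coparallel closures. (3) If $M\in\mathcal L_0$ is 2-connected and $|E|\ne 2$, then for every element of $E$ its parallel closure or its coparallel closure is a singleton. -/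

import Mathlib

universe u v

namespace LockedMatroid

open Set

/-! ### Matroid isomorphism, 2-connectedness, closures and locked subsets -/

/-- `M` and `N` are isomorphic: some bijection between the ground sets carries the bases of `M`
exactly onto the bases of `N`. -/
def Isomorphic {α : Type u} {β : Type v} (M : Matroid α) (N : Matroid β) : Prop :=
  ∃ φ : M.E ≃ N.E, ∀ B : Set M.E,
    M.IsBase ((fun x : M.E => (x : α)) '' B) ↔ N.IsBase ((fun x : M.E => (φ x : β)) '' B)

/-- Two elements are in the same 2-connected component if they are equal or lie on a common
circuit. -/
def SameComponent {α : Type u} (M : Matroid α) (e f : α) : Prop :=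
  e = f ∨ ∃ C, M.IsCircuit C ∧ e ∈ C ∧ f ∈ C

/-- `M` is 2-connected (that is, connected): any two distinct elements lie on a common circuit. -/
def TwoConnected {α : Type u} (M : Matroid α) : Prop :=
  ∀ e ∈ M.E, ∀ f ∈ M.E, SameComponent M e f

/-- The ground set of the 2-connected component of `M` that contains `e`. -/
def component {α : Type u} (M : Matroid α) (e : α) : Set α :=
  {f | f ∈ M.E ∧ SameComponent M e f}

/-- `e` and `f` are parallel: equal, or the two elements of a two-element circuit. -/
def Parallel {α : Type u} (M : Matroid α) (e f : α) : Prop :=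
  e = f ∨ M.IsCircuit {e, f}

/-- `e` and `f` are coparallel: parallel in the dual matroid. -/
def Coparallel {α : Type u} (M : Matroid α) (e f : α) : Prop :=
  Parallel M.dual e f

/-- The parallel closure of `e`. -/
def parallelClosure {α : Type u} (M : Matroid α) (e : α) : Set α :=
  {f | f ∈ M.E ∧ Parallel M e f}

/-- The coparallel closure of `e`. -/
def coparallelClosure {α : Type u} (M : Matroid α) (e : α) : Set α :=
  {f | f ∈ M.E ∧ Coparallel M e f}

/-- The class of all parallel closures of `M`. -/
def parallelClosures {α : Type u} (M : Matroid α) : Set (Set α) :=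
  parallelClosure M '' M.E

/-- The class of all coparallel closures of `M`. -/
def coparallelClosures {α : Type u} (M : Matroid α) : Set (Set α) :=
  coparallelClosure M '' M.E

/-- The multiset of the cardinalities of the members of `A`, as its multiplicity function:
`closureSizes A k` is the number of members of `A` that have exactly `k` elements. -/
noncomputable def closureSizes {α : Type u} (A : Set (Set α)) (k : ℕ) : ℕ :=
  {X | X ∈ A ∧ X.ncard = k}.ncard

/-- Locked subsets of a 2-connected matroid `M`: both `M|L` and `M*|(E \ L)` are 2-connected, and
both have rank at least `2`. -/
def IsLockedIn {α : Type u} (M : Matroid α) (L : Set α) : Prop :=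
  L ⊆ M.E ∧ TwoConnected (M.restrict L) ∧ TwoConnected (M.dual.restrict (M.E \ L)) ∧
    2 ≤ M.eRk L ∧ 2 ≤ M.dual.eRk (M.E \ L)

/-- The class of locked subsets of an arbitrary matroid: the union of the classes of locked subsets
of its 2-connected components. (If `M` is 2-connected, its only component is `M` itself.) -/
def lockedSubsets {α : Type u} (M : Matroid α) : Set (Set α) :=
  {L | ∃ e ∈ M.E, IsLockedIn (M.restrict (component M e)) L}

/-- The class of `0`-locked matroids: those without locked subsets. -/
def ZeroLocked {α : Type u} (M : Matroid α) : Prop :=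
  lockedSubsets M = ∅

/-! ### The locked lattice -/

/-- Vertices of the locked lattice: the root (the empty set), one vertex for each coparallel
closure, each parallel closure and each locked subset, and the sink (the ground set). -/
inductive LatticeVertex {α : Type u} (M : Matroid α) : Type u
  | root : LatticeVertex M
  | coparallel (S : Set α) (hS : S ∈ coparallelClosures M) : LatticeVertex M
  | parallel (P : Set α) (hP : P ∈ parallelClosures M) : LatticeVertex M
  | locked (L : Set α) (hL : L ∈ lockedSubsets M) : LatticeVertex M
  | sink : LatticeVertex M

/-- The subset of the ground set that a vertex represents. -/
def LatticeVertex.carrier {α : Type u} {M : Matroid α} : LatticeVertex M → Set α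
  | .root => ∅
  | .coparallel S _ => S
  | .parallel P _ => P
  | .locked L _ => L
  | .sink => M.E

/-- Every vertex is labelled by its cardinality and its rank. -/
noncomputable def LatticeVertex.label {α : Type u} {M : Matroid α} (x : LatticeVertex M) :
    ℕ∞ × ℕ∞ :=
  (x.carrier.encard, M.eRk x.carrier)

/-- The arcs of the locked lattice. The root is joined to all coparallel closures; a coparallel
closure is joined to the parallel closures that meet it; above the parallel closures the arcs are
the covering pairs of inclusion, the ground set being on top. -/
def LatticeVertex.Arc {α : Type u} {M : Matroid α} : LatticeVertex M → LatticeVertex M → Prop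
  | .root, .coparallel _ _ => True
  | .coparallel S _, .parallel P _ => (S ∩ P).Nonempty
  | .parallel P _, .locked L _ => P ⊆ L ∧ ∀ L' ∈ lockedSubsets M, P ⊆ L' → ¬ L' ⊂ L
  | .parallel P _, .sink => ∀ L' ∈ lockedSubsets M, ¬ P ⊆ L'
  | .locked L _, .locked K _ => L ⊂ K ∧ ∀ L' ∈ lockedSubsets M, L ⊂ L' → ¬ L' ⊂ K
  | .locked L _, .sink => ∀ L' ∈ lockedSubsets M, ¬ L ⊂ L'
  | _, _ => False

/-- The locked lattices of `M` and `N` are isomorphic as vertex-labelled directed graphs. -/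
def LockedLatticesIsomorphic {α : Type u} {β : Type v} (M : Matroid α) (N : Matroid β) : Prop :=
  ∃ f : LatticeVertex M ≃ LatticeVertex N,
    (∀ x, (f x).label = x.label) ∧ ∀ x y, (f x).Arc (f y) ↔ x.Arc y

/-! ### The machine model: a random access machine with a step count -/

/-- Programs of a random access machine. Its working memory is an array of natural numbers, indexed
by natural numbers; its read-only input consists of numbered arrays of natural numbers. -/
inductive Program : Type
  /-- `mem[a] := k` -/
  | const (a k : ℕ) : Program
  /-- `mem[a] := mem[b] + mem[c]` -/
  | add (a b c : ℕ) : Program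
  /-- `mem[a] := mem[b] - mem[c]`, truncated at zero -/
  | sub (a b c : ℕ) : Program
  /-- `mem[a] := mem[mem[b]]` -/
  | load (a b : ℕ) : Program
  /-- `mem[mem[a]] := mem[b]` -/
  | store (a b : ℕ) : Program
  /-- `mem[a] := input[j][mem[b]]` -/
  | read (a j b : ℕ) : Program
  /-- first `p`, then `q` -/
  | seq (p q : Program) : Program
  /-- if `mem[a] ≠ 0` then `p` else `q` -/
  | cond (a : ℕ) (p q : Program) : Program
  /-- while `mem[a] ≠ 0` do `p` -/
  | loop (a : ℕ) (p : Program) : Program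

/-- `Runs w input p m t m'`: started with the memory contents `m`, the program `p` stops after
exactly `t` steps with the memory contents `m'`. Every elementary instruction and every test of a
branch or a loop is one step. A memory cell holds only numbers up to `w`: an instruction that would
write a larger number cannot be executed. -/
inductive Runs (w : ℕ) (input : ℕ → ℕ → ℕ) : Program → (ℕ → ℕ) → ℕ → (ℕ → ℕ) → Prop
  | const (a k : ℕ) (m : ℕ → ℕ) (h : k ≤ w) :
      Runs w input (.const a k) m 1 (Function.update m a k)
  | add (a b c : ℕ) (m : ℕ → ℕ) (h : m b + m c ≤ w) :
      Runs w input (.add a b c) m 1 (Function.update m a (m b + m c))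
  | sub (a b c : ℕ) (m : ℕ → ℕ) (h : m b - m c ≤ w) :
      Runs w input (.sub a b c) m 1 (Function.update m a (m b - m c))
  | load (a b : ℕ) (m : ℕ → ℕ) (h : m (m b) ≤ w) :
      Runs w input (.load a b) m 1 (Function.update m a (m (m b)))
  | store (a b : ℕ) (m : ℕ → ℕ) (h : m b ≤ w) :
      Runs w input (.store a b) m 1 (Function.update m (m a) (m b))
  | read (a j b : ℕ) (m : ℕ → ℕ) (h : input j (m b) ≤ w) :
      Runs w input (.read a j b) m 1 (Function.update m a (input j (m b)))
  | seq (p q : Program) (m m₁ m₂ : ℕ → ℕ) (s t : ℕ)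
      (hp : Runs w input p m s m₁) (hq : Runs w input q m₁ t m₂) :
      Runs w input (.seq p q) m (s + t) m₂
  | cond_then (a : ℕ) (p q : Program) (m m₁ : ℕ → ℕ) (t : ℕ) (h : m a ≠ 0)
      (hp : Runs w input p m t m₁) : Runs w input (.cond a p q) m (t + 1) m₁
  | cond_else (a : ℕ) (p q : Program) (m m₁ : ℕ → ℕ) (t : ℕ) (h : m a = 0)
      (hq : Runs w input q m t m₁) : Runs w input (.cond a p q) m (t + 1) m₁
  | loop_stop (a : ℕ) (p : Program) (m : ℕ → ℕ) (h : m a = 0) :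
      Runs w input (.loop a p) m 1 m
  | loop_step (a : ℕ) (p : Program) (m m₁ m₂ : ℕ → ℕ) (s t : ℕ) (h : m a ≠ 0)
      (hp : Runs w input p m s m₁) (hl : Runs w input (.loop a p) m₁ t m₂) :
      Runs w input (.loop a p) m (s + t + 1) m₂

/-! ### The input of the algorithm -/

/-- Data describing the locked structure of a matroid without locked subsets whose elements are
numbered `0, …, n - 1`: for every element the names of its 2-connected component, of its parallel
closure and of its coparallel closure, and the rank of its component. -/
structure LockedCode (n : ℕ) where
  comp : Fin n → Fin n
  par : Fin n → Fin n
  copar : Fin n → Fin n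
  rank : Fin n → ℕ

/-- `c` describes `M`, for the numbering `num` of the elements of `M`. The names are arbitrary:
equal names mean equal components, respectively equal closures. -/
def LockedCode.Describes {α : Type u} {n : ℕ} (c : LockedCode n) (M : Matroid α)
    (num : Fin n ≃ M.E) : Prop :=
  (∀ i j, c.comp i = c.comp j ↔ SameComponent M (num i : α) (num j : α)) ∧
  (∀ i j, c.par i = c.par j ↔ Parallel M (num i : α) (num j : α)) ∧
  (∀ i j, c.copar i = c.copar j ↔ Coparallel M (num i : α) (num j : α)) ∧
  ∀ i, (c.rank i : ℕ∞) = M.eRk (component M (num i : α))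

/-- A finite sequence as an array, padded with zeros. -/
def toArray {n : ℕ} (f : Fin n → ℕ) (i : ℕ) : ℕ :=
  if h : i < n then f ⟨i, h⟩ else 0

/-- The input arrays for a pair of matroids. Arrays `0` to `4` describe the first matroid (number
of elements, components, parallel closures, coparallel closures, ranks), arrays `5` to `9` the
second one. -/
def pairInput {n₁ n₂ : ℕ} (c₁ : LockedCode n₁) (c₂ : LockedCode n₂) : ℕ → ℕ → ℕ
  | 0 => fun i => if i = 0 then n₁ else 0
  | 1 => toArray fun i => (c₁.comp i : ℕ)
  | 2 => toArray fun i => (c₁.par i : ℕ)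
  | 3 => toArray fun i => (c₁.copar i : ℕ)
  | 4 => toArray c₁.rank
  | 5 => fun i => if i = 0 then n₂ else 0
  | 6 => toArray fun i => (c₂.comp i : ℕ)
  | 7 => toArray fun i => (c₂.par i : ℕ)
  | 8 => toArray fun i => (c₂.copar i : ℕ)
  | 9 => toArray c₂.rank
  | _ => fun _ => 0

end LockedMatroid

open LockedMatroid

/-!
A connected matroid without locked subsets is determined by its rank and by its parallel and
coparallel closures: its bases are the sets of the right size that contain at most one element of
each parallel closure and miss at most one element of each coparallel closure
(`indep_of_parallel_of_coparallel`). If such a set `B` were dependent, some `F` would violate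
`|B ∩ F| ≤ r(F)`; choose `F` connected and, among the connected violating sets, maximal. By
submodularity `M*|(E \ F)` is then connected too. As `F` is not locked, one of `M|F` and
`M*|(E \ F)` has rank at most one, so it lies in a single parallel or coparallel closure, and there
`B` does not violate anything. Component by component, this describes the bases of every matroid
without locked subsets (`ZeroLocked.isBase_iff`), and isomorphisms are the bijections that respect
components with their ranks, parallel closures and coparallel closures
(`isomorphic_iff_exists_sameLockedStructure`).

An element with a parallel partner `f` and a coparallel partner `g` has `f = g`, and then `{e, f}`
is a whole component (`eq_of_parallel_of_coparallel`). Hence the two partitions of a component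
hardly interact, and the sizes of their classes determine them up to a bijection
(`exists_equiv_of_nearlyDisjoint`). So the rank and the two multisets of class sizes are a complete
invariant of a connected matroid in the class (`isomorphic_iff_closureSizes`). The locked lattice
determines them, because its (co)parallel vertices can be recognized by the directed paths through
them (`sizes_eq_of_lockedLatticesIsomorphic`).

In general, two matroids without locked subsets are isomorphic if and only if each such invariant
belongs to the component of equally many elements of both
(`LockedCode.Describes.isomorphic_iff`). To decide this in linear time without sorting, class sizes
are replaced by the conjugate partition: the number of classes with more than `t` elements is the
number of elements with position `t + 1` in their class, which counting computes in one pass. The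
invariant of a component with `k` elements becomes a sequence of `3 * k` numbers, so that all
sequences together have linear length. They are named by the nodes of a trie, one symbol per
element and pass (`executes_trie`). The trie is an array of quadratically many cells, which costs no
time since the memory starts with zeros. Finally the multiplicities of the names in the two matroids
are compared.

Programs are written as passes over index ranges with loop-free bodies (`Code`, `pass`), whose
correctness is proved by invariants (`executes_pass`).
-/

namespace LockedMatroid

open Set

variable {α : Type u} {β : Type v} {M : Matroid α} {N : Matroid β} {e f g : α}
  {B C F K L X Y : Set α}

/-! ### Connectedness and the rank function -/

lemma SameComponent.symm (h : SameComponent M e f) : SameComponent M f e := by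
  rcases h with rfl | ⟨C, hC, he, hf⟩
  exacts [Or.inl rfl, Or.inr ⟨C, hC, hf, he⟩]

/-- Two circuits that meet give a circuit through any two prescribed elements of their union: if no
such circuit existed, two strong eliminations would replace the pair by one with smaller union. -/
lemma exists_isCircuit_mem_mem [M.Finite] {C D : Set α} (hC : M.IsCircuit C) (hD : M.IsCircuit D)
    (he : e ∈ C) (hg : g ∈ D) (hCD : (C ∩ D).Nonempty) :
    ∃ K, M.IsCircuit K ∧ e ∈ K ∧ g ∈ K := by
  induction hn : (C ∪ D).ncard using Nat.strong_induction_on generalizing D with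
  | _ n ih =>
  by_contra hno
  obtain ⟨f, hfC, hfD⟩ := hCD
  have heD : e ∉ D := fun h => hno ⟨D, hD, h, hg⟩
  have hgC : g ∉ C := fun h => hno ⟨C, hC, he, h⟩
  obtain ⟨C₃, h3s, h3, he3⟩ := hC.strong_elimination hD hfC hfD he heD
  have hg3 : g ∉ C₃ := fun h => hno ⟨C₃, h3, he3, h⟩
  obtain ⟨x, hx3, hxC⟩ : ∃ x ∈ C₃, x ∉ C := by
    by_contra! hcon
    exact (h3s (h3.eq_of_subset_isCircuit hC hcon ▸ hfC)).2 rfl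
  have hxD : x ∈ D := (h3s hx3).1.resolve_left hxC
  obtain ⟨C₄, h4s, h4, hg4⟩ := hD.strong_elimination h3 hxD hx3 hg hg3
  obtain ⟨y, hy4, hyD⟩ : ∃ y ∈ C₄, y ∉ D := by
    by_contra! hcon
    exact (h4s (h4.eq_of_subset_isCircuit hD hcon ▸ hxD)).2 rfl
  have hyC : y ∈ C := (h3s ((h4s hy4).1.resolve_left hyD)).1.resolve_right hyD
  refine hno (ih (C ∪ C₄).ncard ?_ h4 hg4 ⟨y, hyC, hy4⟩ rfl)
  rw [← hn]
  refine ncard_lt_ncard (ssubset_iff_of_subset ?_ |>.2 ⟨x, Or.inr hxD, ?_⟩)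
    ((M.set_finite C hC.subset_ground).union (M.set_finite D hD.subset_ground))
  · refine union_subset subset_union_left (h4s.trans ?_)
    rintro z ⟨hz | hz, -⟩
    exacts [Or.inr hz, (h3s hz).1]
  · rintro (h | h)
    exacts [hxC h, (h4s h).2 rfl]

lemma SameComponent.trans [M.Finite] (h : SameComponent M e f) (h' : SameComponent M f g) :
    SameComponent M e g := by
  rcases h with rfl | ⟨C, hC, he, hf⟩
  · exact h'
  rcases h' with rfl | ⟨D, hD, hf', hg⟩
  · exact Or.inr ⟨C, hC, he, hf⟩
  exact Or.inr (exists_isCircuit_mem_mem hC hD he hg ⟨f, hf, hf'⟩)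

/-- The rank of a set as a natural number; junk `0` for sets of infinite rank. -/
noncomputable def natRank (M : Matroid α) (X : Set α) : ℕ := (M.eRk X).toNat

lemma cast_natRank [M.Finite] (X : Set α) : (natRank M X : ℕ∞) = M.eRk X :=
  ENat.natCast_toNat (Matroid.eRk_ne_top_iff.2 (Matroid.isRkFinite_set M X))

lemma natRank_submod [M.Finite] (X Y : Set α) :
    natRank M (X ∩ Y) + natRank M (X ∪ Y) ≤ natRank M X + natRank M Y := by
  have := M.eRk_inter_add_eRk_union_le X Y
  simp only [← cast_natRank] at this
  exact_mod_cast this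

lemma natRank_mono [M.Finite] (h : X ⊆ Y) : natRank M X ≤ natRank M Y := by
  have := M.eRk_mono h
  simp only [← cast_natRank] at this
  exact_mod_cast this

lemma natRank_le_ncard [M.Finite] (hX : X ⊆ M.E) : natRank M X ≤ X.ncard := by
  have := M.eRk_le_encard X
  rw [← cast_natRank, ← (M.set_finite X hX).cast_ncard_eq] at this
  exact_mod_cast this

lemma indep_iff_natRank [M.Finite] (hX : X ⊆ M.E) : M.Indep X ↔ natRank M X = X.ncard := by
  rw [Matroid.indep_iff_eRk_eq_encard, ← cast_natRank, ← (M.set_finite X hX).cast_ncard_eq]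
  norm_cast

lemma natRank_dual [M.Finite] (hX : X ⊆ M.E) :
    natRank M.dual X + natRank M M.E = natRank M (M.E \ X) + X.ncard := by
  have := M.eRk_dual_add_eRank X hX
  rw [← Matroid.eRk_ground, ← cast_natRank, ← cast_natRank, ← cast_natRank,
    ← (M.set_finite X hX).cast_ncard_eq] at this
  exact_mod_cast this

lemma natRank_circuit [M.Finite] (hC : M.IsCircuit C) : natRank M C + 1 = C.ncard := by
  have := hC.eRk_add_one_eq
  rw [← cast_natRank, ← (M.set_finite C hC.subset_ground).cast_ncard_eq] at this
  exact_mod_cast this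

lemma isBase_iff_natRank [M.Finite] (hX : X ⊆ M.E) :
    M.IsBase X ↔ M.Indep X ∧ X.ncard = natRank M M.E := by
  refine ⟨fun h => ⟨h.indep, ?_⟩, fun h => ?_⟩
  · have := h.encard_eq_eRank
    rw [← Matroid.eRk_ground, ← cast_natRank, ← (M.set_finite X hX).cast_ncard_eq] at this
    exact_mod_cast this
  · refine h.1.isBase_of_eRk_ge (M.set_finite X hX) ?_
    rw [← Matroid.eRk_ground, ← cast_natRank, ← cast_natRank, ← h.2]
    exact_mod_cast ((indep_iff_natRank hX).1 h.1).ge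

/-- If no circuit inside `X ∪ Y` crosses between the disjoint sets `X` and `Y`, then ranks add. -/
lemma natRank_add_le_of_circuits [M.Finite] (hX : X ⊆ M.E) (hY : Y ⊆ M.E) (hXY : Disjoint X Y)
    (h : ∀ K, M.IsCircuit K → K ⊆ X ∪ Y → K ⊆ X ∨ K ⊆ Y) :
    natRank M X + natRank M Y ≤ natRank M (X ∪ Y) := by
  obtain ⟨I, hI⟩ := M.exists_isBasis X
  obtain ⟨J, hJ⟩ := M.exists_isBasis Y
  have hIJE : I ∪ J ⊆ M.E := union_subset hI.indep.subset_ground hJ.indep.subset_ground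
  have hIJ : M.Indep (I ∪ J) := by
    rw [Matroid.indep_iff_forall_subset_not_isCircuit hIJE]
    intro K hKs hK
    rcases h K hK (hKs.trans (union_subset_union hI.subset hJ.subset)) with hKX | hKY
    · refine hK.not_indep (hI.indep.subset fun x hx => (hKs hx).resolve_right fun hxJ => ?_)
      exact hXY.le_bot ⟨hKX hx, hJ.subset hxJ⟩
    · refine hK.not_indep (hJ.indep.subset fun x hx => (hKs hx).resolve_left fun hxI => ?_)
      exact hXY.le_bot ⟨hI.subset hxI, hKY hx⟩
  have e1 : natRank M X + natRank M Y = natRank M (I ∪ J) := by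
    have h1 : natRank M X = I.ncard := by
      rw [← (indep_iff_natRank hI.indep.subset_ground).1 hI.indep, natRank, natRank, hI.eRk_eq_eRk]
    have h2 : natRank M Y = J.ncard := by
      rw [← (indep_iff_natRank hJ.indep.subset_ground).1 hJ.indep, natRank, natRank, hJ.eRk_eq_eRk]
    rw [h1, h2, (indep_iff_natRank hIJE).1 hIJ, ncard_union_eq (hXY.mono hI.subset hJ.subset)
      (M.set_finite I hI.indep.subset_ground) (M.set_finite J hJ.indep.subset_ground)]
  rw [e1]
  exact natRank_mono (union_subset_union hI.subset hJ.subset)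

/-- `F` has no separation in `M`: every partition of `F` into two nonempty parts has larger total
rank than `F`. For `F ⊆ M.E` this says that `M|F` is connected. -/
def NoSeparation (M : Matroid α) (F : Set α) : Prop :=
  ∀ X ⊆ F, X.Nonempty → (F \ X).Nonempty → natRank M F < natRank M X + natRank M (F \ X)

lemma sameComponent_restrict_iff (hF : F ⊆ M.E) :
    SameComponent (M.restrict F) e f ↔ e = f ∨ ∃ C, M.IsCircuit C ∧ C ⊆ F ∧ e ∈ C ∧ f ∈ C := by
  simp only [SameComponent, Matroid.restrict_isCircuit_iff hF, and_assoc]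

lemma restrict_finite [M.Finite] (hF : F ⊆ M.E) : (M.restrict F).Finite :=
  ⟨M.set_finite F hF⟩

lemma NoSeparation.twoConnected [M.Finite] (hF : F ⊆ M.E) (h : NoSeparation M F) :
    TwoConnected (M.restrict F) := by
  intro e he f hf
  have := restrict_finite hF
  by_contra hef
  set X := component (M.restrict F) e with hX
  have hXF : X ⊆ F := fun x hx => hx.1
  have := h X hXF ⟨e, he, Or.inl rfl⟩ ⟨f, hf, fun hfX => hef hfX.2⟩
  refine this.not_ge ?_
  nth_rw 2 [← union_sdiff_cancel hXF]
  refine natRank_add_le_of_circuits (hXF.trans hF) (sdiff_subset.trans hF) disjoint_sdiff_right ?_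
  intro K hK hKs
  rw [union_sdiff_cancel hXF] at hKs
  have hK' : (M.restrict F).IsCircuit K := hK.isCircuit_restrict_of_subset hKs
  by_cases hKX : (K ∩ X).Nonempty
  · obtain ⟨a, haK, haX⟩ := hKX
    exact Or.inl fun b hb => ⟨hKs hb, haX.2.trans (Or.inr ⟨K, hK', haK, hb⟩)⟩
  · exact Or.inr fun b hb => ⟨hKs hb, fun hbX => hKX ⟨b, hb, hbX⟩⟩

lemma TwoConnected.noSeparation [M.Finite] (h : TwoConnected M) : NoSeparation M M.E := by
  rintro X hXE ⟨e, heX⟩ ⟨f, hfE, hfX⟩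
  by_contra! hle
  obtain rfl | ⟨K, hK, heK, hfK⟩ := h e (hXE heX) f hfE
  · exact hfX heX
  obtain ⟨I, hI, hKI⟩ := (hK.ssubset_indep (X := K ∩ X) ⟨inter_subset_left,
    fun h => hfX (h hfK).2⟩).subset_isBasis_of_subset inter_subset_right hXE
  obtain ⟨J, hJ, hKJ⟩ := (hK.ssubset_indep (X := K \ X) ⟨sdiff_subset,
    fun h => (h heK).2 heX⟩).subset_isBasis_of_subset
      (sdiff_subset_sdiff_left hK.subset_ground) sdiff_subset
  have hIJE : I ∪ J ⊆ M.E := union_subset hI.indep.subset_ground hJ.indep.subset_ground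
  have hr : natRank M (I ∪ J) = natRank M M.E := by
    rw [natRank, natRank, hI.eRk_eq_eRk_union, union_comm, hJ.eRk_eq_eRk_union, union_comm,
      union_sdiff_cancel hXE]
  have h1 : natRank M X = I.ncard := by
    rw [← (indep_iff_natRank hI.indep.subset_ground).1 hI.indep, natRank, natRank, hI.eRk_eq_eRk]
  have h2 : natRank M (M.E \ X) = J.ncard := by
    rw [← (indep_iff_natRank hJ.indep.subset_ground).1 hJ.indep, natRank, natRank, hJ.eRk_eq_eRk]
  have h3 := ncard_union_le I J
  have h4 := natRank_le_ncard hIJE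
  refine hK.not_indep (((indep_iff_natRank hIJE).2 (by omega)).subset fun x hx => ?_)
  by_cases hxX : x ∈ X
  exacts [Or.inl (hKI ⟨hx, hxX⟩), Or.inr (hKJ ⟨hx, hxX⟩)]

lemma NoSeparation.dual [M.Finite] (h : NoSeparation M M.E) : NoSeparation M.dual M.dual.E := by
  intro X hX h1 h2
  change X ⊆ M.E at hX
  change (M.E \ X).Nonempty at h2
  change natRank M.dual M.E < _ + natRank M.dual (M.E \ X)
  have := h X hX h1 h2
  have a1 := natRank_dual hX
  have a2 := natRank_dual (M := M) (X := M.E \ X) sdiff_subset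
  have a3 := natRank_dual (M := M) (X := M.E) subset_rfl
  rw [sdiff_sdiff_cancel_left hX] at a2
  have a4 := ncard_sdiff_add_ncard_of_subset hX (M.set_finite M.E)
  have a5 : natRank M (M.E \ M.E) = 0 := by simp [natRank]
  omega

lemma TwoConnected.dual [M.Finite] (h : TwoConnected M) : TwoConnected M.dual := by
  have := h.noSeparation.dual.twoConnected subset_rfl
  rwa [Matroid.restrict_ground_eq_self] at this

/-- If `F` is connected in a connected matroid and `K` is a separator of the contraction `M / F`,
then `F` together with the other separators is connected as well. -/
lemma NoSeparation.compl_separator [M.Finite] (hM : NoSeparation M M.E) (hFE : F ⊆ M.E)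
    (hF : NoSeparation M F) (hF0 : F.Nonempty) (hK : K ⊆ M.E \ F)
    (hle : natRank M (M.E \ K) + natRank M (F ∪ K) ≤ natRank M F + natRank M M.E) :
    NoSeparation M (M.E \ K) := by
  have hFK : Disjoint F K := disjoint_left.2 fun x hx hxK => (hK hxK).2 hx
  have hKE : K ⊆ M.E := hK.trans sdiff_subset
  have hFF' : F ⊆ M.E \ K := fun x hx => ⟨hFE hx, fun hxK => (hK hxK).2 hx⟩
  -- One of the two sides of a separation contains all of `F`.
  have key : ∀ X ⊆ M.E \ K, F ⊆ X → ((M.E \ K) \ X).Nonempty →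
      natRank M (M.E \ K) < natRank M X + natRank M ((M.E \ K) \ X) := by
    intro X hX hFX hY
    by_contra! hcon
    have h1 := natRank_submod (M := M) (F ∪ K) X
    have e1 : (F ∪ K) ∩ X = F := by
      ext x
      have := @hX x
      have := @hFX x
      simp only [mem_inter_iff, mem_union, mem_sdiff] at *
      tauto
    have h2 := hM ((M.E \ K) \ X) (sdiff_subset.trans sdiff_subset) hY
    have e2 : M.E \ ((M.E \ K) \ X) = F ∪ K ∪ X := by
      ext x
      have := @hX x
      have := @hFX x
      have := @hFE x
      have := @hKE x
      simp only [mem_union, mem_sdiff] at *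
      tauto
    rw [e1] at h1
    rw [e2] at h2
    have := h2 (hF0.mono fun x hx => Or.inl (Or.inl hx))
    omega
  intro X hX hX0 hY0
  by_cases hFX : F ⊆ X
  · exact key X hX hFX hY0
  by_cases hFY : F ⊆ (M.E \ K) \ X
  · have := key _ sdiff_subset hFY
    rw [sdiff_sdiff_cancel_left hX] at this
    rw [add_comm]
    exact this hX0
  by_contra! hcon
  set Y := (M.E \ K) \ X with hY
  have hXF' : (F ∩ X).Nonempty := by
    by_contra hne
    refine hFY fun x hx => ⟨hFF' hx, fun hxX => hne ⟨x, hx, hxX⟩⟩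
  have hYF' : (F \ (F ∩ X)).Nonempty := by
    by_contra hne
    refine hFX fun x hx => ?_
    by_contra hxX
    exact hne ⟨x, hx, fun h => hxX h.2⟩
  have h0 := hF (F ∩ X) inter_subset_left hXF' hYF'
  have h1 := natRank_submod (M := M) F Y
  have h2 := natRank_submod (M := M) (F ∪ Y) X
  have e1 : F \ (F ∩ X) = F ∩ Y := by
    ext x
    have := @hFF' x
    simp only [hY, mem_inter_iff, mem_sdiff] at *
    tauto
  have e2 : (F ∪ Y) ∩ X = F ∩ X := by
    ext x
    simp only [hY, mem_inter_iff, mem_sdiff, mem_union] at *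
    tauto
  have e3 : F ∪ Y ∪ X = M.E \ K := by
    ext x
    have := @hFF' x
    have := @hX x
    simp only [hY, mem_sdiff, mem_union] at *
    tauto
  rw [e1] at h0
  rw [e2, e3] at h2
  omega

/-! ### Bases of connected matroids without locked subsets -/

/-- A connected restriction of rank at most one meets `B` in at most its rank, provided that `B`
contains no two parallel elements. -/
lemma ncard_inter_le_natRank_of_le_one [M.Finite] (hM : TwoConnected M) (hFE : F ⊆ M.E)
    (hF : TwoConnected (M.restrict F)) (hr : natRank M F ≤ 1) (hB : B ⊆ M.E)
    (hBr : B.ncard = natRank M M.E) (hP : ∀ e ∈ B, ∀ f ∈ B, Parallel M e f → e = f) :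
    (B ∩ F).ncard ≤ natRank M F := by
  have hfin : (B ∩ F).Finite := M.set_finite _ (inter_subset_left.trans hB)
  have h1 : (B ∩ F).ncard ≤ 1 := by
    rw [ncard_le_one hfin]
    rintro e ⟨heB, heF⟩ f ⟨hfB, hfF⟩
    rcases (sameComponent_restrict_iff hFE).1 (hF e heF f hfF) with h | ⟨C, hC, hCF, heC, hfC⟩
    · exact h
    by_contra hne
    have hc := natRank_circuit hC
    have hm := natRank_mono (M := M) hCF
    have hCef : {e, f} = C := by
      refine eq_of_subset_of_ncard_le (insert_subset heC (singleton_subset_iff.2 hfC)) ?_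
        (M.set_finite C hC.subset_ground)
      rw [ncard_pair hne]
      omega
    exact hne (hP e heB f hfB (Or.inr (hCef ▸ hC)))
  by_contra! hlt
  obtain ⟨e, heB, heF⟩ : (B ∩ F).Nonempty := nonempty_of_ncard_ne_zero (by omega)
  have h0 : natRank M F = 0 := by omega
  have he0 : natRank M {e} = 0 := by
    have := natRank_mono (M := M) (singleton_subset_iff.2 heF)
    omega
  -- An element of rank zero is a loop, so it is the only element of the connected matroid `M`.
  have hE : M.E = {e} := by
    refine Subset.antisymm (fun f hf => ?_) (singleton_subset_iff.2 (hB heB))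
    rcases hM e (hB heB) f hf with rfl | ⟨C, hC, heC, hfC⟩
    · rfl
    by_contra hne
    have hind : M.Indep {e} :=
      hC.ssubset_indep ⟨singleton_subset_iff.2 heC, fun h => hne (h hfC)⟩
    rw [indep_iff_natRank (singleton_subset_iff.2 (hB heB)), he0] at hind
    simp at hind
  rw [hE, he0, ncard_eq_zero (M.set_finite B hB)] at hBr
  simp [hBr] at heB

/-- If `F` is maximal among the connected sets that violate the rank bound, then the complement of
`F` is connected in the dual. -/
lemma noSeparation_dual_compl [M.Finite] (hM : NoSeparation M M.E) (hFE : F ⊆ M.E)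
    (hF : NoSeparation M F) (hF0 : F.Nonempty)
    (hmax : ∀ F' ⊆ M.E, F ⊂ F' → NoSeparation M F' → natRank M F' < (B ∩ F').ncard → False)
    (hB : B ⊆ M.E) (hBr : B.ncard = natRank M M.E) (hv : natRank M F < (B ∩ F).ncard) :
    NoSeparation M.dual (M.E \ F) := by
  have hBfin : B.Finite := M.set_finite B hB
  -- Neither side of a separation of the dual restriction can violate the rank bound.
  have key : ∀ K ⊆ M.E \ F, ((M.E \ F) \ K).Nonempty →
      natRank M (M.E \ K) + natRank M (F ∪ K) ≤ natRank M F + natRank M M.E →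
      (B ∩ (M.E \ K)).ncard ≤ natRank M (M.E \ K) := by
    intro K hK hK' hle
    by_contra! hlt
    refine hmax (M.E \ K) sdiff_subset ⟨fun x hx => ⟨hFE hx, fun hxK => (hK hxK).2 hx⟩, ?_⟩
      (hM.compl_separator hFE hF hF0 hK hle) hlt
    intro h
    obtain ⟨x, ⟨hxE, hxF⟩, hxK⟩ := hK'
    exact hxF (h ⟨hxE, hxK⟩)
  intro K hK hK0 hK1
  by_contra! hcon
  set K' := (M.E \ F) \ K with hK'
  have hKE : K ⊆ M.E := hK.trans sdiff_subset
  have hK'E : K' ⊆ M.E := sdiff_subset.trans sdiff_subset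
  have e1 : F ∪ K = M.E \ K' := by
    ext x
    have := @hFE x
    have := @hK x
    simp only [hK', mem_union, mem_sdiff] at *
    tauto
  have e2 : F ∪ K' = M.E \ K := by
    ext x
    have := @hFE x
    have := @hK x
    simp only [hK', mem_union, mem_sdiff] at *
    tauto
  have e3 : (M.E \ F) \ K' = K := sdiff_sdiff_cancel_left hK
  have d1 := natRank_dual (M := M) hKE
  have d2 := natRank_dual (M := M) hK'E
  have d3 := natRank_dual (M := M) (X := M.E \ F) sdiff_subset
  rw [sdiff_sdiff_cancel_left hFE] at d3
  have c1 := ncard_sdiff_add_ncard_of_subset hK (M.set_finite (M.E \ F) sdiff_subset)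
  rw [← hK'] at c1
  have hle : natRank M (M.E \ K) + natRank M (F ∪ K) ≤ natRank M F + natRank M M.E := by
    rw [e1]; omega
  have k1 := key K hK hK1 hle
  have k2 := key K' sdiff_subset (by rw [e3]; exact hK0)
    (by rw [e2, ← e1, add_comm]; exact hle)
  have c2 : (B ∩ (M.E \ K)).ncard + (B ∩ (M.E \ K')).ncard = (B ∩ F).ncard + B.ncard := by
    rw [← ncard_union_add_ncard_inter _ _ (hBfin.inter_of_left _) (hBfin.inter_of_left _), add_comm]
    congr 2
    · ext x
      have := @hFE x
      have := @hK x
      simp only [hK', mem_inter_iff, mem_sdiff] at *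
      tauto
    · ext x
      have := @hB x
      have := @hK x
      simp only [hK', mem_inter_iff, mem_sdiff, mem_union] at *
      tauto
  rw [e1] at hle
  omega

/-- In a connected matroid without locked subsets, a set of the size of a base is a base as soon as
it contains at most one element of each parallel closure and misses at most one element of each
coparallel closure. Otherwise, a connected set `F` that violates the rank bound and is maximal with
this property would be connected in the dual as well, so it would be locked. -/
theorem indep_of_parallel_of_coparallel [M.Finite] (hM : TwoConnected M)
    (hL : ∀ L, ¬ IsLockedIn M L) (hB : B ⊆ M.E) (hBr : B.ncard = natRank M M.E)
    (hP : ∀ e ∈ B, ∀ f ∈ B, Parallel M e f → e = f)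
    (hS : ∀ e ∈ M.E \ B, ∀ f ∈ M.E \ B, Coparallel M e f → e = f) : M.Indep B := by
  by_contra hBi
  have hBfin : B.Finite := M.set_finite B hB
  have hMs := hM.noSeparation
  -- A violating set of minimal size has no separation.
  have hex : ∃ n F, F ⊆ M.E ∧ natRank M F < (B ∩ F).ncard ∧ F.ncard = n :=
    ⟨_, B, hB, by
      have h1 := natRank_le_ncard hB
      have h2 := mt (indep_iff_natRank hB).2 hBi
      rw [inter_self]; omega, rfl⟩
  classical
  obtain ⟨F₀, hF₀E, hF₀v, hF₀n⟩ := Nat.find_spec hex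
  have hF₀s : NoSeparation M F₀ := by
    intro X hX hX0 hX1
    by_contra! hle
    have hmin : ∀ Z ⊂ F₀, (B ∩ Z).ncard ≤ natRank M Z := by
      intro Z hZ
      by_contra! hlt
      refine Nat.find_min hex ?_ ⟨Z, hZ.1.trans hF₀E, hlt, rfl⟩
      rw [← hF₀n]
      exact ncard_lt_ncard hZ (M.set_finite F₀ hF₀E)
    have h1 := hmin X ⟨hX, fun h => by obtain ⟨x, hx, hx'⟩ := hX1; exact hx' (h hx)⟩
    have h2 := hmin (F₀ \ X) ⟨sdiff_subset, fun h => by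
      obtain ⟨x, hx⟩ := hX0; exact (h (hX hx)).2 hx⟩
    have h3 : (B ∩ F₀).ncard ≤ (B ∩ X).ncard + (B ∩ (F₀ \ X)).ncard := by
      refine le_trans (ncard_le_ncard ?_ ((hBfin.inter_of_left _).union (hBfin.inter_of_left _)))
        (ncard_union_le _ _)
      intro x hx
      by_cases hxX : x ∈ X
      exacts [Or.inl ⟨hx.1, hxX⟩, Or.inr ⟨hx.1, hx.2, hxX⟩]
    omega
  have hfin : {F | F ⊆ M.E ∧ NoSeparation M F ∧ natRank M F < (B ∩ F).ncard}.Finite :=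
    (M.set_finite M.E).finite_subsets.subset fun F hF => hF.1
  obtain ⟨F, ⟨hFE, hFs, hFv⟩, hFmax⟩ := hfin.exists_maximal ⟨F₀, hF₀E, hF₀s, hF₀v⟩
  have hF0 : F.Nonempty := by
    rw [nonempty_iff_ne_empty]
    rintro rfl
    simp at hFv
  have hFd : NoSeparation M.dual (M.E \ F) :=
    noSeparation_dual_compl hMs hFE hFs hF0
      (fun F' h1 h2 h3 h4 => h2.not_subset (hFmax ⟨h1, h3, h4⟩ h2.1)) hB hBr hFv
  have hFc := hFs.twoConnected hFE
  have hFdc := hFd.twoConnected (M := M.dual) sdiff_subset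
  have hrk : natRank M F ≤ 1 ∨ natRank M.dual (M.E \ F) ≤ 1 := by
    by_contra! hcon
    refine hL F ⟨hFE, hFc, hFdc, ?_, ?_⟩
    · rw [← cast_natRank]; exact_mod_cast hcon.1
    · rw [← cast_natRank]; exact_mod_cast hcon.2
  rcases hrk with hr | hr
  · have := ncard_inter_le_natRank_of_le_one hM hFE hFc hr hB hBr hP
    omega
  · have d1 := natRank_dual (M := M) (X := M.E) subset_rfl
    have d2 := natRank_dual (M := M) (X := M.E \ F) sdiff_subset
    rw [sdiff_sdiff_cancel_left hFE] at d2
    have a5 : natRank M (M.E \ M.E) = 0 := by simp [natRank]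
    have a4 := ncard_sdiff_add_ncard_of_subset hB (M.set_finite M.E)
    have := ncard_inter_le_natRank_of_le_one (M := M.dual) (B := M.E \ B) hM.dual
      (F := M.E \ F) sdiff_subset hFdc hr sdiff_subset
      (by change (M.E \ B).ncard = natRank M.dual M.E; omega) hS
    have c1 : ((M.E \ B) ∩ (M.E \ F)).ncard + B.ncard = (B ∩ F).ncard + (M.E \ F).ncard := by
      have g1 := ncard_union_add_ncard_inter ((M.E \ B) ∩ (M.E \ F)) B
        (M.set_finite _ (inter_subset_left.trans sdiff_subset)) hBfin
      have g2 := ncard_union_add_ncard_inter (B ∩ F) (M.E \ F)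
        (hBfin.inter_of_left _) (M.set_finite _ sdiff_subset)
      have s1 : (M.E \ B) ∩ (M.E \ F) ∩ B = ∅ := by
        ext x; simp only [mem_inter_iff, mem_sdiff, mem_empty_iff_false]; tauto
      have s2 : (B ∩ F) ∩ (M.E \ F) = ∅ := by
        ext x; simp only [mem_inter_iff, mem_sdiff, mem_empty_iff_false]; tauto
      have s3 : (M.E \ B) ∩ (M.E \ F) ∪ B = (B ∩ F) ∪ (M.E \ F) := by
        ext x
        have := @hB x
        simp only [mem_inter_iff, mem_sdiff, mem_union] at *; tauto
      rw [s1, s3, ncard_empty] at g1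
      rw [s2, ncard_empty] at g2
      omega
    omega

end LockedMatroid

namespace LockedMatroid

open Set

variable {α : Type u} {β : Type v} {M : Matroid α} {N : Matroid β} {e f g : α}
  {B C F K L X Y : Set α}

/-! ### Parallel and coparallel elements -/

lemma Parallel.symm (h : Parallel M e f) : Parallel M f e := by
  rcases h with rfl | h
  exacts [Or.inl rfl, Or.inr (pair_comm e f ▸ h)]

lemma Parallel.trans (h : Parallel M e f) (h' : Parallel M f g) : Parallel M e g := by
  rcases h with rfl | h
  · exact h'
  rcases h' with rfl | h'
  · exact Or.inr h
  by_cases hef : e = f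
  · exact Or.inr (hef ▸ h')
  by_cases hfg : f = g
  · exact Or.inr (hfg ▸ h)
  by_cases heg : e = g
  · exact Or.inl heg
  have hne : ({e, f} : Set α) ≠ {f, g} := fun hs => by
    have : e ∈ ({f, g} : Set α) := hs ▸ mem_insert e _
    simp [hef, heg] at this
  obtain ⟨C, hCs, hC⟩ := h.elimination h' hne f
  have hCeg : C ⊆ {e, g} := fun x hx => by
    obtain ⟨hx1, hx2⟩ := hCs hx
    simp only [mem_union, mem_insert_iff, mem_singleton_iff] at *
    tauto
  rcases subset_pair_iff_eq.1 hCeg with rfl | rfl | rfl | rfl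
  · exact absurd hC.nonempty not_nonempty_empty
  · have := hC.eq_of_subset_isCircuit h (by simp)
    have : f ∈ ({e} : Set α) := this ▸ by simp
    exact absurd (mem_singleton_iff.1 this).symm hef
  · have := hC.eq_of_subset_isCircuit h' (by simp)
    have : f ∈ ({g} : Set α) := this ▸ by simp
    exact absurd (mem_singleton_iff.1 this) hfg
  · exact Or.inr hC

lemma Parallel.sameComponent (h : Parallel M e f) : SameComponent M e f := by
  rcases h with rfl | h
  exacts [Or.inl rfl, Or.inr ⟨_, h, by simp, by simp⟩]

/-- Two elements form a series pair iff they lie in the same circuits and in at least one. -/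
lemma isCircuit_dual_pair_iff (hne : e ≠ f) : M.dual.IsCircuit {e, f} ↔
    f ∈ M.E ∧ (∃ K, M.IsCircuit K ∧ e ∈ K) ∧ ∀ K, M.IsCircuit K → (e ∈ K ↔ f ∈ K) := by
  constructor
  · intro h
    have hK : M.IsCocircuit {e, f} := h
    have hsub : ({e, f} : Set α) ⊆ M.E := hK.subset_ground
    refine ⟨hsub (by simp), ?_, fun K hKc => ⟨fun he => ?_, fun hf => ?_⟩⟩
    · have hi : M.dual.Indep {e} := h.ssubset_indep
        ⟨by simp, fun hs => hne (hs (by simp : f ∈ ({e, f} : Set α))).symm⟩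
      obtain ⟨B, hB, hdisj⟩ := (Matroid.dual_indep_iff_exists (hsub.trans' (by simp))).1 hi
      have heB : e ∉ B := fun h => (disjoint_left.1 hdisj rfl) h
      exact ⟨_, hB.fundCircuit_isCircuit (hsub (by simp)) heB, M.mem_fundCircuit e B⟩
    · by_contra hf
      refine hKc.inter_isCocircuit_ne_singleton hK (e := e) ?_
      ext x
      simp only [mem_inter_iff, mem_insert_iff, mem_singleton_iff]
      constructor
      · rintro ⟨hx, rfl | rfl⟩
        exacts [rfl, absurd hx hf]
      · rintro rfl
        exact ⟨he, Or.inl rfl⟩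
    · by_contra he
      refine hKc.inter_isCocircuit_ne_singleton hK (e := f) ?_
      ext x
      simp only [mem_inter_iff, mem_insert_iff, mem_singleton_iff]
      constructor
      · rintro ⟨hx, rfl | rfl⟩
        exacts [absurd hx he, rfl]
      · rintro rfl
        exact ⟨hf, Or.inr rfl⟩
  · rintro ⟨hfE, ⟨K, hK, heK⟩, hiff⟩
    have hfK : f ∈ K := (hiff K hK).1 heK
    have hpE : ({e, f} : Set α) ⊆ M.E := by
      rintro x (rfl | rfl)
      exacts [hK.subset_ground heK, hfE]
    have hd : M.dual.Dep {e, f} := by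
      rw [← Matroid.not_indep_iff (M := M.dual) hpE, Matroid.dual_indep_iff_exists hpE]
      rintro ⟨B, hB, hdisj⟩
      have heB : e ∉ B := disjoint_left.1 hdisj (by simp)
      have hfB : f ∉ B := disjoint_left.1 hdisj (by simp)
      have hc := hB.fundCircuit_isCircuit (hpE (by simp)) heB
      rcases M.fundCircuit_subset_insert e B ((hiff _ hc).1 (M.mem_fundCircuit e B)) with h | h
      exacts [hne h.symm, hfB h]
    obtain ⟨D, hDs, hD⟩ := hd.exists_isCircuit_subset
    rcases subset_pair_iff_eq.1 hDs with rfl | rfl | rfl | rfl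
    · exact absurd hD.nonempty not_nonempty_empty
    · exact absurd (inter_eq_self_of_subset_right (singleton_subset_iff.2 heK))
        (hK.inter_isCocircuit_ne_singleton hD)
    · exact absurd (inter_eq_self_of_subset_right (singleton_subset_iff.2 hfK))
        (hK.inter_isCocircuit_ne_singleton hD)
    · exact hD

lemma Coparallel.sameComponent (h : Coparallel M e f) : SameComponent M e f := by
  rcases h with rfl | h
  · exact Or.inl rfl
  by_cases hne : e = f
  · exact Or.inl hne
  obtain ⟨-, ⟨K, hK, he⟩, hiff⟩ := (isCircuit_dual_pair_iff hne).1 h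
  exact Or.inr ⟨K, hK, he, (hiff K hK).1 he⟩

/-- If an element has both a parallel and a coparallel partner, then the partners agree and the two
elements form a component. -/
lemma eq_of_parallel_of_coparallel (hf : Parallel M e f) (hef : e ≠ f) (hg : Coparallel M e g)
    (heg : e ≠ g) : f = g ∧ ∀ x, SameComponent M e x → x = e ∨ x = f := by
  have hc : M.IsCircuit {e, f} := hf.resolve_left hef
  have hd := (isCircuit_dual_pair_iff heg).1 (hg.resolve_left heg)
  have hfg : f = g := by
    have := (hd.2.2 _ hc).1 (by simp)
    simp only [mem_insert_iff, mem_singleton_iff] at this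
    rcases this with h | h
    exacts [absurd h.symm heg, h.symm]
  refine ⟨hfg, ?_⟩
  rintro x (rfl | ⟨K, hK, heK, hxK⟩)
  · exact Or.inl rfl
  have hgK := (hd.2.2 K hK).1 heK
  have : ({e, f} : Set α) = K := hc.eq_of_subset_isCircuit hK
    (insert_subset heK (singleton_subset_iff.2 (hfg ▸ hgK)))
  rw [← this] at hxK
  simpa using hxK

theorem parallelClosure_or_coparallelClosure_eq_singleton (hM : TwoConnected M)
    (hE : M.E.ncard ≠ 2) (he : e ∈ M.E) :
    parallelClosure M e = {e} ∨ coparallelClosure M e = {e} := by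
  by_contra! hcon
  have hp : e ∈ parallelClosure M e := ⟨he, Or.inl rfl⟩
  have hs : e ∈ coparallelClosure M e := ⟨he, Or.inl rfl⟩
  obtain ⟨f, hf, hfe⟩ : ∃ f ∈ parallelClosure M e, f ≠ e := by
    by_contra! h
    exact hcon.1 (Subset.antisymm h (singleton_subset_iff.2 hp))
  obtain ⟨g, hg, hge⟩ : ∃ f ∈ coparallelClosure M e, f ≠ e := by
    by_contra! h
    exact hcon.2 (Subset.antisymm h (singleton_subset_iff.2 hs))
  have key := eq_of_parallel_of_coparallel hf.2 hfe.symm hg.2 hge.symm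
  refine hE ?_
  rw [← ncard_pair hfe.symm]
  congr 1
  refine Subset.antisymm (fun x hx => ?_) (insert_subset he (singleton_subset_iff.2 hf.1))
  simpa using key.2 x (hM e he x hx)

/-! ### Bases of arbitrary matroids without locked subsets -/

lemma mem_component_self (he : e ∈ M.E) : e ∈ component M e := ⟨he, Or.inl rfl⟩

lemma component_subset_ground : component M e ⊆ M.E := fun _ h => h.1

lemma isCircuit_subset_component (hC : M.IsCircuit C) (he : e ∈ C) : C ⊆ component M e :=
  fun _ hx => ⟨hC.subset_ground hx, Or.inr ⟨C, hC, he, hx⟩⟩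

lemma twoConnected_restrict_component [M.Finite] :
    TwoConnected (M.restrict (component M e)) := by
  intro x hx y hy
  rw [sameComponent_restrict_iff component_subset_ground]
  rcases hx.2.symm.trans hy.2 with h | ⟨C, hC, hxC, hyC⟩
  · exact Or.inl h
  · exact Or.inr ⟨C, hC, fun z hz => ⟨hC.subset_ground hz,
      hx.2.trans (Or.inr ⟨C, hC, hxC, hz⟩)⟩, hxC, hyC⟩

lemma coparallel_of_restrict_component [M.Finite] {x y : α} (hx : x ∈ component M e)
    (h : Coparallel (M.restrict (component M e)) x y) : Coparallel M x y := by
  by_cases hne : x = y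
  · exact Or.inl hne
  obtain ⟨hy, ⟨K, hK, hxK⟩, hiff⟩ := (isCircuit_dual_pair_iff hne).1 (h.resolve_left hne)
  refine Or.inr ((isCircuit_dual_pair_iff hne).2 ⟨hy.1,
    ⟨K, ((Matroid.restrict_isCircuit_iff component_subset_ground).1 hK).1, hxK⟩, fun D hD => ?_⟩)
  by_cases hDs : D ⊆ component M e
  · exact hiff D (hD.isCircuit_restrict_of_subset hDs)
  -- A circuit through an element of the component stays inside the component.
  have aux : ∀ z ∈ component M e, z ∉ D := fun z hz hzD => hDs fun w hw =>
    ⟨hD.subset_ground hw, hz.2.trans (Or.inr ⟨D, hD, hzD, hw⟩)⟩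
  exact ⟨fun h => absurd h (aux x hx), fun h => absurd h (aux y hy)⟩

lemma ncard_inter_component_of_isBase [M.Finite] (hB : M.IsBase B) :
    (B ∩ component M e).ncard = natRank M (component M e) := by
  have hC : component M e ⊆ M.E := component_subset_ground
  have h1 : natRank M (component M e) + natRank M (M.E \ component M e) ≤ natRank M M.E := by
    conv_rhs => rw [← union_sdiff_cancel hC]
    refine natRank_add_le_of_circuits hC sdiff_subset disjoint_sdiff_right fun K hK _ => ?_
    by_cases h : ∃ x ∈ K, x ∈ component M e
    · obtain ⟨x, hxK, hx⟩ := h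
      exact Or.inl fun y hy => ⟨hK.subset_ground hy, hx.2.trans (Or.inr ⟨K, hK, hxK, hy⟩)⟩
    · push Not at h
      exact Or.inr fun y hy => ⟨hK.subset_ground hy, h y hy⟩
  have h2 := ((isBase_iff_natRank hB.subset_ground).1 hB).2
  have i1 := (indep_iff_natRank (inter_subset_left.trans hB.subset_ground)).1
    (hB.indep.subset (inter_subset_left (t := component M e)))
  have i2 := (indep_iff_natRank (sdiff_subset.trans hB.subset_ground)).1
    (hB.indep.subset (sdiff_subset (t := component M e)))
  have h3 := ncard_inter_add_ncard_sdiff_eq_ncard B (component M e)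
    (M.set_finite B hB.subset_ground)
  have h4 : natRank M (B ∩ component M e) ≤ _ := natRank_mono inter_subset_right
  have h5 : natRank M (B \ component M e) ≤ _ :=
    natRank_mono (sdiff_subset_sdiff_left hB.subset_ground)
  omega

lemma eq_of_parallel_of_indep (hB : M.Indep B) (he : e ∈ B) (hf : f ∈ B) (h : Parallel M e f) :
    e = f :=
  h.resolve_right fun hc => hc.not_indep (hB.subset (insert_subset he (singleton_subset_iff.2 hf)))

/-- The locked structure (components with their ranks, parallel and coparallel closures) of a
matroid without locked subsets determines its bases. -/
theorem ZeroLocked.isBase_iff [M.Finite] (hM : ZeroLocked M) (hB : B ⊆ M.E) : M.IsBase B ↔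
    (∀ e ∈ M.E, (B ∩ component M e).ncard = natRank M (component M e)) ∧
    (∀ e ∈ B, ∀ f ∈ B, Parallel M e f → e = f) ∧
    (∀ e ∈ M.E \ B, ∀ f ∈ M.E \ B, Coparallel M e f → e = f) := by
  refine ⟨fun h => ⟨fun e _ => ncard_inter_component_of_isBase h, fun e he f hf =>
    eq_of_parallel_of_indep h.indep he hf, fun e he f hf =>
      eq_of_parallel_of_indep h.compl_isBase_dual.indep he hf⟩, fun ⟨hr, hP, hS⟩ => ?_⟩
  have hBi : M.Indep B := by
    rw [Matroid.indep_iff_forall_subset_not_isCircuit hB]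
    intro K hKB hK
    obtain ⟨e, heK⟩ := hK.nonempty
    have heE := hK.subset_ground heK
    have hC : component M e ⊆ M.E := component_subset_ground
    have hKC := isCircuit_subset_component hK heK
    have := restrict_finite (M := M) hC
    refine (hK.isCircuit_restrict_of_subset hKC).not_indep
      ((indep_of_parallel_of_coparallel (B := B ∩ component M e)
      twoConnected_restrict_component (fun L hL => ?_) inter_subset_right ?_ ?_ ?_).subset
        (subset_inter hKB hKC))
    · exact (eq_empty_iff_forall_notMem.1 hM) L ⟨e, heE, hL⟩
    · rw [hr e heE, natRank, natRank]
      congr 1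
      exact (M.restrict_eRk_eq subset_rfl).symm
    · rintro x ⟨hx, -⟩ y ⟨hy, -⟩ h
      refine hP x hx y hy (h.imp_right fun h => ?_)
      exact ((Matroid.restrict_isCircuit_iff hC).1 h).1
    · rintro x ⟨hx, hxB⟩ y ⟨hy, hyB⟩ h
      exact hS x ⟨hx.1, fun h => hxB ⟨h, hx⟩⟩ y ⟨hy.1, fun h => hyB ⟨h, hy⟩⟩
        (coparallel_of_restrict_component hx h)
  obtain ⟨B', hB', hBB'⟩ := hBi.exists_isBase_superset
  have : B = B' := by
    refine Subset.antisymm hBB' fun x hx => ?_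
    have hxE := hB'.subset_ground hx
    have h1 := hr x hxE
    rw [← ncard_inter_component_of_isBase hB'] at h1
    have := eq_of_subset_of_ncard_le (inter_subset_inter_left (component M x) hBB') h1.ge
      (M.set_finite _ (inter_subset_left.trans hB'.subset_ground))
    have hx' : x ∈ B' ∩ component M x := ⟨hx, mem_component_self hxE⟩
    rw [← this] at hx'
    exact hx'.1
  exact this ▸ hB'

/-! ### Isomorphism in terms of the locked structure

Both matroids are labelled by one index type `ι`, through injections onto their ground sets. -/

section Labelled

variable {ι : Type*} {u : ι → α} {w : ι → β} {x y : ι} {A : Set ι}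

lemma component_eq_image (hu' : range u = M.E) :
    component M (u x) = u '' {y | SameComponent M (u x) (u y)} := by
  ext z
  constructor
  · rintro ⟨hz, h⟩
    rw [← hu'] at hz
    obtain ⟨y, rfl⟩ := hz
    exact ⟨y, h, rfl⟩
  · rintro ⟨y, h, rfl⟩
    exact ⟨hu' ▸ mem_range_self y, h⟩

/-- `ZeroLocked.isBase_iff` in terms of the labels. -/
lemma isBase_image_iff [M.Finite] (hM : ZeroLocked M) (hu : Function.Injective u)
    (hu' : range u = M.E) : M.IsBase (u '' A) ↔
    (∀ x, (A ∩ {y | SameComponent M (u x) (u y)}).ncard = natRank M (component M (u x))) ∧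
    (∀ x ∈ A, ∀ y ∈ A, Parallel M (u x) (u y) → x = y) ∧
    (∀ x ∉ A, ∀ y ∉ A, Coparallel M (u x) (u y) → x = y) := by
  have hmem : ∀ x, u x ∈ M.E := fun x => hu' ▸ mem_range_self x
  rw [hM.isBase_iff (hu' ▸ image_subset_range u A), ← hu', ← image_compl_eq_range_sdiff_image hu]
  simp only [forall_mem_range, forall_mem_image, hu.eq_iff]
  refine and_congr (forall_congr' fun x => ?_) Iff.rfl
  conv_lhs => rw [component_eq_image hu', ← image_inter hu, ncard_image_of_injective _ hu]
  rw [component_eq_image hu']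

/-- Labels identify the locked structures of `M` and `N`. -/
def SameLockedStructure (M : Matroid α) (N : Matroid β) (u : ι → α) (w : ι → β) : Prop :=
  (∀ x y, SameComponent M (u x) (u y) ↔ SameComponent N (w x) (w y)) ∧
  (∀ x y, Parallel M (u x) (u y) ↔ Parallel N (w x) (w y)) ∧
  (∀ x y, Coparallel M (u x) (u y) ↔ Coparallel N (w x) (w y)) ∧
  ∀ x, M.eRk (component M (u x)) = N.eRk (component N (w x))

lemma indep_image_iff (hu' : range u = M.E) :
    M.Indep (u '' A) ↔ ∃ B, A ⊆ B ∧ M.IsBase (u '' B) := by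
  constructor
  · intro h
    obtain ⟨B, hB, hAB⟩ := h.exists_isBase_superset
    refine ⟨u ⁻¹' B, image_subset_iff.1 hAB, ?_⟩
    rwa [image_preimage_eq_of_subset (hu' ▸ hB.subset_ground)]
  · rintro ⟨B, hAB, hB⟩
    exact hB.indep.subset (image_mono hAB)

lemma isCircuit_image_iff (hu : Function.Injective u) (hu' : range u = M.E) :
    M.IsCircuit (u '' A) ↔ ¬ M.Indep (u '' A) ∧ ∀ x ∈ A, M.Indep (u '' (A \ {x})) := by
  have hs : u '' A ⊆ M.E := hu' ▸ image_subset_range u A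
  rw [Matroid.isCircuit_iff_dep_forall_sdiff_singleton_indep, Matroid.not_indep_iff hs]
  simp only [forall_mem_image, image_sdiff hu, image_singleton]

lemma sameComponent_image_iff (hu : Function.Injective u) (hu' : range u = M.E) :
    SameComponent M (u x) (u y) ↔
      x = y ∨ ∃ A : Set ι, M.IsCircuit (u '' A) ∧ x ∈ A ∧ y ∈ A := by
  rw [SameComponent, hu.eq_iff]
  refine or_congr_right ⟨?_, ?_⟩
  · rintro ⟨C, hC, hx, hy⟩
    refine ⟨u ⁻¹' C, ?_, hx, hy⟩
    rwa [image_preimage_eq_of_subset (hu' ▸ hC.subset_ground)]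
  · rintro ⟨A, hA, hx, hy⟩
    exact ⟨_, hA, mem_image_of_mem u hx, mem_image_of_mem u hy⟩

lemma dual_isBase_image_iff (hu : Function.Injective u) (hu' : range u = M.E) :
    M.dual.IsBase (u '' A) ↔ M.IsBase (u '' Aᶜ) := by
  have hs : u '' A ⊆ M.E := hu' ▸ image_subset_range u A
  rw [Matroid.dual_isBase_iff hs, ← hu', image_compl_eq_range_sdiff_image hu]

lemma eRk_image_le (hw : Function.Injective w) (hu : Function.Injective u)
    (h : ∀ A : Set ι, M.Indep (u '' A) → N.Indep (w '' A)) (A : Set ι) :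
    M.eRk (u '' A) ≤ N.eRk (w '' A) := by
  rw [Matroid.eRk_le_iff]
  intro I hI hIi
  obtain ⟨J, hJ, rfl⟩ := subset_image_iff.1 hI
  rw [hu.encard_image, ← hw.encard_image]
  exact (h J hIi).encard_le_eRk_of_subset (image_mono hJ)

lemma indep_image_iff_of_isBase_iff (hu' : range u = M.E) (hw' : range w = N.E)
    (h : ∀ A : Set ι, M.IsBase (u '' A) ↔ N.IsBase (w '' A)) :
    M.Indep (u '' A) ↔ N.Indep (w '' A) := by
  rw [indep_image_iff hu', indep_image_iff hw']
  simp only [h]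

lemma eRk_image_eq (hu : Function.Injective u) (hu' : range u = M.E)
    (hw : Function.Injective w) (hw' : range w = N.E)
    (h : ∀ A : Set ι, M.IsBase (u '' A) ↔ N.IsBase (w '' A)) (A : Set ι) :
    M.eRk (u '' A) = N.eRk (w '' A) :=
  le_antisymm (eRk_image_le hw hu (fun _ => (indep_image_iff_of_isBase_iff hu' hw' h).1) A)
    (eRk_image_le hu hw (fun _ => (indep_image_iff_of_isBase_iff hu' hw' h).2) A)

theorem sameLockedStructure_of_isBase_iff (hu : Function.Injective u) (hu' : range u = M.E)
    (hw : Function.Injective w) (hw' : range w = N.E)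
    (h : ∀ A : Set ι, M.IsBase (u '' A) ↔ N.IsBase (w '' A)) : SameLockedStructure M N u w := by
  have hi := fun A => indep_image_iff_of_isBase_iff (A := A) hu' hw' h
  have hc : ∀ A : Set ι, M.IsCircuit (u '' A) ↔ N.IsCircuit (w '' A) := fun A => by
    rw [isCircuit_image_iff hu hu', isCircuit_image_iff hw hw']
    simp only [hi]
  have hd : ∀ A : Set ι, M.dual.IsBase (u '' A) ↔ N.dual.IsBase (w '' A) := fun A => by
    rw [dual_isBase_image_iff hu hu', dual_isBase_image_iff hw hw', h]
  have hid : ∀ A : Set ι, M.dual.Indep (u '' A) ↔ N.dual.Indep (w '' A) := fun A => by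
    rw [indep_image_iff (M := M.dual) hu', indep_image_iff (M := N.dual) hw']
    simp only [hd]
  have hcd : ∀ A : Set ι, M.dual.IsCircuit (u '' A) ↔ N.dual.IsCircuit (w '' A) := fun A => by
    rw [isCircuit_image_iff (M := M.dual) hu hu', isCircuit_image_iff (M := N.dual) hw hw']
    simp only [hid]
  have hs : ∀ x y, SameComponent M (u x) (u y) ↔ SameComponent N (w x) (w y) := fun x y => by
    rw [sameComponent_image_iff hu hu', sameComponent_image_iff hw hw']
    simp only [hc]
  refine ⟨hs, fun x y => ?_, fun x y => ?_, fun x => ?_⟩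
  · have := hc {x, y}
    rw [image_pair, image_pair] at this
    rw [Parallel, Parallel, this, hu.eq_iff, hw.eq_iff]
  · have := hcd {x, y}
    rw [image_pair, image_pair] at this
    rw [Coparallel, Coparallel, Parallel, Parallel, this, hu.eq_iff, hw.eq_iff]
  · rw [component_eq_image hu', component_eq_image hw']
    simp only [hs]
    exact eRk_image_eq hu hu' hw hw' h _

theorem isomorphic_iff_exists_sameLockedStructure [M.Finite] [N.Finite] (hM : ZeroLocked M)
    (hN : ZeroLocked N) : Isomorphic M N ↔
    ∃ φ : M.E ≃ N.E, SameLockedStructure M N (fun x : M.E => (x : α)) (fun x => (φ x : β)) := by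
  refine exists_congr fun φ => ?_
  have hu : Function.Injective (fun x : M.E => (x : α)) := Subtype.val_injective
  have hu' : range (fun x : M.E => (x : α)) = M.E := Subtype.range_coe
  have hw : Function.Injective (fun x : M.E => (φ x : β)) :=
    Subtype.val_injective.comp φ.injective
  have hw' : range (fun x : M.E => (φ x : β)) = N.E := by
    rw [show (fun x : M.E => (φ x : β)) = Subtype.val ∘ φ from rfl, φ.surjective.range_comp,
      Subtype.range_coe]
  refine ⟨sameLockedStructure_of_isBase_iff hu hu' hw hw', fun ⟨h1, h2, h3, h4⟩ A => ?_⟩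
  rw [isBase_image_iff hM hu hu', isBase_image_iff hN hw hw']
  simp only [h1, h2, h3, natRank, h4]

end Labelled

end LockedMatroid

namespace LockedMatroid

open Set

/-! ### Bijections that respect partitions

A partition of a finite type `A` is given by a function `p` on `A`; the class of `a` is the fibre of
`p a`. -/

section Partitions

variable {A B P P' Q Q' : Type*} [Finite A] [Finite B] {p : A → P} {p' : B → P'} {q : A → Q}
  {q' : B → Q'}

omit [Finite A] in
lemma exists_eq_of_one_le_ncard_fiber {x : P} (h : 1 ≤ (p ⁻¹' {x}).ncard) : ∃ a, p a = x := by
  obtain ⟨a, ha⟩ := nonempty_of_ncard_ne_zero (s := p ⁻¹' {x}) (by omega)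
  exact ⟨a, ha⟩

lemma one_le_ncard_fiber (x : range p) : 1 ≤ (p ⁻¹' {x.1}).ncard := by
  obtain ⟨_, a, rfl⟩ := x
  exact (ncard_pos (toFinite _)).2 ⟨a, rfl⟩

omit [Finite A] in
lemma card_range_fiber {k : ℕ} (hk : 1 ≤ k) :
    Nat.card {x : range p // (p ⁻¹' {x.1}).ncard = k} = {x | (p ⁻¹' {x}).ncard = k}.ncard := by
  rw [← Nat.card_coe_set_eq]
  exact Nat.card_congr ⟨fun x => ⟨x.1.1, x.2⟩,
    fun x => ⟨⟨x.1, exists_eq_of_one_le_ncard_fiber (hk.trans_eq (Eq.symm x.2))⟩, x.2⟩,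
    fun _ => rfl, fun _ => rfl⟩

/-- Partitions with the same class sizes are related by a bijection of the underlying types. -/
lemma exists_equiv_of_class_sizes
    (h : ∀ k, 1 ≤ k → {x | (p ⁻¹' {x}).ncard = k}.ncard = {x | (p' ⁻¹' {x}).ncard = k}.ncard) :
    ∃ e : A ≃ B, ∀ a b, p a = p b ↔ p' (e a) = p' (e b) := by
  have h1 : ∀ k, Nonempty ({x : range p // (p ⁻¹' {x.1}).ncard = k} ≃
      {x : range p' // (p' ⁻¹' {x.1}).ncard = k}) := by
    intro k
    refine Finite.card_eq.1 ?_
    rcases Nat.eq_zero_or_pos k with rfl | hk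
    · have : IsEmpty {x : range p // (p ⁻¹' {x.1}).ncard = 0} :=
        ⟨fun x => by have := one_le_ncard_fiber x.1; have := x.2; omega⟩
      have : IsEmpty {x : range p' // (p' ⁻¹' {x.1}).ncard = 0} :=
        ⟨fun x => by have := one_le_ncard_fiber x.1; have := x.2; omega⟩
      simp
    · rw [card_range_fiber hk, card_range_fiber hk, h k hk]
  let e₁ : range p ≃ range p' := Equiv.ofFiberEquiv fun k => (h1 k).some
  have he₁ : ∀ x, (p' ⁻¹' {(e₁ x).1}).ncard = (p ⁻¹' {x.1}).ncard :=
    fun x => Equiv.ofFiberEquiv_map (fun k => (h1 k).some) x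
  have h2 : ∀ y : range p', Nonempty ({a : A // e₁ (rangeFactorization p a) = y} ≃
      {b : B // rangeFactorization p' b = y}) := by
    intro y
    obtain ⟨x, rfl⟩ := e₁.surjective y
    refine Finite.card_eq.1 ?_
    have c1 : Nat.card {a : A // e₁ (rangeFactorization p a) = e₁ x} = (p ⁻¹' {x.1}).ncard := by
      rw [← Nat.card_coe_set_eq]
      refine Nat.card_congr (Equiv.subtypeEquivRight fun a => ?_)
      rw [e₁.injective.eq_iff, Subtype.ext_iff]
      rfl
    have c2 : Nat.card {b : B // rangeFactorization p' b = e₁ x} = (p' ⁻¹' {(e₁ x).1}).ncard := by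
      rw [← Nat.card_coe_set_eq]
      refine Nat.card_congr (Equiv.subtypeEquivRight fun a => ?_)
      rw [Subtype.ext_iff]
      rfl
    rw [c1, c2, he₁]
  refine ⟨Equiv.ofFiberEquiv fun y => (h2 y).some, fun a b => ?_⟩
  have hm := fun a => Equiv.ofFiberEquiv_map (fun y => (h2 y).some) a
  have : ∀ c d : B, p' c = p' d ↔ rangeFactorization p' c = rangeFactorization p' d :=
    fun c d => by rw [Subtype.ext_iff]; rfl
  rw [this, hm, hm, e₁.injective.eq_iff, Subtype.ext_iff]
  rfl

omit [Finite A] [Finite B] in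
/-- A bijection that respects two partitions matches their classes, sizes included. -/
lemma class_count_congr (e : A ≃ B) (he : ∀ a b, p a = p b ↔ p' (e a) = p' (e b)) (S : ℕ → Prop)
    (h0 : ¬ S 0) :
    {x | S (p ⁻¹' {x}).ncard}.ncard = {x | S (p' ⁻¹' {x}).ncard}.ncard := by
  have hsz : ∀ a, (p' ⁻¹' {p' (e a)}).ncard = (p ⁻¹' {p a}).ncard := by
    intro a
    rw [← ncard_image_of_injective _ e.injective]
    congr 1
    ext b
    obtain ⟨b, rfl⟩ := e.surjective b
    simp [← he]
  have h1 : ∀ n, S n → 1 ≤ n := fun n hn => Nat.one_le_iff_ne_zero.2 fun h => h0 (h ▸ hn)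
  choose f hf using fun x (hx : S (p ⁻¹' {x}).ncard) =>
    exists_eq_of_one_le_ncard_fiber (h1 _ hx)
  refine ncard_congr (fun x hx => p' (e (f x hx))) (fun x hx => ?_) (fun x y hx hy hxy => ?_)
    (fun y hy => ?_)
  · simpa only [mem_ofPred_eq, hsz, hf x hx] using hx
  · rwa [← he, hf x hx, hf y hy] at hxy
  · obtain ⟨b, rfl⟩ := exists_eq_of_one_le_ncard_fiber (h1 _ hy)
    obtain ⟨a, rfl⟩ := e.surjective b
    have hx : S (p ⁻¹' {p a}).ncard := by
      rw [← hsz]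
      exact hy
    exact ⟨p a, hx, (he _ _).1 (hf _ hx)⟩

/-- If both partitions are trivial, then any bijection respects them. -/
lemma exists_equiv_of_degenerate
    (hp : ∀ k, 1 ≤ k → {x | (p ⁻¹' {x}).ncard = k}.ncard = {x | (p' ⁻¹' {x}).ncard = k}.ncard)
    (hq : ∀ k, 1 ≤ k → {x | (q ⁻¹' {x}).ncard = k}.ncard = {x | (q' ⁻¹' {x}).ncard = k}.ncard)
    (h : ∀ a b, p a = p b ∧ q a = q b) :
    ∃ e : A ≃ B, (∀ a b, p a = p b ↔ p' (e a) = p' (e b)) ∧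
      ∀ a b, q a = q b ↔ q' (e a) = q' (e b) := by
  obtain ⟨e, he⟩ := exists_equiv_of_class_sizes hp
  obtain ⟨e', he'⟩ := exists_equiv_of_class_sizes hq
  refine ⟨e, he, fun a b => iff_of_true (h a b).2 ?_⟩
  obtain ⟨c, hc⟩ := e'.surjective (e a)
  obtain ⟨d, hd⟩ := e'.surjective (e b)
  rw [← hc, ← hd, ← he']
  exact (h c d).2

/-- The class of `a` has elements other than `a`. -/
def InNontrivialClass (p : A → P) (a : A) : Prop := ∃ b, p a = p b ∧ a ≠ b

omit [Finite A] [Finite B] in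
lemma inNontrivialClass_iff (e : A ≃ B) (he : ∀ a b, p a = p b ↔ p' (e a) = p' (e b)) (a : A) :
    InNontrivialClass p' (e a) ↔ InNontrivialClass p a := by
  simp only [InNontrivialClass, ← e.exists_congr_right, ← he, ne_eq, e.injective.eq_iff]

lemma card_option_bool_fibers (col : A → Option Bool) :
    Nat.card {a // col a = some true} + Nat.card {a // col a = some false} +
      Nat.card {a // col a = none} = Nat.card A := by
  rw [← Nat.card_congr (Equiv.sigmaFiberEquiv col), Nat.card_sigma, Fintype.sum_option,
    Fintype.sum_bool]
  omega

/-- Two pairs of partitions with the same class sizes are related by one bijection, if every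
element is a singleton class of one partition of the pair. -/
lemma exists_equiv_of_singletons
    (hp : ∀ k, 1 ≤ k → {x | (p ⁻¹' {x}).ncard = k}.ncard = {x | (p' ⁻¹' {x}).ncard = k}.ncard)
    (hq : ∀ k, 1 ≤ k → {x | (q ⁻¹' {x}).ncard = k}.ncard = {x | (q' ⁻¹' {x}).ncard = k}.ncard)
    (h : ∀ a, (∀ b, p a = p b → a = b) ∨ ∀ b, q a = q b → a = b)
    (h' : ∀ a, (∀ b, p' a = p' b → a = b) ∨ ∀ b, q' a = q' b → a = b) :
    ∃ e : A ≃ B, (∀ a b, p a = p b ↔ p' (e a) = p' (e b)) ∧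
      ∀ a b, q a = q b ↔ q' (e a) = q' (e b) := by
  obtain ⟨e₁, he₁⟩ := exists_equiv_of_class_sizes hp
  obtain ⟨e₂, he₂⟩ := exists_equiv_of_class_sizes hq
  classical
  -- The elements in nontrivial classes of `p`, in nontrivial classes of `q`, and the others.
  have hn₁ := inNontrivialClass_iff e₁ he₁
  have hn₂ := inNontrivialClass_iff e₂ he₂
  have hx : ∀ a, ¬ (InNontrivialClass p a ∧ InNontrivialClass q a) := by
    rintro a ⟨⟨b, hb, hab⟩, c, hc, hac⟩
    rcases h a with h | h
    exacts [hab (h b hb), hac (h c hc)]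
  have hx' : ∀ a, ¬ (InNontrivialClass p' a ∧ InNontrivialClass q' a) := by
    rintro a ⟨⟨b, hb, hab⟩, c, hc, hac⟩
    rcases h' a with h | h
    exacts [hab (h b hb), hac (h c hc)]
  let col : A → Option Bool := fun a => if InNontrivialClass p a then some true
    else if InNontrivialClass q a then some false else none
  let col' : B → Option Bool := fun a => if InNontrivialClass p' a then some true
    else if InNontrivialClass q' a then some false else none
  have ct : ∀ a, col a = some true ↔ InNontrivialClass p a := fun a => by
    simp only [col]; split_ifs <;> simp_all
  have cf : ∀ a, col a = some false ↔ InNontrivialClass q a := fun a => by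
    have := hx a
    simp only [col]; split_ifs <;> simp_all
  have ct' : ∀ a, col' a = some true ↔ InNontrivialClass p' a := fun a => by
    simp only [col']; split_ifs <;> simp_all
  have cf' : ∀ a, col' a = some false ↔ InNontrivialClass q' a := fun a => by
    have := hx' a
    simp only [col']; split_ifs <;> simp_all
  let E₁ : {a // col a = some true} ≃ {b // col' b = some true} :=
    e₁.subtypeEquiv fun a => by rw [ct, ct', hn₁]
  let E₂ : {a // col a = some false} ≃ {b // col' b = some false} :=
    e₂.subtypeEquiv fun a => by rw [cf, cf', hn₂]
  have E₀ : Nonempty ({a // col a = none} ≃ {b // col' b = none}) := by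
    refine Finite.card_eq.1 ?_
    have k1 := card_option_bool_fibers col
    have k2 := card_option_bool_fibers col'
    have k3 := Nat.card_congr E₁
    have k4 := Nat.card_congr E₂
    have k5 := Nat.card_congr e₁
    omega
  let E : ∀ c, {a // col a = c} ≃ {b // col' b = c}
    | none => E₀.some
    | some true => E₁
    | some false => E₂
  have hE : ∀ a, col' (Equiv.ofFiberEquiv E a) = col a := Equiv.ofFiberEquiv_map E
  have hval : ∀ a c (hc : col a = c), Equiv.ofFiberEquiv E a = E c ⟨a, hc⟩ := by
    rintro a c rfl
    rfl
  have h1 : ∀ a, InNontrivialClass p a → Equiv.ofFiberEquiv E a = e₁ a :=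
    fun a ha => hval a _ ((ct a).2 ha)
  have h2 : ∀ a, InNontrivialClass q a → Equiv.ofFiberEquiv E a = e₂ a :=
    fun a ha => hval a _ ((cf a).2 ha)
  refine ⟨Equiv.ofFiberEquiv E, fun a b => ?_, fun a b => ?_⟩
  · by_cases hab : a = b
    · simp [hab]
    constructor
    · intro hpab
      rw [h1 a ⟨b, hpab, hab⟩, h1 b ⟨a, hpab.symm, Ne.symm hab⟩]
      exact (he₁ a b).1 hpab
    · intro hpab
      have hne : Equiv.ofFiberEquiv E a ≠ Equiv.ofFiberEquiv E b :=
        fun h => hab ((Equiv.ofFiberEquiv E).injective h)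
      have na : InNontrivialClass p a := by rw [← ct, ← hE, ct']; exact ⟨_, hpab, hne⟩
      have nb : InNontrivialClass p b := by rw [← ct, ← hE, ct']; exact ⟨_, hpab.symm, hne.symm⟩
      rw [h1 a na, h1 b nb] at hpab
      exact (he₁ a b).2 hpab
  · by_cases hab : a = b
    · simp [hab]
    constructor
    · intro hpab
      rw [h2 a ⟨b, hpab, hab⟩, h2 b ⟨a, hpab.symm, Ne.symm hab⟩]
      exact (he₂ a b).1 hpab
    · intro hpab
      have hne : Equiv.ofFiberEquiv E a ≠ Equiv.ofFiberEquiv E b :=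
        fun h => hab ((Equiv.ofFiberEquiv E).injective h)
      have na : InNontrivialClass q a := by rw [← cf, ← hE, cf']; exact ⟨_, hpab, hne⟩
      have nb : InNontrivialClass q b := by rw [← cf, ← hE, cf']; exact ⟨_, hpab.symm, hne.symm⟩
      rw [h2 a na, h2 b nb] at hpab
      exact (he₂ a b).2 hpab

/-- Either all elements are related by both partitions, or every element is a singleton class of
one of them. -/
def NearlyDisjoint (p : A → P) (q : A → Q) : Prop :=
  (∀ a b, p a = p b ∧ q a = q b) ∨ ∀ a, (∀ b, p a = p b → a = b) ∨ ∀ b, q a = q b → a = b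

/-- For two pairs of nearly disjoint partitions, agreement of the class sizes in both components is
enough for one bijection that respects both. -/
lemma exists_equiv_of_nearlyDisjoint
    (hp : ∀ k, 1 ≤ k → {x | (p ⁻¹' {x}).ncard = k}.ncard = {x | (p' ⁻¹' {x}).ncard = k}.ncard)
    (hq : ∀ k, 1 ≤ k → {x | (q ⁻¹' {x}).ncard = k}.ncard = {x | (q' ⁻¹' {x}).ncard = k}.ncard)
    (h : NearlyDisjoint p q) (h' : NearlyDisjoint p' q') :
    ∃ e : A ≃ B, (∀ a b, p a = p b ↔ p' (e a) = p' (e b)) ∧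
      ∀ a b, q a = q b ↔ q' (e a) = q' (e b) := by
  rcases h with h | h
  · exact exists_equiv_of_degenerate hp hq h
  rcases h' with h' | h'
  · obtain ⟨e, he1, he2⟩ := exists_equiv_of_degenerate (fun k hk => (hp k hk).symm)
      (fun k hk => (hq k hk).symm) h'
    exact ⟨e.symm, fun a b => by simp [he1], fun a b => by simp [he2]⟩
  · exact exists_equiv_of_singletons hp hq h h'

omit [Finite A] in
/-- If `pos` numbers the elements of each class from `1` on, then the number of classes of size at
least `t` is the number of elements in position `t`. -/
lemma class_count_eq_pos_count (pos : A → ℕ)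
    (hinj : ∀ a b, p a = p b → pos a = pos b → a = b)
    (hle : ∀ a, pos a ≤ (p ⁻¹' {p a}).ncard)
    (hex : ∀ a t, 1 ≤ t → t ≤ (p ⁻¹' {p a}).ncard → ∃ b, p b = p a ∧ pos b = t) {t : ℕ}
    (ht : 1 ≤ t) : {x | t ≤ (p ⁻¹' {x}).ncard}.ncard = {a | pos a = t}.ncard := by
  symm
  refine ncard_congr (fun a _ => p a) (fun a ha => ?_) (fun a b ha hb hab => ?_) (fun x hx => ?_)
  · have := hle a
    simp only [mem_ofPred_eq] at *
    omega
  · simp only [mem_ofPred_eq] at *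
    exact hinj a b hab (ha.trans hb.symm)
  · simp only [mem_ofPred_eq] at hx
    obtain ⟨a, rfl⟩ : ∃ a, p a = x := by
      by_contra hne
      have : p ⁻¹' {x} = ∅ := preimage_singleton_eq_empty.2 hne
      rw [this, ncard_empty] at hx
      omega
    obtain ⟨b, hb, hbt⟩ := hex a t ht hx
    exact ⟨b, hbt, hb⟩

lemma class_count_split {k : ℕ} (hk : 1 ≤ k) : {x | (p ⁻¹' {x}).ncard = k}.ncard +
    {x | k + 1 ≤ (p ⁻¹' {x}).ncard}.ncard = {x | k ≤ (p ⁻¹' {x}).ncard}.ncard := by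
  have hf : {x | k ≤ (p ⁻¹' {x}).ncard}.Finite :=
    (finite_range p).subset fun x hx => exists_eq_of_one_le_ncard_fiber (hk.trans hx)
  have hf₁ : {x | (p ⁻¹' {x}).ncard = k}.Finite := hf.subset fun x hx => (Eq.symm hx).le
  have hf₂ : {x | k + 1 ≤ (p ⁻¹' {x}).ncard}.Finite :=
    hf.subset fun x hx => (Nat.le_succ k).trans hx
  rw [← ncard_union_eq ?_ hf₁ hf₂]
  · congr 1
    ext x
    simp only [mem_union, mem_ofPred_eq]
    omega
  · rw [disjoint_left]
    intro x hx hx'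
    simp only [mem_ofPred_eq] at *
    omega

lemma class_count_eq_of_ge_count
    (h : ∀ t, 1 ≤ t → {x | t ≤ (p ⁻¹' {x}).ncard}.ncard = {x | t ≤ (p' ⁻¹' {x}).ncard}.ncard)
    (k : ℕ) (hk : 1 ≤ k) :
    {x | (p ⁻¹' {x}).ncard = k}.ncard = {x | (p' ⁻¹' {x}).ncard = k}.ncard := by
  have := class_count_split (p := p) hk
  have := class_count_split (p := p') hk
  have := h k hk
  have := h (k + 1) (by omega)
  omega

lemma ncard_label_fiber {C : Type*} (c : A → C) {S : Type*} (H : C → S) [Finite C] {s : S} {z : ℕ}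
    (hz : ∀ x, H x = s → Nat.card {a // c a = x} = z) :
    {a | H (c a) = s}.ncard = Nat.card {x // H x = s} * z := by
  have := Fintype.ofFinite {x // H x = s}
  have e : {a // H (c a) = s} ≃ Σ x : {x // H x = s}, {a // c a = x.1} :=
    { toFun := fun a => ⟨⟨c a.1, a.2⟩, a.1, rfl⟩
      invFun := fun y => ⟨y.2.1, by rw [y.2.2]; exact y.1.2⟩
      left_inv := fun a => rfl
      right_inv := by
        rintro ⟨⟨x, h⟩, a, ha⟩
        change c a = x at ha
        subst ha
        rfl }
  rw [← Nat.card_coe_set_eq]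
  change Nat.card {a // H (c a) = s} = _
  rw [Nat.card_congr e, Nat.card_sigma, Finset.sum_congr rfl fun x _ => hz x.1 x.2]
  simp

/-- Bijections between the blocks of two partitions glue, if the blocks carry labels that are
equally frequent, counted by elements, and blocks with the same label correspond. -/
lemma exists_equiv_of_blocks {C C' : Type*} {c : A → C} {c' : B → C'} (hc : c.Surjective)
    (hc' : c'.Surjective) {S : Type*} {H : C → S} {H' : C' → S}
    (hcount : ∀ s, {a | H (c a) = s}.ncard = {b | H' (c' b) = s}.ncard)
    (hcp : ∀ a b, p a = p b → c a = c b) (hcq : ∀ a b, q a = q b → c a = c b)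
    (hcp' : ∀ a b, p' a = p' b → c' a = c' b) (hcq' : ∀ a b, q' a = q' b → c' a = c' b)
    (hloc : ∀ x y, H x = H' y → ∃ e : {a // c a = x} ≃ {b // c' b = y},
      (∀ a b, p a.1 = p b.1 ↔ p' (e a).1 = p' (e b).1) ∧
      ∀ a b, q a.1 = q b.1 ↔ q' (e a).1 = q' (e b).1) :
    ∃ e : A ≃ B, (∀ a b, c a = c b ↔ c' (e a) = c' (e b)) ∧
      (∀ a b, p a = p b ↔ p' (e a) = p' (e b)) ∧ (∀ a b, q a = q b ↔ q' (e a) = q' (e b)) ∧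
      ∀ a, H' (c' (e a)) = H (c a) := by
  have : Finite C := Finite.of_surjective c hc
  have : Finite C' := Finite.of_surjective c' hc'
  have hblocks : ∀ s, Nonempty ({x // H x = s} ≃ {y // H' y = s}) := by
    intro s
    refine Finite.card_eq.1 ?_
    by_cases hs : ∃ a b, H (c a) = s ∧ H' (c' b) = s
    · obtain ⟨a, b, ha, hb⟩ := hs
      have hz : ∀ x, H x = s → Nat.card {a // c a = x} = Nat.card {b' // c' b' = c' b} :=
        fun x hx => Nat.card_congr (hloc x (c' b) (hx.trans hb.symm)).choose
      have hz' : ∀ y, H' y = s → Nat.card {b // c' b = y} = Nat.card {b' // c' b' = c' b} :=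
        fun y hy => by
          rw [← hz (c a) ha]
          exact (Nat.card_congr (hloc (c a) y (ha.trans hy.symm)).choose).symm
      have h1 := ncard_label_fiber c H hz
      have h2 := ncard_label_fiber c' H' hz'
      have hpos : 0 < Nat.card {b' // c' b' = c' b} :=
        Nat.card_pos_iff.2 ⟨⟨⟨b, rfl⟩⟩, inferInstance⟩
      rw [hcount, h2] at h1
      exact (Nat.eq_of_mul_eq_mul_right hpos h1).symm
    · have hA : {a | H (c a) = s} = ∅ ∧ {b | H' (c' b) = s} = ∅ := by
        rcases eq_empty_or_nonempty {a | H (c a) = s} with h1 | ⟨a, ha⟩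
        · refine ⟨h1, ?_⟩
          rw [← ncard_eq_zero, ← hcount, h1, ncard_empty]
        rcases eq_empty_or_nonempty {b | H' (c' b) = s} with h2 | ⟨b, hb⟩
        · refine ⟨?_, h2⟩
          rw [← ncard_eq_zero, hcount, h2, ncard_empty]
        exact absurd ⟨a, b, ha, hb⟩ hs
      have : IsEmpty {x // H x = s} := ⟨fun ⟨x, hx⟩ => by
        obtain ⟨a, rfl⟩ := hc x
        exact (eq_empty_iff_forall_notMem.1 hA.1) a hx⟩
      have : IsEmpty {x // H' x = s} := ⟨fun ⟨x, hx⟩ => by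
        obtain ⟨a, rfl⟩ := hc' x
        exact (eq_empty_iff_forall_notMem.1 hA.2) a hx⟩
      simp
  let E : C ≃ C' := Equiv.ofFiberEquiv fun s => (hblocks s).some
  have hE : ∀ x, H' (E x) = H x := fun x => Equiv.ofFiberEquiv_map (fun s => (hblocks s).some) x
  choose F hFp hFq using fun x => hloc x (E x) (hE x).symm
  let e : A ≃ B := (Equiv.sigmaFiberEquiv c).symm.trans
    ((Equiv.sigmaCongr E F).trans (Equiv.sigmaFiberEquiv c'))
  have he : ∀ x (a : {a // c a = x}), e a.1 = (F x a).1 := by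
    rintro _ ⟨a, rfl⟩
    rfl
  have hce : ∀ a, c' (e a) = E (c a) := fun a => by
    rw [he (c a) ⟨a, rfl⟩]
    exact (F (c a) ⟨a, rfl⟩).2
  have hcc : ∀ a b, c a = c b ↔ c' (e a) = c' (e b) := fun a b => by
    rw [hce, hce, E.injective.eq_iff]
  refine ⟨e, hcc, fun a b => ?_, fun a b => ?_, fun a => by rw [hce, hE]⟩
  · by_cases hab : c a = c b
    · rw [he (c b) ⟨a, hab⟩, he (c b) ⟨b, rfl⟩]
      exact hFp (c b) ⟨a, hab⟩ ⟨b, rfl⟩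
    · exact iff_of_false (fun h => hab (hcp a b h)) fun h => hab ((hcc a b).2 (hcp' _ _ h))
  · by_cases hab : c a = c b
    · rw [he (c b) ⟨a, hab⟩, he (c b) ⟨b, rfl⟩]
      exact hFq (c b) ⟨a, hab⟩ ⟨b, rfl⟩
    · exact iff_of_false (fun h => hab (hcq a b h)) fun h => hab ((hcc a b).2 (hcq' _ _ h))

end Partitions

/-- The parallel and the coparallel classes of elements of one component are nearly disjoint. -/
lemma nearlyDisjoint_of_sameComponent {α : Type u} {M : Matroid α} [M.Finite] {A X Y : Type*}
    {u : A → α} (hinj : Function.Injective u) {p : A → X} {q : A → Y}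
    (hp : ∀ a b, p a = p b ↔ Parallel M (u a) (u b))
    (hq : ∀ a b, q a = q b ↔ Coparallel M (u a) (u b))
    (hc : ∀ a b, SameComponent M (u a) (u b)) : NearlyDisjoint p q := by
  by_contra hcon
  rw [NearlyDisjoint, not_or] at hcon
  obtain ⟨h1, h2⟩ := hcon
  push Not at h2
  obtain ⟨a, ⟨b, hb, hab⟩, d, hd, had⟩ := h2
  obtain ⟨hbd, hall⟩ := eq_of_parallel_of_coparallel ((hp _ _).1 hb) (hinj.ne hab)
    ((hq _ _).1 hd) (hinj.ne had)
  obtain rfl := hinj hbd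
  have hall' : ∀ x, x = a ∨ x = b := fun x =>
    (hall (u x) (hc a x)).imp (fun h => hinj h) fun h => hinj h
  refine h1 fun x y => ?_
  rcases hall' x with rfl | rfl <;> rcases hall' y with rfl | rfl <;> simp [hb, hd]

end LockedMatroid

namespace LockedMatroid

/-! ### Loop-free code over a memory that is divided into lanes -/

/-- The memory seen as 64 arrays, the lanes: `s k i` is the content of the memory cell `64 * i + k`.
Cell `0` of a lane serves as a scalar variable. Lane `0` is reserved for address computations and
is not modelled. -/
abbrev Lanes := ℕ → ℕ → ℕ

/-- Write `v` into cell `i` of lane `k`. -/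
def Lanes.write (s : Lanes) (k i v : ℕ) : Lanes :=
  fun k' => if k' = k then Function.update (s k) i v else s k'

/-- The memory `m` has the contents `s` in the lanes `1` to `63`. -/
def Represents (m : ℕ → ℕ) (s : Lanes) : Prop :=
  ∀ k i, 1 ≤ k → k < 64 → m (64 * i + k) = s k i

/-- No lane contains a number above `V`. -/
def Lanes.Bounded (V : ℕ) (s : Lanes) : Prop := ∀ k i, s k i ≤ V

/-- Loop-free programs over lanes; a scalar variable is named by its lane. -/
inductive Code : Type
  /-- `v := k` -/
  | set (v k : ℕ) : Code
  /-- `x := y + z` -/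
  | add (x y z : ℕ) : Code
  /-- `x := y - z`, truncated -/
  | sub (x y z : ℕ) : Code
  /-- `x := lane k [y]` -/
  | get (x k y : ℕ) : Code
  /-- `lane k [y] := x` -/
  | put (k y x : ℕ) : Code
  /-- `x := input[j][y]` -/
  | read (x j y : ℕ) : Code
  | seq (p q : Code) : Code
  /-- if `v ≠ 0` then `p` else `q` -/
  | ite (v : ℕ) (p q : Code) : Code

namespace Code

/-- Only the lanes `1` to `63` are used. -/
def WellFormed : Code → Bool
  | set v _ => (1 ≤ v) && (v < 64)
  | add x y z => (1 ≤ x) && (x < 64) && (1 ≤ y) && (y < 64) && (1 ≤ z) && (z < 64)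
  | sub x y z => (1 ≤ x) && (x < 64) && (1 ≤ y) && (y < 64) && (1 ≤ z) && (z < 64)
  | get x k y => (1 ≤ x) && (x < 64) && (1 ≤ k) && (k < 64) && (1 ≤ y) && (y < 64)
  | put k y x => (1 ≤ x) && (x < 64) && (1 ≤ k) && (k < 64) && (1 ≤ y) && (y < 64)
  | read x _ y => (1 ≤ x) && (x < 64) && (1 ≤ y) && (y < 64)
  | seq p q => p.WellFormed && q.WellFormed
  | ite v p q => (1 ≤ v) && (v < 64) && p.WellFormed && q.WellFormed

/-- The effect of a loop-free program on the lanes. -/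
def eval (input : ℕ → ℕ → ℕ) : Code → Lanes → Lanes
  | set v k, s => s.write v 0 k
  | add x y z, s => s.write x 0 (s y 0 + s z 0)
  | sub x y z, s => s.write x 0 (s y 0 - s z 0)
  | get x k y, s => s.write x 0 (s k (s y 0))
  | put k y x, s => s.write k (s y 0) (s x 0)
  | read x j y, s => s.write x 0 (input j (s y 0))
  | seq p q, s => q.eval input (p.eval input s)
  | ite v p q, s => if s v 0 ≠ 0 then p.eval input s else q.eval input s

/-- No instruction writes a number above `V`, if the program starts with lanes bounded by `V`. Only
constants, sums and inputs have to be checked, since the other instructions do not enlarge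
numbers. -/
def Safe (V : ℕ) (input : ℕ → ℕ → ℕ) : Code → Lanes → Prop
  | set _ k, _ => k ≤ V
  | add _ y z, s => s y 0 + s z 0 ≤ V
  | sub _ _ _, _ => True
  | get _ _ _, _ => True
  | put _ _ _, _ => True
  | read _ j y, s => input j (s y 0) ≤ V
  | seq p q, s => p.Safe V input s ∧ q.Safe V input (p.eval input s)
  | ite v p q, s => if s v 0 ≠ 0 then p.Safe V input s else q.Safe V input s

/-- A bound for the number of machine steps. -/
def cost : Code → ℕ
  | get _ _ _ => 9
  | put _ _ _ => 9
  | seq p q => p.cost + q.cost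
  | ite _ p q => p.cost + q.cost + 1
  | _ => 1

/-- Computes the address `64 * y + k` in the cell `0`, by six doublings. The cell `64`, also in lane
`0`, receives the constant `k`. -/
def address (k y : ℕ) : Program :=
  .seq (.add 0 y y) (.seq (.add 0 0 0) (.seq (.add 0 0 0) (.seq (.add 0 0 0) (.seq (.add 0 0 0)
    (.seq (.add 0 0 0) (.seq (.const 64 k) (.add 0 0 64)))))))

/-- Translation into machine instructions. -/
def compile : Code → Program
  | set v k => .const v k
  | add x y z => .add x y z
  | sub x y z => .sub x y z
  | get x k y => .seq (address k y) (.load x 0)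
  | put k y x => .seq (address k y) (.store 0 x)
  | read x j y => .read x j y
  | seq p q => .seq p.compile q.compile
  | ite v p q => .cond v p.compile q.compile

end Code

lemma Represents.scalar {m : ℕ → ℕ} {s : Lanes} (h : Represents m s) {k : ℕ} (h1 : 1 ≤ k)
    (h2 : k < 64) : m k = s k 0 := by simpa using h k 0 h1 h2

lemma Represents.write {m : ℕ → ℕ} {s : Lanes} (h : Represents m s) {k : ℕ} (h2 : k < 64)
    (i v : ℕ) : Represents (Function.update m (64 * i + k) v) (s.write k i v) := by
  intro k' i' h1' h2'
  by_cases hk : k' = k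
  · subst hk
    by_cases hi : i' = i
    · subst hi
      simp [Lanes.write]
    · have : 64 * i' + k' ≠ 64 * i + k' := by omega
      simp [Lanes.write, Function.update_of_ne this, Function.update_of_ne hi, h k' i' h1' h2']
  · have : 64 * i' + k' ≠ 64 * i + k := by omega
    simp [Lanes.write, hk, Function.update_of_ne this, h k' i' h1' h2']

lemma Represents.write_scalar {m : ℕ → ℕ} {s : Lanes} (h : Represents m s) {k : ℕ}
    (h2 : k < 64) (v : ℕ) : Represents (Function.update m k v) (s.write k 0 v) := by
  simpa using h.write h2 0 v

lemma Lanes.Bounded.write {V : ℕ} {s : Lanes} (h : s.Bounded V) {v : ℕ} (hv : v ≤ V) (k i : ℕ) :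
    (s.write k i v).Bounded V := by
  intro k' i'
  simp only [Lanes.write]
  split_ifs
  · by_cases hi : i' = i
    · subst hi; simpa using hv
    · rw [Function.update_of_ne hi]; exact h _ _
  · exact h _ _

/-- Changes of cells in lane `0` are invisible. -/
lemma Represents.update_reserved {m : ℕ → ℕ} {s : Lanes} (h : Represents m s) (i v : ℕ) :
    Represents (Function.update m (64 * i) v) s := by
  intro k' i' h1' h2'
  have : 64 * i' + k' ≠ 64 * i := by omega
  rw [Function.update_of_ne this, h k' i' h1' h2']

lemma runs_address {w : ℕ} {input : ℕ → ℕ → ℕ} {m : ℕ → ℕ} {s : Lanes} (h : Represents m s)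
    {k y : ℕ} (hk : k < 64) (hy : 1 ≤ y) (hy' : y < 64) (hw : 64 * s y 0 + 64 ≤ w) :
    ∃ m', Runs w input (Code.address k y) m 8 m' ∧ Represents m' s ∧ m' 0 = 64 * s y 0 + k := by
  set a := s y 0 with ha
  have hm : m y = a := h.scalar hy hy'
  have up : ∀ v, Function.update (Function.update m 0 v) 0 = Function.update m 0 := by
    intro v; funext v'; simp
  have r1 : Runs w input (.add 0 y y) m 1 (Function.update m 0 (2 * a)) := by
    have := Runs.add (w := w) (input := input) 0 y y m (by omega)
    rwa [hm, ← two_mul] at this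
  have rd : ∀ b, b + b ≤ w → Runs w input (.add 0 0 0) (Function.update m 0 b) 1
      (Function.update m 0 (2 * b)) := by
    intro b hb
    have := Runs.add (w := w) (input := input) 0 0 0 (Function.update m 0 b) (by simpa using hb)
    simpa only [up, Function.update_self, ← two_mul] using this
  have rc := Runs.const (w := w) (input := input) 64 k (Function.update m 0 (64 * a)) (by omega)
  have ra := Runs.add (w := w) (input := input) 0 0 64
    (Function.update (Function.update m 0 (64 * a)) 64 k) (by simp; omega)
  have rl : Runs w input (.seq (.const 64 k) (.add 0 0 64)) (Function.update m 0 (64 * a)) (1 + 1)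
      (Function.update (Function.update (Function.update m 0 (64 * a)) 64 k) 0 (64 * a + k)) := by
    refine Runs.seq _ _ _ _ _ _ _ rc ?_
    simpa using ra
  have e : 2 * (2 * (2 * (2 * (2 * (2 * a))))) = 64 * a := by ring
  rw [← e] at rl
  have hr := Runs.seq _ _ _ _ _ _ _ r1 (Runs.seq _ _ _ _ _ _ _ (rd _ (by omega))
    (Runs.seq _ _ _ _ _ _ _ (rd _ (by omega)) (Runs.seq _ _ _ _ _ _ _ (rd _ (by omega))
    (Runs.seq _ _ _ _ _ _ _ (rd _ (by omega)) (Runs.seq _ _ _ _ _ _ _ (rd _ (by omega)) rl)))))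
  refine ⟨_, hr, ((h.update_reserved 0 _).update_reserved 1 _).update_reserved 0 _, ?_⟩
  rw [Function.update_self, e]

/-- The machine program `p` takes the lanes `s` to the lanes `s'` in at most `T` steps, all numbers
being bounded by `w` during the computation and by `V` in the lanes at the end. -/
def Executes (V w : ℕ) (input : ℕ → ℕ → ℕ) (p : Program) (T : ℕ) (s s' : Lanes) : Prop :=
  s'.Bounded V ∧
    ∀ m, Represents m s → ∃ t m', t ≤ T ∧ Runs w input p m t m' ∧ Represents m' s'

variable {V w : ℕ} {input : ℕ → ℕ → ℕ}

lemma Executes.seq {p q : Program} {T T' : ℕ} {s s₁ s₂ : Lanes}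
    (h : Executes V w input p T s s₁) (h' : Executes V w input q T' s₁ s₂) :
    Executes V w input (.seq p q) (T + T') s s₂ := by
  refine ⟨h'.1, fun m hm => ?_⟩
  obtain ⟨t, m₁, ht, hr, hm₁⟩ := h.2 m hm
  obtain ⟨t', m₂, ht', hr', hm₂⟩ := h'.2 m₁ hm₁
  exact ⟨t + t', m₂, by omega, hr.seq _ _ _ _ _ _ _ hr', hm₂⟩

lemma Executes.mono {p : Program} {T T' : ℕ} {s s' : Lanes} (h : Executes V w input p T s s')
    (hT : T ≤ T') : Executes V w input p T' s s' :=
  ⟨h.1, fun m hm => by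
    obtain ⟨t, m₁, ht, hr, hm₁⟩ := h.2 m hm
    exact ⟨t, m₁, ht.trans hT, hr, hm₁⟩⟩

/-- The translation of loop-free code is correct. -/
theorem Code.executes (c : Code) (hc : c.WellFormed) (hw : 64 * V + 64 ≤ w) {s : Lanes}
    (hs : s.Bounded V) (hsafe : c.Safe V input s) :
    Executes V w input c.compile c.cost s (c.eval input s) := by
  induction c generalizing s with
  | set v k =>
    simp only [WellFormed, Bool.and_eq_true, decide_eq_true_eq] at hc
    simp only [Safe] at hsafe
    exact ⟨hs.write hsafe _ _, fun m hm => ⟨1, _, le_rfl, .const v k m (by omega),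
      hm.write_scalar hc.2 _⟩⟩
  | add x y z =>
    simp only [WellFormed, Bool.and_eq_true, decide_eq_true_eq] at hc
    simp only [Safe] at hsafe
    refine ⟨hs.write hsafe _ _, fun m hm => ⟨1, _, le_rfl, .add x y z m ?_, ?_⟩⟩
    · rw [hm.scalar (by omega) (by omega), hm.scalar (by omega) (by omega)]
      omega
    · rw [hm.scalar (k := y) (by omega) (by omega), hm.scalar (k := z) (by omega) (by omega)]
      exact hm.write_scalar (by omega) _
  | sub x y z =>
    simp only [WellFormed, Bool.and_eq_true, decide_eq_true_eq] at hc
    have := hs y 0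
    refine ⟨hs.write (by omega) _ _, fun m hm => ⟨1, _, le_rfl, .sub x y z m ?_, ?_⟩⟩
    · rw [hm.scalar (by omega) (by omega), hm.scalar (by omega) (by omega)]
      omega
    · rw [hm.scalar (k := y) (by omega) (by omega), hm.scalar (k := z) (by omega) (by omega)]
      exact hm.write_scalar (by omega) _
  | get x k y =>
    simp only [WellFormed, Bool.and_eq_true, decide_eq_true_eq] at hc
    refine ⟨hs.write (hs _ _) _ _, fun m hm => ?_⟩
    have := hs y 0
    obtain ⟨m', hr, hm', h0⟩ := runs_address (input := input) (w := w) hm (k := k) (y := y)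
      (by omega) (by omega) (by omega) (by omega)
    have hv : m' (m' 0) = s k (s y 0) := by rw [h0, hm' k _ (by omega) (by omega)]
    have hvV := hs k (s y 0)
    refine ⟨8 + 1, _, le_rfl, hr.seq _ _ _ _ _ _ _ (.load x 0 m' (by omega)), ?_⟩
    rw [hv]
    exact hm'.write_scalar (by omega) _
  | put k y x =>
    simp only [WellFormed, Bool.and_eq_true, decide_eq_true_eq] at hc
    refine ⟨hs.write (hs _ _) _ _, fun m hm => ?_⟩
    have := hs y 0
    obtain ⟨m', hr, hm', h0⟩ := runs_address (input := input) (w := w) hm (k := k) (y := y)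
      (by omega) (by omega) (by omega) (by omega)
    have hv : m' x = s x 0 := hm'.scalar (by omega) (by omega)
    have hvV := hs x 0
    refine ⟨8 + 1, _, le_rfl, hr.seq _ _ _ _ _ _ _ (.store 0 x m' (by omega)), ?_⟩
    rw [h0, hv]
    exact hm'.write (by omega) _ _
  | read x j y =>
    simp only [WellFormed, Bool.and_eq_true, decide_eq_true_eq] at hc
    simp only [Safe] at hsafe
    refine ⟨hs.write hsafe _ _, fun m hm => ⟨1, _, le_rfl, .read x j y m ?_, ?_⟩⟩
    · rw [hm.scalar (by omega) (by omega)]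
      omega
    · rw [hm.scalar (k := y) (by omega) (by omega)]
      exact hm.write_scalar (by omega) _
  | seq p q ihp ihq =>
    simp only [WellFormed, Bool.and_eq_true] at hc
    have h1 := ihp hc.1 hs hsafe.1
    exact h1.seq (ihq hc.2 h1.1 hsafe.2)
  | ite v p q ihp ihq =>
    simp only [WellFormed, Bool.and_eq_true, decide_eq_true_eq] at hc
    simp only [Safe] at hsafe
    simp only [eval, compile, cost]
    split_ifs at hsafe ⊢ with h
    · have := ihp (by tauto) hs hsafe
      refine ⟨this.1, fun m hm => ?_⟩
      obtain ⟨t, m', ht, hr, hm'⟩ := this.2 m hm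
      exact ⟨t + 1, m', by omega,
        .cond_then _ _ _ _ _ _ (by rwa [hm.scalar (by omega) (by omega)]) hr, hm'⟩
    · have := ihq (by tauto) hs hsafe
      refine ⟨this.1, fun m hm => ?_⟩
      obtain ⟨t, m', ht, hr, hm'⟩ := this.2 m hm
      exact ⟨t + 1, m', by omega,
        .cond_else _ _ _ _ _ _ (by rw [hm.scalar (by omega) (by omega)]; simpa using h) hr, hm'⟩

/-- A loop that counts down the variable `v` from `n` to zero. -/
lemma Executes.countdown {body : Program} {v T n : ℕ} (hv : 1 ≤ v) (hv' : v < 64)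
    (I : ℕ → Lanes → Prop) (hn : ∀ i s, I i s → s v 0 = n - i)
    (step : ∀ i s, i < n → s.Bounded V → I i s →
      ∃ s', Executes V w input body T s s' ∧ I (i + 1) s')
    {s : Lanes} (hs : s.Bounded V) (h0 : I 0 s) :
    ∃ s', Executes V w input (.loop v body) (n * (T + 1) + 1) s s' ∧ I n s' := by
  suffices ∀ d i s, i + d = n → s.Bounded V → I i s →
      ∃ s', Executes V w input (.loop v body) (d * (T + 1) + 1) s s' ∧ I n s' from
    this n 0 s (by omega) hs h0
  intro d
  induction d with
  | zero =>
    intro i s hi hs hI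
    obtain rfl : i = n := by omega
    refine ⟨s, ⟨hs, fun m hm => ⟨1, m, by omega, ?_, hm⟩⟩, hI⟩
    -- The counter is zero, so the loop ends at once.
    constructor
    rw [hm.scalar hv hv', hn i s hI]
    omega
  | succ d ih =>
    intro i s hi hs hI
    obtain ⟨s₁, he, hI₁⟩ := step i s (by omega) hs hI
    obtain ⟨s₂, he₂, hI₂⟩ := ih (i + 1) s₁ (by omega) he.1 hI₁
    refine ⟨s₂, ⟨he₂.1, fun m hm => ?_⟩, hI₂⟩
    obtain ⟨t, m₁, ht, hr, hm₁⟩ := he.2 m hm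
    obtain ⟨t', m₂, ht', hr', hm₂⟩ := he₂.2 m₁ hm₁
    refine ⟨t + t' + 1, m₂, ?_, .loop_step _ _ _ _ _ _ _ ?_ hr hr', hm₂⟩
    · rw [Nat.succ_mul]; omega
    · rw [hm.scalar hv hv', hn i s hI]
      omega

/-! ### Passes over a range of indices

Lane `1` holds the running index, lane `2` counts down, lane `3` holds the number one, and lanes `4`
to `6` are scratch variables. -/

/-- Forget the loop variables and the scratch variables. -/
def Lanes.erase (s : Lanes) : Lanes :=
  fun k => if k = 1 ∨ k = 2 ∨ k = 4 ∨ k = 5 ∨ k = 6 then 0 else s k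

/-- Run `body` for the indices `lo, lo + 1, …, lo + len - 1`. -/
def pass (lo len : ℕ) (body : Code) : Program :=
  .seq (Code.compile (.seq (.sub 4 3 3) (.seq (.add 1 lo 4) (.add 2 len 4))))
    (.loop 2 (Code.compile (.seq body (.seq (.add 1 1 3) (.sub 2 2 3)))))

/-- Invariant rule for passes. The invariant `I` speaks about the lanes that are not erased. -/
lemma executes_pass {lo len : ℕ} {body : Code} (hlo : 3 ≤ lo) (hlo' : lo < 64) (hlo4 : lo ≠ 4)
    (hlen : 3 ≤ len) (hlen' : len < 64) (hlen4 : len ≠ 4) (hbody : body.WellFormed)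
    (hw : 64 * V + 64 ≤ w) (I : ℕ → Lanes → Prop) (hone : ∀ i e, I i e → e 3 0 = 1)
    {s₀ : Lanes} {a n : ℕ} (hs₀ : s₀.Bounded V) (ha : s₀ lo 0 = a) (hn : s₀ len 0 = n)
    (hV : a + n ≤ V) (h0 : I 0 s₀.erase)
    (step : ∀ i s, i < n → s.Bounded V → I i s.erase → s 1 0 = a + i → s 3 0 = 1 →
      body.Safe V input s ∧ body.eval input s 1 0 = a + i ∧ body.eval input s 2 0 = s 2 0 ∧
        I (i + 1) (body.eval input s).erase) :
    ∃ s', Executes V w input (pass lo len body) (n * (body.cost + 3) + 4) s₀ s' ∧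
      I n s'.erase := by
  set s₁ := Code.eval input (.seq (.sub 4 3 3) (.seq (.add 1 lo 4) (.add 2 len 4))) s₀ with hs₁
  have e1 : s₁ 1 0 = a := by
    have : lo ≠ 4 := hlo4
    simp [hs₁, Code.eval, Lanes.write, ha, this]
  have e2 : s₁ 2 0 = n := by
    have : len ≠ 1 := by omega
    simp [hs₁, Code.eval, Lanes.write, hn, this, hlen4]
  have ee : s₁.erase = s₀.erase := by
    funext k
    simp only [Lanes.erase]
    split_ifs with h
    · rfl
    · push Not at h
      simp [hs₁, Code.eval, Lanes.write, h]
  have hx1 : Executes V w input _ _ s₀ s₁ :=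
    Code.executes (V := V) (w := w) (input := input)
      (.seq (.sub 4 3 3) (.seq (.add 1 lo 4) (.add 2 len 4)))
      (by simp [Code.WellFormed, hlo', hlen']; omega) hw hs₀ (by
        have : len ≠ 1 := by omega
        simp [Code.Safe, Code.eval, Lanes.write, ha, hn, hlo4, hlen4, this]; omega)
  obtain ⟨s', hx2, hI⟩ := Executes.countdown (V := V) (w := w) (input := input) (v := 2)
    (body := Code.compile (.seq body (.seq (.add 1 1 3) (.sub 2 2 3)))) (T := body.cost + 2)
    (n := n) (by norm_num) (by norm_num)
    (fun i s => s 1 0 = a + i ∧ s 2 0 = n - i ∧ I i s.erase) (fun i s h => h.2.1)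
    (fun i s hi hs ⟨h1, h2, h3⟩ => by
      have h4 : s 3 0 = 1 := by simpa [Lanes.erase] using hone _ _ h3
      obtain ⟨g1, g2, g3, g4⟩ := step i s hi hs h3 h1 h4
      have g5 : body.eval input s 3 0 = 1 := by simpa [Lanes.erase] using hone _ _ g4
      refine ⟨_, Code.executes (V := V) (w := w) (input := input)
        (.seq body (.seq (.add 1 1 3) (.sub 2 2 3)))
        (by simp [Code.WellFormed, hbody]) hw hs ?_, ?_, ?_, ?_⟩
      · simp only [Code.Safe, g1, g2, g5]
        refine ⟨trivial, ?_, trivial⟩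
        omega
      · simp [Code.eval, Lanes.write, g2, g5]
        omega
      · simp [Code.eval, Lanes.write, g3, g5, h2]
        omega
      · convert g4 using 1
        funext k
        simp only [Lanes.erase]
        split_ifs with h
        · rfl
        · push Not at h
          simp [Code.eval, Lanes.write, h])
    hx1.1 (s := s₁) ⟨by simp [e1], by simp [e2], by rw [ee]; exact h0⟩
  refine ⟨s', (hx1.seq hx2).mono ?_, hI.2.2⟩
  have : n * (body.cost + 2 + 1) = n * (body.cost + 3) := rfl
  simp only [Code.cost]
  omega

end LockedMatroid

namespace LockedMatroid

open Function

variable {V w : ℕ} {input : ℕ → ℕ → ℕ}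

/-! ### Basic passes -/

/-- Lanes that are neither reserved nor erased, apart from the constant in lane `3`. -/
def IsArrayLane (k : ℕ) : Prop := 7 ≤ k ∧ k < 64

lemma Lanes.erase_apply (s : Lanes) {k : ℕ} (hk : IsArrayLane k) : s.erase k = s k := by
  have := hk.1
  simp only [Lanes.erase]
  rw [if_neg (by omega)]

lemma Lanes.erase_write_scratch (s : Lanes) {k : ℕ} (hk : k = 1 ∨ k = 2 ∨ k = 4 ∨ k = 5 ∨ k = 6)
    (i v : ℕ) : (s.write k i v).erase = s.erase := by
  funext k'
  simp only [Lanes.erase, Lanes.write]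
  split_ifs with h1 h2
  · rfl
  · omega
  · rfl

lemma Lanes.erase_write (s : Lanes) {k : ℕ} (hk : IsArrayLane k) (i v : ℕ) :
    (s.write k i v).erase = update s.erase k (update (s.erase k) i v) := by
  have := hk.1
  funext k'
  by_cases h : k' = k
  · subst h
    rw [Lanes.erase_apply _ hk, Lanes.erase_apply _ hk]
    simp [Lanes.write]
  · rw [update_of_ne h]
    simp [Lanes.erase, Lanes.write, h]

/-- Invariant rule for passes that are described by giving the contents `G i` of the lanes that are
not erased after `i` rounds. -/
lemma executes_pass_exact {lo len : ℕ} {body : Code} (hlo : IsArrayLane lo)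
    (hlen : IsArrayLane len) (hbody : body.WellFormed)
    (hw : 64 * V + 64 ≤ w) {s₀ : Lanes} {a n T : ℕ} (G : ℕ → Lanes) (hone : ∀ i, G i 3 0 = 1)
    (hs₀ : s₀.Bounded V) (ha : s₀.erase lo 0 = a) (hn : s₀.erase len 0 = n)
    (hV : a + n ≤ V) (h0 : s₀.erase = G 0)
    (step : ∀ i s, i < n → s.Bounded V → s.erase = G i → s 1 0 = a + i → s 3 0 = 1 →
      body.Safe V input s ∧ body.eval input s 1 0 = a + i ∧ body.eval input s 2 0 = s 2 0 ∧
        (body.eval input s).erase = G (i + 1)) (hT : n * (body.cost + 3) + 4 ≤ T) :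
    ∃ s', Executes V w input (pass lo len body) T s₀ s' ∧ s'.erase = G n := by
  rw [Lanes.erase_apply _ hlo] at ha
  rw [Lanes.erase_apply _ hlen] at hn
  obtain ⟨s', h, h'⟩ := executes_pass (input := input)
    (by linarith [hlo.1]) hlo.2 (by linarith [hlo.1])
    (by linarith [hlen.1]) hlen.2 (by linarith [hlen.1]) hbody hw (fun i e => e = G i)
    (fun i e h => h ▸ hone i) hs₀ ha hn hV h0 step
  exact ⟨s', h.mono hT, h'⟩

/-- The number of `t < n` with `f (a + t) = v`. -/
def countFrom (f : ℕ → ℕ) (a n v : ℕ) : ℕ := ((Finset.range n).filter fun t => f (a + t) = v).card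

lemma countFrom_le (f : ℕ → ℕ) (a n v : ℕ) : countFrom f a n v ≤ n := by
  simpa only [countFrom, Finset.card_range] using
    Finset.card_filter_le (Finset.range n) fun t => f (a + t) = v

lemma countFrom_zero (f : ℕ → ℕ) (a : ℕ) : countFrom f a 0 = 0 := by
  funext v; simp [countFrom]

lemma countFrom_succ_apply (f : ℕ → ℕ) (a n v : ℕ) :
    countFrom f a (n + 1) v = countFrom f a n v + if f (a + n) = v then 1 else 0 := by
  simp only [countFrom]
  rw [Finset.range_add_one, Finset.filter_insert]
  split_ifs
  · rw [Finset.card_insert_of_notMem (by simp)]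
  · rfl

lemma countFrom_succ (f : ℕ → ℕ) (a n : ℕ) : countFrom f a (n + 1) =
    update (countFrom f a n) (f (a + n)) (countFrom f a n (f (a + n)) + 1) := by
  funext v
  rw [countFrom_succ_apply]
  by_cases h : v = f (a + n)
  · subst h; simp
  · rw [update_of_ne h, if_neg (Ne.symm h), add_zero]

/-- `old`, with the values at `a, …, a + n - 1` replaced by those of `g`. -/
def fill (old : ℕ → ℕ) (a n : ℕ) (g : ℕ → ℕ) : ℕ → ℕ :=
  fun x => if a ≤ x ∧ x < a + n then g x else old x

lemma fill_zero (old : ℕ → ℕ) (a : ℕ) (g : ℕ → ℕ) : fill old a 0 g = old := by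
  funext x
  simp only [fill]
  rw [if_neg (by omega)]

lemma fill_succ (old : ℕ → ℕ) (a n : ℕ) (g : ℕ → ℕ) :
    fill old a (n + 1) g = update (fill old a n g) (a + n) (g (a + n)) := by
  funext x
  by_cases h : x = a + n
  · subst h; simp [fill]
  · rw [update_of_ne h]
    simp only [fill]
    congr 1
    apply propext
    omega

lemma fill_apply (old : ℕ → ℕ) {a n x : ℕ} (g : ℕ → ℕ) (h : a ≤ x) (h' : x < a + n) :
    fill old a n g x = g x := if_pos ⟨h, h'⟩

/-- `out[i] := input[j][i - off] + shift` for `off ≤ i < off + n`. -/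
def copyBody (off shift j out : ℕ) : Code :=
  .seq (.add 4 1 off) (.seq (.read 5 j 1) (.seq (.add 5 5 shift) (.put out 4 5)))

lemma executes_copy {off shift j out origin len : ℕ} (hoff : IsArrayLane off)
    (hshift : IsArrayLane shift)
    (hout : IsArrayLane out) (horigin : IsArrayLane origin) (hlen : IsArrayLane len)
    (h1 : off ≠ out) (h2 : shift ≠ out) (hw : 64 * V + 64 ≤ w) {s : Lanes} {n T : ℕ}
    (hs : s.Bounded V) (hone : s.erase 3 0 = 1) (hz : s.erase origin 0 = 0)
    (hn : s.erase len 0 = n) (hV : n + s.erase off 0 ≤ V)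
    (hin : ∀ i < n, input j i + s.erase shift 0 ≤ V) (hT : n * 15 + 4 ≤ T) :
    ∃ s', Executes V w input (pass origin len (copyBody off shift j out)) T s s' ∧
      s'.erase = update s.erase out (fill (s.erase out) (s.erase off 0) n
        fun x => input j (x - s.erase off 0) + s.erase shift 0) := by
  have o7 := hout.1
  have f7 := hoff.1
  have g7 := hshift.1
  set e := s.erase with he
  set g := fun x => input j (x - e off 0) + e shift 0 with hg
  refine executes_pass_exact (T := T) horigin hlen ?_ hw
    (fun i => update e out (fill (e out) (e off 0) i g))
    (fun i => ?_) hs hz hn (by omega) ?_ (fun i s' hi hs' hG h1' h3' => ?_) hT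
  · have := hoff.2; have := hout.2; have := hshift.2
    simp [Code.WellFormed, copyBody]; omega
  · rw [update_of_ne (by omega), hone]
  · simp only [fill_zero, update_eq_self, he]
  · have e1 : s' off = e off := by
      rw [← Lanes.erase_apply s' hoff, hG, update_of_ne h1]
    have e2 : s' shift = e shift := by
      rw [← Lanes.erase_apply s' hshift, hG, update_of_ne h2]
    have e3 : s'.erase out = fill (e out) (e off 0) i g := by simp [hG]
    rw [zero_add] at h1'
    have := hin i hi
    have n1 : shift ≠ 4 := by omega
    have n2 : shift ≠ 5 := by omega
    have n3 : 1 ≠ out := by omega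
    have n4 : 2 ≠ out := by omega
    have n5 : off ≠ 4 := by omega
    have ev : (copyBody off shift j out).eval input s' =
        (((s'.write 4 0 (i + e off 0)).write 5 0 (input j i)).write 5 0
          (input j i + e shift 0)).write out (i + e off 0) (input j i + e shift 0) := by
      simp [copyBody, Code.eval, Lanes.write, e1, e2, h1', n1, n2]
    refine ⟨?_, ?_, ?_, ?_⟩
    · simp [copyBody, Code.Safe, Code.eval, Lanes.write, e1, e2, h1', n1, n2]
      omega
    · simp [ev, Lanes.write, n3, h1']
    · simp [ev, Lanes.write, n4]
    · rw [ev, Lanes.erase_write _ hout, Lanes.erase_write_scratch _ (by simp),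
        Lanes.erase_write_scratch _ (by simp), Lanes.erase_write_scratch _ (by simp), e3, hG,
        update_idem, fill_succ, add_comm i]
      congr 2
      simp [hg]

/-- `out[i] := cnt[src[i]] := cnt[src[i]] + 1` -/
def countBody (src cnt out : ℕ) : Code :=
  .seq (.get 4 src 1) (.seq (.get 5 cnt 4) (.seq (.add 5 5 3) (.seq (.put cnt 4 5) (.put out 1 5))))

/-- After counting, lane `cnt` holds the multiplicities of the values of lane `src`, and lane `out`
the position, counted from one, of each index among those with the same value. -/
lemma executes_count {src cnt out lo len : ℕ} (hsrc : IsArrayLane src) (hcnt : IsArrayLane cnt)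
    (hout : IsArrayLane out) (hlo : IsArrayLane lo) (hlen : IsArrayLane len)
    (h1 : src ≠ cnt) (h2 : src ≠ out) (h3 : cnt ≠ out) (hw : 64 * V + 64 ≤ w) {s : Lanes}
    {a n T : ℕ} (hs : s.Bounded V) (hone : s.erase 3 0 = 1) (ha : s.erase lo 0 = a)
    (hn : s.erase len 0 = n) (hV : a + n ≤ V) (hz : s.erase cnt = 0) (hT : n * 40 + 4 ≤ T) :
    ∃ s', Executes V w input (pass lo len (countBody src cnt out)) T s s' ∧
      s'.erase = update (update s.erase cnt (countFrom (s.erase src) a n)) out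
        (fill (s.erase out) a n
          fun x => countFrom (s.erase src) a (x - a) (s.erase src x) + 1) := by
  have o7 := hout.1
  have c7 := hcnt.1
  have s7 := hsrc.1
  set e := s.erase with he
  set g := fun x => countFrom (e src) a (x - a) (e src x) + 1 with hg
  refine executes_pass_exact (T := T) hlo hlen ?_ hw
    (fun i => update (update e cnt (countFrom (e src) a i)) out (fill (e out) a i g))
    (fun i => ?_) hs ha hn hV ?_ (fun i s' hi hs' hG h1' h3' => ?_)
    (by simp [countBody, Code.cost]; omega)
  · have := hsrc.2; have := hout.2; have := hcnt.2
    simp [Code.WellFormed, countBody]; omega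
  · rw [update_of_ne (by omega), update_of_ne (by omega), hone]
  · simp only [fill_zero, countFrom_zero, ← he, ← hz, update_eq_self]
  · have e1 : s' src = e src := by
      rw [← Lanes.erase_apply s' hsrc, hG, update_of_ne h2, update_of_ne h1]
    have e2 : s' cnt = countFrom (e src) a i := by
      rw [← Lanes.erase_apply s' hcnt, hG, update_of_ne h3, update_self]
    have n1 : cnt ≠ 4 := by omega
    have n3 : 1 ≠ out := by omega
    have n4 : 2 ≠ out := by omega
    have n5 : 1 ≠ cnt := by omega
    have n6 : 2 ≠ cnt := by omega
    have n7 : 5 ≠ cnt := by omega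
    have n8 : 4 ≠ cnt := by omega
    have hc := countFrom_le (e src) a i (e src (a + i))
    have ev : (countBody src cnt out).eval input s' =
        ((((s'.write 4 0 (e src (a + i))).write 5 0 (countFrom (e src) a i (e src (a + i)))).write 5
          0 (g (a + i))).write cnt (e src (a + i)) (g (a + i))).write out (a + i) (g (a + i)) := by
      simp [countBody, Code.eval, Lanes.write, e1, e2, h1', h3', n1, n5, n7, hg]
    refine ⟨?_, ?_, ?_, ?_⟩
    · simp [countBody, Code.Safe, Code.eval, Lanes.write, e1, e2, h1', h3', n1]
      omega
    · simp [ev, Lanes.write, n3, n5, h1']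
    · simp [ev, Lanes.write, n4, n6]
    · rw [ev, Lanes.erase_write _ hout, Lanes.erase_write _ hcnt,
        Lanes.erase_write_scratch _ (by simp),
        Lanes.erase_write_scratch _ (by simp), Lanes.erase_write_scratch _ (by simp), hG,
        fill_succ, countFrom_succ]
      have hgi : countFrom (e src) a i (e src (a + i)) + 1 = g (a + i) := by simp [hg]
      rw [hgi]
      funext k
      by_cases k1 : k = out
      · subst k1; simp [Ne.symm h3]
      by_cases k2 : k = cnt
      · subst k2; simp [h3]
      · simp [k1, k2]

/-- `out[i] := tbl[idx[i]]` -/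
def gatherBody (tbl idx out : ℕ) : Code :=
  .seq (.get 4 idx 1) (.seq (.get 5 tbl 4) (.put out 1 5))

lemma executes_gather {tbl idx out lo len : ℕ} (htbl : IsArrayLane tbl) (hidx : IsArrayLane idx)
    (hout : IsArrayLane out) (hlo : IsArrayLane lo) (hlen : IsArrayLane len)
    (h1 : tbl ≠ out) (h2 : idx ≠ out) (hw : 64 * V + 64 ≤ w) {s : Lanes}
    {a n T : ℕ} (hs : s.Bounded V) (hone : s.erase 3 0 = 1) (ha : s.erase lo 0 = a)
    (hn : s.erase len 0 = n) (hV : a + n ≤ V) (hT : n * 30 + 4 ≤ T) :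
    ∃ s', Executes V w input (pass lo len (gatherBody tbl idx out)) T s s' ∧
      s'.erase = update s.erase out
        (fill (s.erase out) a n fun x => s.erase tbl (s.erase idx x)) := by
  have o7 := hout.1
  have c7 := htbl.1
  have s7 := hidx.1
  set e := s.erase with he
  set g := fun x => e tbl (e idx x) with hg
  refine executes_pass_exact (T := T) hlo hlen ?_ hw
    (fun i => update e out (fill (e out) a i g))
    (fun i => ?_) hs ha hn hV ?_ (fun i s' hi hs' hG h1' h3' => ?_)
    (by simp [gatherBody, Code.cost]; omega)
  · have := hidx.2; have := hout.2; have := htbl.2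
    simp [Code.WellFormed, gatherBody]; omega
  · rw [update_of_ne (by omega), hone]
  · simp only [fill_zero, update_eq_self, he]
  · have e1 : s' tbl = e tbl := by
      rw [← Lanes.erase_apply s' htbl, hG, update_of_ne h1]
    have e2 : s' idx = e idx := by
      rw [← Lanes.erase_apply s' hidx, hG, update_of_ne h2]
    have n1 : tbl ≠ 4 := by omega
    have n3 : 1 ≠ out := by omega
    have n4 : 2 ≠ out := by omega
    have ev : (gatherBody tbl idx out).eval input s' =
        ((s'.write 4 0 (e idx (a + i))).write 5 0 (g (a + i))).write out (a + i) (g (a + i)) := by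
      simp [gatherBody, Code.eval, Lanes.write, e1, e2, h1', n1, hg]
    refine ⟨?_, ?_, ?_, ?_⟩
    · simp [gatherBody, Code.Safe]
    · simp [ev, Lanes.write, n3, h1']
    · simp [ev, Lanes.write, n4]
    · rw [ev, Lanes.erase_write _ hout,
        Lanes.erase_write_scratch _ (by simp), Lanes.erase_write_scratch _ (by simp), hG,
        fill_succ]
      simp

/-- `out[i] := x[i] + y[i]` -/
def addBody (x y out : ℕ) : Code :=
  .seq (.get 4 x 1) (.seq (.get 5 y 1) (.seq (.add 4 4 5) (.put out 1 4)))

lemma executes_add {x y out lo len : ℕ} (hx : IsArrayLane x) (hy : IsArrayLane y)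
    (hout : IsArrayLane out) (hlo : IsArrayLane lo) (hlen : IsArrayLane len)
    (h1 : x ≠ out) (h2 : y ≠ out) (hw : 64 * V + 64 ≤ w) {s : Lanes}
    {a n T : ℕ} (hs : s.Bounded V) (hone : s.erase 3 0 = 1) (ha : s.erase lo 0 = a)
    (hn : s.erase len 0 = n) (hV : a + n ≤ V)
    (hsum : ∀ i < n, s.erase x (a + i) + s.erase y (a + i) ≤ V) (hT : n * 40 + 4 ≤ T) :
    ∃ s', Executes V w input (pass lo len (addBody x y out)) T s s' ∧
      s'.erase = update s.erase out
        (fill (s.erase out) a n fun i => s.erase x i + s.erase y i) := by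
  have o7 := hout.1
  have c7 := hx.1
  have s7 := hy.1
  set e := s.erase with he
  set g := fun i => e x i + e y i with hg
  refine executes_pass_exact (T := T) hlo hlen ?_ hw
    (fun i => update e out (fill (e out) a i g))
    (fun i => ?_) hs ha hn hV ?_ (fun i s' hi hs' hG h1' h3' => ?_)
    (by simp [addBody, Code.cost]; omega)
  · have := hx.2; have := hout.2; have := hy.2
    simp [Code.WellFormed, addBody]; omega
  · rw [update_of_ne (by omega), hone]
  · simp only [fill_zero, update_eq_self, he]
  · have e1 : s' x = e x := by
      rw [← Lanes.erase_apply s' hx, hG, update_of_ne h1]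
    have e2 : s' y = e y := by
      rw [← Lanes.erase_apply s' hy, hG, update_of_ne h2]
    have n1 : y ≠ 4 := by omega
    have n3 : 1 ≠ out := by omega
    have n4 : 2 ≠ out := by omega
    have ev : (addBody x y out).eval input s' =
        (((s'.write 4 0 (e x (a + i))).write 5 0 (e y (a + i))).write 4 0 (g (a + i))).write out
          (a + i) (g (a + i)) := by
      simp [addBody, Code.eval, Lanes.write, e1, e2, h1', n1, hg]
    refine ⟨?_, ?_, ?_, ?_⟩
    · simp [addBody, Code.Safe, Code.eval, Lanes.write, e1, e2, h1', n1]
      exact hsum i hi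
    · simp [ev, Lanes.write, n3, h1']
    · simp [ev, Lanes.write, n4]
    · rw [ev, Lanes.erase_write _ hout, Lanes.erase_write_scratch _ (by simp),
        Lanes.erase_write_scratch _ (by simp), Lanes.erase_write_scratch _ (by simp), hG,
        fill_succ]
      simp

/-- `out[i + 1] := out[i] + step` -/
def multiplesBody (step out : ℕ) : Code :=
  .seq (.get 4 out 1) (.seq (.add 4 4 step) (.seq (.add 5 1 3) (.put out 5 4)))

lemma executes_multiples {step out origin len : ℕ} (hstep : IsArrayLane step)
    (hout : IsArrayLane out) (horigin : IsArrayLane origin) (hlen : IsArrayLane len)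
    (h1 : step ≠ out) (hw : 64 * V + 64 ≤ w) {s : Lanes}
    {n d T : ℕ} (hs : s.Bounded V) (hone : s.erase 3 0 = 1) (ha : s.erase origin 0 = 0)
    (hn : s.erase len 0 = n) (hd : s.erase step 0 = d) (hV : n ≤ V) (hV' : n * d ≤ V)
    (hz : s.erase out = 0) (hT : n * 40 + 4 ≤ T) :
    ∃ s', Executes V w input (pass origin len (multiplesBody step out)) T s s' ∧
      s'.erase = update s.erase out fun x => if x ≤ n then x * d else 0 := by
  have o7 := hout.1
  have c7 := hstep.1
  set e := s.erase with he
  refine executes_pass_exact (T := T) horigin hlen ?_ hw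
    (fun i => update e out fun x => if x ≤ i then x * d else 0)
    (fun i => ?_) hs ha hn (by omega) ?_ (fun i s' hi hs' hG h1' h3' => ?_)
    (by simp [multiplesBody, Code.cost]; omega)
  · have := hout.2; have := hstep.2
    simp [Code.WellFormed, multiplesBody]; omega
  · rw [update_of_ne (by omega), hone]
  · rw [eq_update_iff, ← he, hz]
    refine ⟨?_, fun _ _ => rfl⟩
    funext x
    by_cases hx : x = 0
    · subst hx; simp
    · rw [if_neg (by omega)]; rfl
  · have e1 : s' step = e step := by
      rw [← Lanes.erase_apply s' hstep, hG, update_of_ne h1]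
    have e2 : s' out = fun x => if x ≤ i then x * d else 0 := by
      rw [← Lanes.erase_apply s' hout, hG, update_self]
    rw [zero_add] at h1'
    have n1 : step ≠ 4 := by omega
    have n3 : 1 ≠ out := by omega
    have n4 : 2 ≠ out := by omega
    have e2' : s' out i = i * d := by rw [e2]; simp
    have hle : (i + 1) * d ≤ n * d := Nat.mul_le_mul_right d hi
    rw [Nat.succ_mul] at hle
    have ev : (multiplesBody step out).eval input s' =
        (((s'.write 4 0 (i * d)).write 4 0 (i * d + d)).write 5 0 (i + 1)).write out
          (i + 1) (i * d + d) := by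
      simp [multiplesBody, Code.eval, Lanes.write, e1, e2', h1', h3', n1, hd]
    refine ⟨?_, ?_, ?_, ?_⟩
    · simp [multiplesBody, Code.Safe, Code.eval, Lanes.write, e1, e2', h1', h3', n1, hd]
      omega
    · simp [ev, Lanes.write, n3, h1']
    · simp [ev, Lanes.write, n4]
    · rw [ev, Lanes.erase_write _ hout, Lanes.erase_write_scratch _ (by simp),
        Lanes.erase_write_scratch _ (by simp), Lanes.erase_write_scratch _ (by simp), hG]
      simp only [update_self, update_idem]
      congr 1
      funext x
      by_cases hx : x = i + 1
      · subst hx; simp [Nat.succ_mul]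
      · rw [update_of_ne hx]
        congr 1
        apply propext
        omega

/-- If `x[h[i]] ≠ y[h[i]]`, then `bad := 1`. With truncated subtraction the two values differ if and
only if one of the two differences is positive. -/
def compareBody (h x y bad : ℕ) : Code :=
  .seq (.get 4 h 1) (.seq (.get 5 x 4) (.seq (.get 6 y 4) (.seq (.sub 4 5 6) (.seq (.sub 6 6 5)
    (.seq (.add 4 4 6) (.ite 4 (.set bad 1) (.sub 4 4 4)))))))

lemma executes_compare {h x y bad origin len : ℕ} (hh : IsArrayLane h) (hx : IsArrayLane x)
    (hy : IsArrayLane y) (hbad : IsArrayLane bad) (horigin : IsArrayLane origin)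
    (hlen : IsArrayLane len) (h1 : h ≠ bad) (h2 : x ≠ bad) (h3 : y ≠ bad)
    (hw : 64 * V + 64 ≤ w) {s : Lanes} {n T : ℕ} (hs : s.Bounded V) (hone : s.erase 3 0 = 1)
    (ha : s.erase origin 0 = 0) (hn : s.erase len 0 = n) (hV : n ≤ V) (hV1 : 1 ≤ V)
    (hz : s.erase bad 0 = 0) (hT : n * 60 + 4 ≤ T) :
    ∃ s', Executes V w input (pass origin len (compareBody h x y bad)) T s s' ∧
      (s'.erase bad 0 = 0 ↔ ∀ i < n, s.erase x (s.erase h i) = s.erase y (s.erase h i)) := by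
  classical
  have o7 := hbad.1
  have c7 := hh.1
  have x7 := hx.1
  have y7 := hy.1
  set e := s.erase with he
  set G : ℕ → Lanes := fun i => update e bad (update (e bad) 0
    (if ∀ t < i, e x (e h t) = e y (e h t) then 0 else 1)) with hGdef
  obtain ⟨s', hex, hs'⟩ : ∃ s',
      Executes V w input (pass origin len (compareBody h x y bad)) T s s' ∧ s'.erase = G n := by
    refine executes_pass_exact (T := T) horigin hlen ?_ hw G
      (fun i => ?_) hs ha hn (by omega) ?_ (fun i s' hi hs' hG h1' h3' => ?_)
      (by simp [compareBody, Code.cost]; omega)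
    · have := hh.2; have := hx.2; have := hy.2; have := hbad.2
      simp [Code.WellFormed, compareBody]; omega
    · rw [hGdef]
      simp only
      rw [update_of_ne (by omega), hone]
    · have : update (e bad) 0 0 = e bad := by rw [update_eq_self_iff, hz]
      simp only [hGdef, Nat.not_lt_zero, IsEmpty.forall_iff, implies_true, if_true, this,
        update_eq_self, ← he]
    · have e1 : s' h = e h := by
        rw [← Lanes.erase_apply s' hh, hG]; exact update_of_ne h1 _ _
      have e2 : s' x = e x := by
        rw [← Lanes.erase_apply s' hx, hG]; exact update_of_ne h2 _ _
      have e3 : s' y = e y := by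
        rw [← Lanes.erase_apply s' hy, hG]; exact update_of_ne h3 _ _
      have b2 := hs' x (e h i)
      have b3 := hs' y (e h i)
      rw [e2] at b2
      rw [e3] at b3
      rw [zero_add] at h1'
      have n1 : x ≠ 4 := by omega
      have n2 : y ≠ 4 := by omega
      have n5 : y ≠ 5 := by omega
      have n3 : 1 ≠ bad := by omega
      have n4 : 2 ≠ bad := by omega
      have n6 : 6 ≠ bad := by omega
      have n7 : bad ≠ 4 := by omega
      have n8 : bad ≠ 5 := by omega
      have n9 : bad ≠ 6 := by omega
      have hsplit : (∀ t < i + 1, e x (e h t) = e y (e h t)) ↔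
          (∀ t < i, e x (e h t) = e y (e h t)) ∧ e x (e h i) = e y (e h i) := by
        simp only [Nat.lt_succ_iff_lt_or_eq]
        exact ⟨fun H => ⟨fun t ht => H t (Or.inl ht), H i (Or.inr rfl)⟩, fun H t ht =>
          ht.elim (H.1 t) fun h => h ▸ H.2⟩
      by_cases heq : e x (e h i) = e y (e h i)
      · refine ⟨?_, ?_, ?_, ?_⟩
        · simp [compareBody, Code.Safe, Code.eval, Lanes.write, e1, e2, e3, h1', n1, n2, n5, heq]
        · simp [compareBody, Code.eval, Lanes.write, e1, e2, e3, h1', n1, n2, n5, heq]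
        · simp [compareBody, Code.eval, Lanes.write, e1, e2, e3, h1', n1, n2, n5, heq]
        · have ev : ((compareBody h x y bad).eval input s').erase = s'.erase := by
            funext k
            simp only [Lanes.erase]
            split_ifs with hk'
            · rfl
            · push Not at hk'
              simp [compareBody, Code.eval, Lanes.write, e1, e2, e3, h1', n1, n2, n5, heq, hk']
          rw [ev, hG]
          simp only [hGdef, hsplit, heq, and_true]
      · have d : e x (e h i) - e y (e h i) ≠ 0 ∨ e y (e h i) - e x (e h i) ≠ 0 := by omega
        have d' : e x (e h i) - e y (e h i) + (e y (e h i) - e x (e h i)) ≤ V := by omega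
        have dd : ¬ (e x (e h i) - e y (e h i) = 0 ∧ e y (e h i) - e x (e h i) = 0) := by omega
        refine ⟨?_, ?_, ?_, ?_⟩
        · simp only [compareBody, Code.Safe, Code.eval, Lanes.write]
          simp [e1, e2, e3, h1', n1, n2, n5, dd, d', hV1]
        · simp only [compareBody, Code.eval, Lanes.write]
          simp [Lanes.write, e1, e2, e3, h1', n1, n2, n5, dd, n3]
        · simp only [compareBody, Code.eval, Lanes.write]
          simp [Lanes.write, e1, e2, e3, h1', n1, n2, n5, dd, n4]
        · have this : ¬ ∀ t < i + 1, e x (e h t) = e y (e h t) := fun H => heq (H i (by omega))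
          have ev : ((compareBody h x y bad).eval input s').erase = (s'.write bad 0 1).erase := by
            funext k
            simp only [Lanes.erase]
            split_ifs with hk'
            · rfl
            · push Not at hk'
              by_cases hk : k = bad
              · simp only [compareBody, Code.eval, Lanes.write]
                simp [Lanes.write, e1, e2, e3, h1', n1, n2, n5, dd, hk, n7, n8, n9]
              · simp only [compareBody, Code.eval, Lanes.write]
                simp [Lanes.write, e1, e2, e3, h1', n1, n2, n5, dd, hk, hk']
          rw [ev, Lanes.erase_write _ hbad, hG]
          simp only [hGdef, if_neg this, update_self, update_idem]
  refine ⟨s', hex, ?_⟩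
  rw [hs']
  simp only [hGdef, update_self]
  split_ifs with hc
  · exact iff_of_true rfl hc
  · exact iff_of_false (by simp) hc

end LockedMatroid

namespace LockedMatroid

open Function

variable {V w : ℕ} {input : ℕ → ℕ → ℕ}

/-! ### Naming sequences by the nodes of a trie -/

/-- The array `child` stores a trie with the nodes `0, …, cnt` over the alphabet `{0, …, W - 1}`:
node `x` represents the sequence `word x`, and the cell `W * x + a` contains `W * y`, where `y` is
the node of `word x` extended by `a`, or `0` if there is none. -/
structure IsTrie (W : ℕ) (child : ℕ → ℕ) (cnt : ℕ) (word : ℕ → List ℕ) : Prop where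
  inj : ∀ x ≤ cnt, ∀ y ≤ cnt, word x = word y → x = y
  none : ∀ x ≤ cnt, ∀ a < W, child (W * x + a) = 0 → ∀ y ≤ cnt, word y ≠ word x ++ [a]
  some : ∀ x ≤ cnt, ∀ a < W, child (W * x + a) ≠ 0 →
    ∃ y ≤ cnt, child (W * x + a) = W * y ∧ word y = word x ++ [a]
  free : ∀ z, W * (cnt + 1) ≤ z → child z = 0
  prefix_closed : ∀ z ≤ cnt, ∀ u a, word z = u ++ [a] → ∃ x ≤ cnt, word x = u

lemma isTrie_zero (W : ℕ) : IsTrie W 0 0 fun _ => [] where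
  inj x hx y hy _ := by omega
  none x hx a ha _ y hy := by simp
  some x hx a ha h := by simp at h
  free z _ := rfl
  prefix_closed z _ u a h := by simp at h

/-- The cells of distinct pairs of a node and a symbol are distinct. -/
lemma address_inj {W x y a b : ℕ} (ha : a < W) (hb : b < W) (h : W * x + a = W * y + b) :
    x = y ∧ a = b := by
  have hW : 0 < W := by omega
  have h1 : (W * x + a) / W = x := by
    rw [Nat.mul_add_div hW, Nat.div_eq_of_lt ha, add_zero]
  have h2 : (W * y + b) / W = y := by
    rw [Nat.mul_add_div hW, Nat.div_eq_of_lt hb, add_zero]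
  have : x = y := by rw [← h1, ← h2, h]
  subst this
  omega

/-- A new node can be added below `x`. -/
lemma IsTrie.insert {W cnt : ℕ} {child : ℕ → ℕ} {word : ℕ → List ℕ} (h : IsTrie W child cnt word)
    {x a : ℕ} (hx : x ≤ cnt) (ha : a < W) (h0 : child (W * x + a) = 0) :
    IsTrie W (update child (W * x + a) (W * (cnt + 1))) (cnt + 1)
      (update word (cnt + 1) (word x ++ [a])) := by
  have hnew := h.none x hx a ha h0
  have hne : ∀ y ≤ cnt, update word (cnt + 1) (word x ++ [a]) y = word y := fun y hy =>
    update_of_ne (by omega) _ _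
  have hbound : ∀ y ≤ cnt, ∀ b < W, W * y + b < W * (cnt + 1) := fun y hy b hb => by
    have := Nat.mul_le_mul_left W hy
    rw [Nat.mul_succ]
    omega
  have hz : ∀ b < W, update child (W * x + a) (W * (cnt + 1)) (W * (cnt + 1) + b) = 0 := by
    intro b hb
    have := hbound x hx a ha
    rw [update_of_ne (by omega)]
    exact h.free _ (by omega)
  refine ⟨?_, ?_, ?_, ?_, ?_⟩
  · intro y hy z hz hyz
    rcases Nat.lt_or_ge cnt y with hy' | hy' <;> rcases Nat.lt_or_ge cnt z with hz' | hz'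
    · omega
    · obtain rfl : y = cnt + 1 := by omega
      rw [update_self, hne z hz'] at hyz
      exact absurd hyz.symm (hnew z hz')
    · obtain rfl : z = cnt + 1 := by omega
      rw [update_self, hne y hy'] at hyz
      exact absurd hyz (hnew y hy')
    · rw [hne y hy', hne z hz'] at hyz
      exact h.inj y hy' z hz' hyz
  · intro y hy b hb h0' z hz' hw
    rcases Nat.lt_or_ge cnt y with hy' | hy'
    · obtain rfl : y = cnt + 1 := by omega
      rw [update_self] at hw
      rcases Nat.lt_or_ge cnt z with hz'' | hz''
      · obtain rfl : z = cnt + 1 := by omega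
        rw [update_self] at hw
        simp at hw
      · rw [hne z hz''] at hw
        -- The new word is not a proper prefix of an old one.
        obtain ⟨x', hx', hw'⟩ := h.prefix_closed z hz'' _ _ hw
        exact hnew x' hx' hw'
    · rw [hne y hy'] at hw
      have hya : ¬ (y = x ∧ b = a) := by
        rintro ⟨rfl, rfl⟩
        rw [update_self] at h0'
        have : 0 < W * (cnt + 1) := Nat.mul_pos (by omega) (by omega)
        omega
      rw [update_of_ne (fun he => hya (address_inj hb ha he))] at h0'
      rcases Nat.lt_or_ge cnt z with hz'' | hz''
      · obtain rfl : z = cnt + 1 := by omega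
        rw [update_self] at hw
        obtain ⟨h1, h2⟩ := List.append_inj' hw rfl
        exact hya ⟨(h.inj x hx y hy' h1).symm, by simpa using h2.symm⟩
      · rw [hne z hz''] at hw
        exact h.none y hy' b hb h0' z hz'' hw
  · intro y hy b hb h0'
    rcases Nat.lt_or_ge cnt y with hy' | hy'
    · obtain rfl : y = cnt + 1 := by omega
      exact absurd (hz b hb) h0'
    · by_cases hya : y = x ∧ b = a
      · obtain ⟨rfl, rfl⟩ := hya
        exact ⟨cnt + 1, le_rfl, by simp, by simp [hne y hy']⟩
      · rw [update_of_ne (fun he => hya (address_inj hb ha he))] at h0' ⊢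
        obtain ⟨z, hz, h1, h2⟩ := h.some y hy' b hb h0'
        exact ⟨z, by omega, h1, by rw [hne z hz, hne y hy', h2]⟩
  · intro z hz'
    have h1 := hbound x hx a ha
    have h2 : W * (cnt + 1) ≤ W * (cnt + 1 + 1) := Nat.mul_le_mul_left W (by omega)
    rw [update_of_ne (by omega)]
    exact h.free z (by omega)
  · intro z hz' u b hw
    rcases Nat.lt_or_ge cnt z with hz'' | hz''
    · obtain rfl : z = cnt + 1 := by omega
      rw [update_self] at hw
      obtain ⟨h1, -⟩ := List.append_inj' hw rfl
      exact ⟨x, by omega, by rw [hne x hx, h1]⟩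
    · rw [hne z hz''] at hw
      obtain ⟨x', hx', hw'⟩ := h.prefix_closed z hz'' _ _ hw
      exact ⟨x', by omega, by rw [hne x' hx', hw']⟩

/-- In the lanes `e`, lane `35` stores a trie with at most `k` nodes besides the root, lane `9` the
number of its last node times `W`, and lane `34` the nodes of the sequences `seqs c`. -/
def TrieState (W : ℕ) (e : Lanes) (k : ℕ) (seqs : ℕ → List ℕ) : Prop :=
  ∃ cnt word, cnt ≤ k ∧ e 9 0 = W * cnt ∧ IsTrie W (e 35) cnt word ∧
    ∀ c, ∃ x ≤ cnt, e 34 c = W * x ∧ word x = seqs c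

/-- Two sequences have the same node if and only if they are equal. -/
lemma TrieState.eq_iff {W : ℕ} (hW : 0 < W) {e : Lanes} {k : ℕ} {seqs : ℕ → List ℕ}
    (h : TrieState W e k seqs) (c d : ℕ) : e 34 c = e 34 d ↔ seqs c = seqs d := by
  obtain ⟨cnt, word, -, -, ht, hs⟩ := h
  obtain ⟨x, hx, hxc, hxw⟩ := hs c
  obtain ⟨y, hy, hyc, hyw⟩ := hs d
  rw [hxc, hyc, ← hxw, ← hyw, Nat.mul_right_inj hW.ne']
  exact ⟨fun h => h ▸ rfl, ht.inj x hx y hy⟩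

/-- One step down the trie: append the symbol `sym[i]` to the sequence of the name in lane `14`.
Since `0` is never a child, an empty cell means that a new node has to be added. -/
def trieBody (sym : ℕ) : Code :=
  .seq (.get 4 14 1) (.seq (.get 5 34 4) (.seq (.get 6 sym 1) (.seq (.add 5 5 6)
    (.seq (.get 6 35 5) (.seq
      (.ite 6 (.sub 4 4 4) (.seq (.add 9 9 8) (.seq (.put 35 5 9) (.get 6 35 5))))
      (.seq (.get 4 14 1) (.put 34 4 6)))))))

lemma trieBody_spec {sym W : ℕ} (hsym : IsArrayLane sym) {s : Lanes} {k : ℕ}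
    {seqs : ℕ → List ℕ} (hT : TrieState W s.erase k seqs)
    (hW8 : s 8 0 = W) (hsW : s sym (s 1 0) < W) (hV : W * (k + 2) ≤ V) :
    (trieBody sym).Safe V input s ∧ (trieBody sym).eval input s 1 0 = s 1 0 ∧
      (trieBody sym).eval input s 2 0 = s 2 0 ∧
      (∀ l, l ≠ 9 → l ≠ 34 → l ≠ 35 → ((trieBody sym).eval input s).erase l = s.erase l) ∧
      TrieState W ((trieBody sym).eval input s).erase (k + 1)
        (update seqs (s 14 (s 1 0)) (seqs (s 14 (s 1 0)) ++ [s sym (s 1 0)])) := by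
  have s7 := hsym.1
  have n4 : sym ≠ 4 := by omega
  have n5 : sym ≠ 5 := by omega
  obtain ⟨cnt, word, hk, hfresh, ht, hs⟩ := hT
  rw [Lanes.erase_apply _ (by norm_num [IsArrayLane])] at hfresh ht
  simp only [Lanes.erase_apply s (k := 34) (by norm_num [IsArrayLane])] at hs
  set c := s 14 (s 1 0) with hc
  set a := s sym (s 1 0) with ha
  obtain ⟨x, hx, hxc, hxw⟩ := hs c
  have b1 : W * x + a < W * (k + 2) := by
    have := Nat.mul_le_mul_left W (hx.trans hk)
    have e2 : W * (k + 2) = W * k + W + W := by ring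
    omega
  have b2 : W * cnt + W ≤ W * (k + 2) := by
    have := Nat.mul_le_mul_left W hk
    have e2 : W * (k + 2) = W * k + W + W := by ring
    omega
  have s4 := fun (s : Lanes) => s.erase_write_scratch (k := 4) (by simp)
  have s5 := fun (s : Lanes) => s.erase_write_scratch (k := 5) (by simp)
  have s6 := fun (s : Lanes) => s.erase_write_scratch (k := 6) (by simp)
  have a9 := fun (s : Lanes) => s.erase_write (k := 9) (by norm_num [IsArrayLane])
  have a34 := fun (s : Lanes) => s.erase_write (k := 34) (by norm_num [IsArrayLane])
  have a35 := fun (s : Lanes) => s.erase_write (k := 35) (by norm_num [IsArrayLane])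
  by_cases h0 : s 35 (W * x + a) = 0
  · have ev : (trieBody sym).eval input s =
        (((((((((s.write 4 0 c).write 5 0 (W * x)).write 6 0 a).write 5 0 (W * x + a)).write 6 0
          0).write 9 0 (W * cnt + W)).write 35 (W * x + a) (W * cnt + W)).write 6 0
            (W * cnt + W)).write 4 0 c).write 34 c (W * cnt + W) := by
      simp [trieBody, Code.eval, Lanes.write, ← hc, ← ha, hxc, h0, hfresh, hW8, n4, n5]
    have hee : ((trieBody sym).eval input s).erase =
        update (update (update s.erase 9 (update (s 9) 0 (W * cnt + W))) 35
          (update (s 35) (W * x + a) (W * cnt + W))) 34 (update (s 34) c (W * cnt + W)) := by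
      rw [ev]
      simp [s4, s5, s6, a9, a34, a35,
        Lanes.erase_apply s (k := 9) (by norm_num [IsArrayLane]),
        Lanes.erase_apply s (k := 35) (by norm_num [IsArrayLane]),
        Lanes.erase_apply s (k := 34) (by norm_num [IsArrayLane])]
    refine ⟨?_, ?_, ?_, ?_, ?_⟩
    · simp [trieBody, Code.Safe, Code.eval, Lanes.write, ← hc, ← ha, hxc, h0, hfresh, hW8, n4, n5]
      omega
    · simp [ev, Lanes.write]
    · simp [ev, Lanes.write]
    · intro l l1 l2 l3
      simp [hee, l1, l2, l3]
    · rw [hee]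
      refine ⟨cnt + 1, update word (cnt + 1) (word x ++ [a]), by omega, ?_, ?_, fun d => ?_⟩
      · simp [Nat.mul_succ]
      · simpa [Nat.mul_succ] using ht.insert hx hsW h0
      · by_cases hd : d = c
        · subst hd
          exact ⟨cnt + 1, le_rfl, by simp [Nat.mul_succ], by simp [hxw]⟩
        · obtain ⟨y, hy, hyc, hyw⟩ := hs d
          refine ⟨y, by omega, by simpa [hd] using hyc, ?_⟩
          rw [update_of_ne (by omega), update_of_ne hd, hyw]
  · obtain ⟨y, hy, hyc, hyw⟩ := ht.some x hx a hsW h0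
    have hy0 : W * y ≠ 0 := by omega
    have ev : (trieBody sym).eval input s =
        (((((((s.write 4 0 c).write 5 0 (W * x)).write 6 0 a).write 5 0 (W * x + a)).write 6 0
          (W * y)).write 4 0 0).write 4 0 c).write 34 c (W * y) := by
      have hy0' := hy0
      rw [ne_eq, Nat.mul_eq_zero] at hy0'
      simp [trieBody, Code.eval, Lanes.write, ← hc, ← ha, hxc, hyc, n4, n5, hy0']
    have hee : ((trieBody sym).eval input s).erase =
        update s.erase 34 (update (s 34) c (W * y)) := by
      rw [ev]
      simp only [s4, s5, s6, a34, Lanes.erase_apply s (k := 34) (by norm_num [IsArrayLane])]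
    refine ⟨?_, ?_, ?_, ?_, ?_⟩
    · have hy0' := hy0
      rw [ne_eq, Nat.mul_eq_zero] at hy0'
      simp [trieBody, Code.Safe, Code.eval, Lanes.write, ← hc, ← ha, hxc, hyc, n4, n5, hy0']
      omega
    · simp [ev, Lanes.write]
    · simp [ev, Lanes.write]
    · intro l l1 l2 l3
      simp [hee, l2]
    · rw [hee]
      refine ⟨cnt, word, by omega, ?_, ?_, fun d => ?_⟩
      · simp [Lanes.erase_apply s (k := 9) (by norm_num [IsArrayLane]), hfresh]
      · simpa [Lanes.erase_apply s (k := 35) (by norm_num [IsArrayLane])] using ht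
      · by_cases hd : d = c
        · subst hd
          exact ⟨y, hy, by simp, by simp [hyw, hxw]⟩
        · obtain ⟨z, hz, hzc, hzw⟩ := hs d
          exact ⟨z, hz, by simpa [hd] using hzc, by rw [update_of_ne hd, hzw]⟩

/-- A pass that appends to the sequence of each name `c` in lane `14` the symbols
`F c 0, F c 1, …`, one for each occurrence of `c`. -/
lemma executes_trie {sym W : ℕ} (hsym : IsArrayLane sym) (h9 : sym ≠ 9) (h34 : sym ≠ 34)
    (h35 : sym ≠ 35) (hw : 64 * V + 64 ≤ w) {s : Lanes} {n k T : ℕ} {seqs : ℕ → List ℕ}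
    (hs : s.Bounded V) (hone : s.erase 3 0 = 1)
    (ha : s.erase 12 0 = 0) (hn : s.erase 7 0 = n) (hW : s.erase 8 0 = W) (hV : n ≤ V)
    (hT : TrieState W s.erase k seqs) (F : ℕ → ℕ → ℕ)
    (hF : ∀ i < n, s.erase sym i = F (s.erase 14 i) (countFrom (s.erase 14) 0 i (s.erase 14 i)))
    (hFW : ∀ i < n, s.erase sym i < W) (hV' : W * (k + n + 2) ≤ V) (hTime : n * 80 + 4 ≤ T) :
    ∃ s', Executes V w input (pass 12 7 (trieBody sym)) T s s' ∧
      (∀ l, l ≠ 9 → l ≠ 34 → l ≠ 35 → s'.erase l = s.erase l) ∧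
      TrieState W s'.erase (k + n)
        (fun c => seqs c ++ (List.range (countFrom (s.erase 14) 0 n c)).map (F c)) := by
  set e := s.erase with he
  obtain ⟨s', hex, h1, h2⟩ := executes_pass (V := V) (w := w) (input := input) (lo := 12) (len := 7)
    (body := trieBody sym) (s₀ := s) (a := 0) (n := n) (by norm_num) (by norm_num) (by norm_num)
    (by norm_num) (by norm_num) (by norm_num)
    (by have := hsym.1; have := hsym.2; simp [trieBody, Code.WellFormed]; omega) hw
    (fun i e' => (∀ l, l ≠ 9 → l ≠ 34 → l ≠ 35 → e' l = e l) ∧ TrieState W e' (k + i)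
      (fun c => seqs c ++ (List.range (countFrom (e 14) 0 i c)).map (F c)))
    (fun i e' h => by rw [h.1 3 (by norm_num) (by norm_num) (by norm_num), hone]) hs
    (by rwa [← Lanes.erase_apply s (by norm_num [IsArrayLane])])
    (by rwa [← Lanes.erase_apply s (by norm_num [IsArrayLane])]) (by omega)
    ⟨fun l _ _ _ => rfl, by simpa [countFrom_zero] using hT⟩
    (fun i s' hi hs' ⟨g1, g2⟩ h1' h3' => by
      rw [zero_add] at h1'
      have e8 : s' 8 0 = W := by
        rw [← hW, ← g1 8 (by norm_num) (by norm_num) (by norm_num),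
          Lanes.erase_apply _ (by norm_num [IsArrayLane])]
      have e14 : s' 14 = e 14 := by
        rw [← g1 14 (by norm_num) (by norm_num) (by norm_num),
          Lanes.erase_apply _ (by norm_num [IsArrayLane])]
      have es : s' sym = e sym := by rw [← g1 sym h9 h34 h35, Lanes.erase_apply _ hsym]
      obtain ⟨r1, r2, r3, r4, r5⟩ := trieBody_spec (V := V) (input := input) hsym g2 e8
        (by rw [h1', es]; exact hFW i hi)
        (le_trans (Nat.mul_le_mul_left W (by omega)) hV')
      refine ⟨r1, by rw [r2, h1', zero_add], r3, fun l l1 l2 l3 => (r4 l l1 l2 l3).trans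
        (g1 l l1 l2 l3), ?_⟩
      rw [← add_assoc]
      convert r5 using 1
      funext c
      rw [h1', e14, es, countFrom_succ_apply, zero_add]
      by_cases hc : c = e 14 i
      · subst hc
        simp only [if_true, update_self]
        rw [List.range_succ, List.map_append, List.append_assoc, hF i hi]
        rfl
      · rw [update_of_ne hc, if_neg (Ne.symm hc), add_zero])
  exact ⟨s', hex.mono (by simp [trieBody, Code.cost]; omega), h1, h2⟩

end LockedMatroid

namespace LockedMatroid

open Function

variable {V w : ℕ} {input : ℕ → ℕ → ℕ}

/-! ### The program

Lanes: `7` total number of elements, `8` that number plus one, `9` last trie node, `10` flag for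
a difference, `11` and `13` numbers of elements of the two matroids, `12` zero, `14` to `17`
component, parallel closure, coparallel closure and rank of each element, `18` multiples of the
content of lane `8`, `20`, `22` and `24` positions in the parallel class, the coparallel class
and the component, with counters in `19`, `21` and `23`, `26` to `28` pairs of a component and a
position, coded as one number, with the part of the component in `25`, `29` and `30` numbers of
elements with a given pair, `31` unused results, `32` and `33` symbols of the two profiles, `34`
trie nodes of the components, `35` the trie, `36` trie nodes of the elements, `37` and `38`
multiplicities of the nodes in both matroids. -/

/-- The contents of the scalar variables after the initialization. -/
structure Header (n₁ n₂ : ℕ) (e : Lanes) : Prop where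
  one : e 3 0 = 1
  total : e 7 0 = n₁ + n₂
  width : e 8 0 = n₁ + n₂ + 1
  flag : e 10 0 = 0
  first : e 11 0 = n₁
  zero : e 12 0 = 0
  second : e 13 0 = n₂

lemma Header.congr {n₁ n₂ : ℕ} {e e' : Lanes} (h : Header n₁ n₂ e)
    (he : ∀ k, k < 14 → k ≠ 9 → e' k = e k) : Header n₁ n₂ e' where
  one := by rw [he 3 (by norm_num) (by norm_num), h.one]
  total := by rw [he 7 (by norm_num) (by norm_num), h.total]
  width := by rw [he 8 (by norm_num) (by norm_num), h.width]
  flag := by rw [he 10 (by norm_num) (by norm_num), h.flag]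
  first := by rw [he 11 (by norm_num) (by norm_num), h.first]
  zero := by rw [he 12 (by norm_num) (by norm_num), h.zero]
  second := by rw [he 13 (by norm_num) (by norm_num), h.second]

lemma Header.update {n₁ n₂ : ℕ} {e : Lanes} (h : Header n₁ n₂ e) {k : ℕ} (hk : 14 ≤ k)
    (f : ℕ → ℕ) : Header n₁ n₂ (update e k f) :=
  h.congr fun l hl _ => update_of_ne (by omega) _ _

lemma countFrom_congr {f g : ℕ → ℕ} {a n : ℕ} (h : ∀ t < n, f (a + t) = g (a + t)) :
    countFrom f a n = countFrom g a n := by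
  funext v
  simp only [countFrom]
  congr 1
  refine Finset.filter_congr fun t ht => ?_
  rw [h t (Finset.mem_range.1 ht)]

section Passes

variable {n₁ n₂ T : ℕ} {s : Lanes}

lemma Header.executes_copy_pair (hH : Header n₁ n₂ s.erase) (hw : 64 * V + 64 ≤ w)
    (hs : s.Bounded V) {shift j₁ j₂ out z : ℕ} (hout : 14 ≤ out) (hout' : out < 64)
    (hshift : shift = 11 ∨ shift = 12) (hz : s.erase shift 0 = z) (D : ℕ → ℕ)
    (h₁ : ∀ i < n₁, input j₁ i = D i) (h₂ : ∀ i < n₂, input j₂ i + z = D (n₁ + i))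
    (hD : ∀ i < n₁ + n₂, D i ≤ V) (hV : n₁ + n₂ ≤ V) (hT : 15 * (n₁ + n₂ + 1) ≤ T) :
    ∃ s' L, Executes V w input (.seq (pass 12 11 (copyBody 12 12 j₁ out))
        (pass 12 13 (copyBody 11 shift j₂ out))) T s s' ∧
      s'.erase = Function.update s.erase out L ∧ ∀ i < n₁ + n₂, L i = D i := by
  have ho : IsArrayLane out := ⟨by omega, hout'⟩
  have hsh : IsArrayLane shift := by
    rcases hshift with rfl | rfl <;> norm_num [IsArrayLane]
  obtain ⟨s₁, x₁, g₁⟩ := executes_copy (V := V) (w := w) (input := input) (off := 12) (shift := 12)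
    (j := j₁) (out := out) (origin := 12) (len := 11) (s := s) (n := n₁) (T := n₁ * 15 + 4)
    (by norm_num [IsArrayLane]) (by norm_num [IsArrayLane]) ho (by norm_num [IsArrayLane])
    (by norm_num [IsArrayLane]) (by omega) (by omega) hw hs hH.one hH.zero hH.first
    (by rw [hH.zero]; omega) (fun i hi => by rw [hH.zero, h₁ i hi]; exact hD i (by omega)) le_rfl
  have hH₁ : Header n₁ n₂ s₁.erase := g₁ ▸ hH.update hout _
  have hz₁ : s₁.erase shift 0 = z := by
    rw [g₁, update_of_ne (by omega), hz]
  obtain ⟨s₂, x₂, g₂⟩ := executes_copy (V := V) (w := w) (input := input) (off := 11)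
    (shift := shift)
    (j := j₂) (out := out) (origin := 12) (len := 13) (s := s₁) (n := n₂) (T := n₂ * 15 + 4)
    (by norm_num [IsArrayLane]) hsh ho (by norm_num [IsArrayLane])
    (by norm_num [IsArrayLane]) (by omega) (by omega) hw x₁.1 hH₁.one hH₁.zero hH₁.second
    (by rw [hH₁.first]; omega) (fun i hi => by rw [hz₁, h₂ i hi]; exact hD _ (by omega)) le_rfl
  have hu : ∀ f, Function.update s₁.erase out f = Function.update s.erase out f := fun f => by
    rw [g₁, update_idem]
  refine ⟨s₂, _, (x₁.seq x₂).mono (by omega), g₂.trans (hu _), fun i hi => ?_⟩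
  rw [hz₁, hH₁.first, g₁, update_self, hH.zero]
  by_cases hi₁ : i < n₁
  · rw [fill, if_neg (by omega), fill_apply _ _ (by omega) (by omega), ← h₁ i hi₁]
    simp
  · rw [fill_apply _ _ (by omega) (by omega), h₂ _ (by omega)]
    congr 1
    omega

lemma Header.executes_count (hH : Header n₁ n₂ s.erase) (hw : 64 * V + 64 ≤ w)
    (hs : s.Bounded V) {src cnt out : ℕ} (hsrc : 14 ≤ src) (hsrc' : src < 64) (hcnt : 14 ≤ cnt)
    (hcnt' : cnt < 64) (hout : 14 ≤ out) (hout' : out < 64) (h1 : src ≠ cnt) (h2 : src ≠ out)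
    (h3 : cnt ≠ out) (hV : n₁ + n₂ ≤ V) (hz : s.erase cnt = 0) (f : ℕ → ℕ)
    (hf : ∀ i < n₁ + n₂, s.erase src i = f i) (hT : 40 * (n₁ + n₂ + 1) ≤ T) :
    ∃ s' L, Executes V w input (pass 12 7 (countBody src cnt out)) T s s' ∧
      s'.erase = Function.update (Function.update s.erase cnt (countFrom f 0 (n₁ + n₂))) out L ∧
      ∀ i < n₁ + n₂, L i = countFrom f 0 i (f i) + 1 := by
  obtain ⟨s', x, g⟩ := LockedMatroid.executes_count (V := V) (w := w) (input := input) (src := src)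
    (cnt := cnt) (out := out) (lo := 12) (len := 7) (s := s) (a := 0) (n := n₁ + n₂) (T := T)
    ⟨by omega, hsrc'⟩ ⟨by omega, hcnt'⟩ ⟨by omega, hout'⟩ (by norm_num [IsArrayLane])
    (by norm_num [IsArrayLane]) h1 h2 h3 hw hs hH.one hH.zero hH.total (by omega) hz (by omega)
  have hc : ∀ m ≤ n₁ + n₂, countFrom (s.erase src) 0 m = countFrom f 0 m := fun m hm =>
    countFrom_congr fun t ht => hf _ (by omega)
  refine ⟨s', _, x, by rw [g, hc _ le_rfl], fun i hi => ?_⟩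
  rw [fill_apply _ _ (by omega) (by omega), hf i hi, hc _ (by omega), Nat.sub_zero]

lemma Header.executes_gather (hH : Header n₁ n₂ s.erase) (hw : 64 * V + 64 ≤ w)
    (hs : s.Bounded V) {tbl idx out : ℕ} (htbl : 14 ≤ tbl) (htbl' : tbl < 64) (hidx : 14 ≤ idx)
    (hidx' : idx < 64) (hout : 14 ≤ out) (hout' : out < 64) (h1 : tbl ≠ out) (h2 : idx ≠ out)
    (hV : n₁ + n₂ ≤ V) (f : ℕ → ℕ)
    (hf : ∀ i < n₁ + n₂, s.erase idx i = f i) (hT : 40 * (n₁ + n₂ + 1) ≤ T) :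
    ∃ s' L, Executes V w input (pass 12 7 (gatherBody tbl idx out)) T s s' ∧
      s'.erase = Function.update s.erase out L ∧
      ∀ i < n₁ + n₂, L i = s.erase tbl (f i) := by
  obtain ⟨s', x, g⟩ := LockedMatroid.executes_gather (V := V) (w := w) (input := input)
    (tbl := tbl) (idx := idx) (out := out) (lo := 12) (len := 7) (s := s) (a := 0) (n := n₁ + n₂)
    (T := T) ⟨by omega, htbl'⟩ ⟨by omega, hidx'⟩ ⟨by omega, hout'⟩ (by norm_num [IsArrayLane])
    (by norm_num [IsArrayLane]) h1 h2 hw hs hH.one hH.zero hH.total (by omega) (by omega)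
  refine ⟨s', _, x, g, fun i hi => ?_⟩
  rw [fill_apply _ _ (by omega) (by omega), hf i hi]

lemma Header.executes_add (hH : Header n₁ n₂ s.erase) (hw : 64 * V + 64 ≤ w)
    (hs : s.Bounded V) {x y out : ℕ} (hx : 14 ≤ x) (hx' : x < 64) (hy : 14 ≤ y)
    (hy' : y < 64) (hout : 14 ≤ out) (hout' : out < 64) (h1 : x ≠ out) (h2 : y ≠ out)
    (hV : n₁ + n₂ ≤ V) (f g : ℕ → ℕ) (hf : ∀ i < n₁ + n₂, s.erase x i = f i)
    (hg : ∀ i < n₁ + n₂, s.erase y i = g i) (hfg : ∀ i < n₁ + n₂, f i + g i ≤ V)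
    (hT : 40 * (n₁ + n₂ + 1) ≤ T) :
    ∃ s' L, Executes V w input (pass 12 7 (addBody x y out)) T s s' ∧
      s'.erase = Function.update s.erase out L ∧
      ∀ i < n₁ + n₂, L i = f i + g i := by
  obtain ⟨s', hx, h⟩ := LockedMatroid.executes_add (V := V) (w := w) (input := input)
    (x := x) (y := y) (out := out) (lo := 12) (len := 7) (s := s) (a := 0) (n := n₁ + n₂)
    (T := T) ⟨by omega, hx'⟩ ⟨by omega, hy'⟩ ⟨by omega, hout'⟩ (by norm_num [IsArrayLane])
    (by norm_num [IsArrayLane]) h1 h2 hw hs hH.one hH.zero hH.total (by omega)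
    (fun i hi => by rw [zero_add, hf i hi, hg i hi]; exact hfg i hi) (by omega)
  refine ⟨s', _, hx, h, fun i hi => ?_⟩
  rw [fill_apply _ _ (by omega) (by omega), hf i hi, hg i hi]

end Passes

/-- Initialization and copying of the input; the names of the second matroid are shifted. -/
def loadProgram : Program :=
  .seq (Code.compile (.seq (.set 3 1) (.seq (.read 11 0 12) (.seq (.read 13 5 12)
    (.seq (.add 7 11 13) (.add 8 7 3))))))
  (.seq (.seq (pass 12 11 (copyBody 12 12 1 14)) (pass 12 13 (copyBody 11 11 6 14)))
  (.seq (.seq (pass 12 11 (copyBody 12 12 2 15)) (pass 12 13 (copyBody 11 11 7 15)))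
  (.seq (.seq (pass 12 11 (copyBody 12 12 3 16)) (pass 12 13 (copyBody 11 11 8 16)))
  (.seq (.seq (pass 12 11 (copyBody 12 12 4 17)) (pass 12 13 (copyBody 11 12 9 17)))
    (pass 12 7 (multiplesBody 8 18))))))

/-- The input arrays are the two parts of functions on `{0, …, n₁ + n₂ - 1}`: names `C`, `P`, `Q` of
the component, the parallel class and the coparallel class, and the rank `R` of the component. The
names of the second matroid are shifted by `n₁`, so that they differ from those of the first. -/
structure Reads (input : ℕ → ℕ → ℕ) (n₁ n₂ : ℕ) (C P Q R : ℕ → ℕ) : Prop where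
  size₁ : input 0 0 = n₁
  size₂ : input 5 0 = n₂
  comp₁ : ∀ i < n₁, input 1 i = C i
  comp₂ : ∀ i < n₂, input 6 i + n₁ = C (n₁ + i)
  par₁ : ∀ i < n₁, input 2 i = P i
  par₂ : ∀ i < n₂, input 7 i + n₁ = P (n₁ + i)
  copar₁ : ∀ i < n₁, input 3 i = Q i
  copar₂ : ∀ i < n₂, input 8 i + n₁ = Q (n₁ + i)
  rank₁ : ∀ i < n₁, input 4 i = R i
  rank₂ : ∀ i < n₂, input 9 i = R (n₁ + i)
  comp_lt : ∀ i < n₁ + n₂, C i < n₁ + n₂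
  par_lt : ∀ i < n₁ + n₂, P i < n₁ + n₂
  copar_lt : ∀ i < n₁ + n₂, Q i < n₁ + n₂
  rank_le : ∀ i < n₁ + n₂, R i ≤ n₁ + n₂

variable {n₁ n₂ : ℕ} {C P Q R : ℕ → ℕ}

lemma executes_loadProgram (hI : Reads input n₁ n₂ C P Q R) (hw : 64 * V + 64 ≤ w)
    (hV : (n₁ + n₂ + 1) * (n₁ + n₂) + (n₁ + n₂) + 1 ≤ V) :
    ∃ s, Executes V w input loadProgram (110 * (n₁ + n₂ + 1)) (fun _ _ => 0) s ∧
      Header n₁ n₂ s.erase ∧ (∀ i < n₁ + n₂, s.erase 14 i = C i) ∧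
      (∀ i < n₁ + n₂, s.erase 15 i = P i) ∧ (∀ i < n₁ + n₂, s.erase 16 i = Q i) ∧
      (∀ i < n₁ + n₂, s.erase 17 i = R i) ∧
      (∀ x ≤ n₁ + n₂, s.erase 18 x = x * (n₁ + n₂ + 1)) ∧
      ∀ k, k = 9 ∨ 19 ≤ k → s.erase k = 0 := by
  have hVn : n₁ + n₂ + 1 ≤ V := by
    have := Nat.zero_le ((n₁ + n₂ + 1) * (n₁ + n₂))
    omega
  have x₀ := Code.executes (V := V) (w := w) (input := input) (s := fun _ _ => 0)
    (.seq (.set 3 1) (.seq (.read 11 0 12) (.seq (.read 13 5 12)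
    (.seq (.add 7 11 13) (.add 8 7 3))))) (by decide) hw (fun _ _ => Nat.zero_le _)
    (by simp [Code.Safe, Code.eval, Lanes.write, hI.size₁, hI.size₂]; omega)
  obtain ⟨s₀, hs₀⟩ : ∃ s, s = Code.eval input (.seq (.set 3 1) (.seq (.read 11 0 12)
    (.seq (.read 13 5 12) (.seq (.add 7 11 13) (.add 8 7 3))))) (fun _ _ => 0) := ⟨_, rfl⟩
  rw [← hs₀] at x₀
  have H₀ : Header n₁ n₂ s₀.erase := by
    constructor <;> simp [hs₀, Lanes.erase, Code.eval, Lanes.write, hI.size₁, hI.size₂]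
  have z₀ : ∀ k, k = 9 ∨ 14 ≤ k → s₀.erase k = 0 := by
    intro k hk
    have : k ≠ 3 ∧ k ≠ 7 ∧ k ≠ 8 ∧ k ≠ 11 ∧ k ≠ 13 := by omega
    have h2 : ¬ (k = 1 ∨ k = 2 ∨ k = 4 ∨ k = 5 ∨ k = 6) := by omega
    funext i
    simp only [Lanes.erase, if_neg h2]
    simp [hs₀, Code.eval, Lanes.write, this]
  obtain ⟨s₁, L₁, x₁, g₁, f₁⟩ := H₀.executes_copy_pair (T := 15 * (n₁ + n₂ + 1)) (out := 14)
    (shift := 11) hw x₀.1 (by norm_num) (by norm_num) (by norm_num) H₀.first C hI.comp₁ hI.comp₂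
    (fun i hi => by have := hI.comp_lt i hi; omega) (by omega) le_rfl
  have H₁ : Header n₁ n₂ s₁.erase := g₁ ▸ H₀.update (by norm_num) _
  obtain ⟨s₂, L₂, x₂, g₂, f₂⟩ := H₁.executes_copy_pair (T := 15 * (n₁ + n₂ + 1)) (out := 15)
    (shift := 11) hw x₁.1 (by norm_num) (by norm_num) (by norm_num) H₁.first P hI.par₁ hI.par₂
    (fun i hi => by have := hI.par_lt i hi; omega) (by omega) le_rfl
  have H₂ : Header n₁ n₂ s₂.erase := g₂ ▸ H₁.update (by norm_num) _
  obtain ⟨s₃, L₃, x₃, g₃, f₃⟩ := H₂.executes_copy_pair (T := 15 * (n₁ + n₂ + 1)) (out := 16)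
    (shift := 11) hw x₂.1 (by norm_num) (by norm_num) (by norm_num) H₂.first Q hI.copar₁ hI.copar₂
    (fun i hi => by have := hI.copar_lt i hi; omega) (by omega) le_rfl
  have H₃ : Header n₁ n₂ s₃.erase := g₃ ▸ H₂.update (by norm_num) _
  obtain ⟨s₄, L₄, x₄, g₄, f₄⟩ := H₃.executes_copy_pair (T := 15 * (n₁ + n₂ + 1)) (out := 17)
    (shift := 12) hw x₃.1 (by norm_num) (by norm_num) (by norm_num) H₃.zero R hI.rank₁
    hI.rank₂ (fun i hi => by have := hI.rank_le i hi; omega) (by omega) le_rfl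
  have H₄ : Header n₁ n₂ s₄.erase := g₄ ▸ H₃.update (by norm_num) _
  have z₄ : ∀ k, k = 9 ∨ 18 ≤ k → s₄.erase k = 0 := by
    intro k hk
    rw [g₄, g₃, g₂, g₁, update_of_ne (by omega), update_of_ne (by omega), update_of_ne (by omega),
      update_of_ne (by omega), z₀ k (by omega)]
  obtain ⟨s₅, x₅, g₅⟩ := executes_multiples (V := V) (w := w) (input := input) (step := 8)
    (out := 18) (origin := 12) (len := 7) (n := n₁ + n₂) (d := n₁ + n₂ + 1) (s := s₄)
    (T := 40 * (n₁ + n₂ + 1))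
    (by norm_num [IsArrayLane]) (by norm_num [IsArrayLane]) (by norm_num [IsArrayLane])
    (by norm_num [IsArrayLane]) (by norm_num) hw x₄.1 H₄.one H₄.zero H₄.total H₄.width (by omega)
    (by rw [mul_comm]; omega) (z₄ 18 (by norm_num)) (by omega)
  have H₅ : Header n₁ n₂ s₅.erase := g₅ ▸ H₄.update (by norm_num) _
  refine ⟨s₅, (x₀.seq (x₁.seq (x₂.seq (x₃.seq (x₄.seq x₅))))).mono ?_, H₅, ?_, ?_, ?_, ?_, ?_, ?_⟩
  · simp only [Code.cost]
    omega
  · intro i hi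
    rw [← f₁ i hi]
    simp [g₅, g₄, g₃, g₂, g₁]
  · intro i hi
    rw [← f₂ i hi]
    simp [g₅, g₄, g₃, g₂]
  · intro i hi
    rw [← f₃ i hi]
    simp [g₅, g₄, g₃]
  · intro i hi
    rw [← f₄ i hi]
    simp [g₅, g₄]
  · intro x hx
    simp [g₅, hx]
  · intro k hk
    rw [g₅, update_of_ne (by omega), z₄ k (by omega)]

/-- Computation of the positions of the elements in their classes, and of the class numbers. -/
def profileProgram : Program :=
  .seq (pass 12 7 (countBody 15 19 20)) (.seq (pass 12 7 (countBody 16 21 22))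
  (.seq (pass 12 7 (countBody 14 23 24)) (.seq (pass 12 7 (gatherBody 18 14 25))
  (.seq (pass 12 7 (addBody 25 20 26)) (.seq (pass 12 7 (addBody 25 22 27))
  (.seq (pass 12 7 (addBody 25 24 28)) (.seq (pass 12 7 (countBody 26 29 31))
  (.seq (pass 12 7 (countBody 27 30 31)) (.seq (pass 12 7 (gatherBody 29 28 32))
    (pass 12 7 (gatherBody 30 28 33)))))))))))

/-- The position, counted from `1`, of `i` among the indices with the same value of `f`. -/
def position (f : ℕ → ℕ) (i : ℕ) : ℕ := countFrom f 0 i (f i) + 1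

lemma position_le (f : ℕ → ℕ) (i : ℕ) : position f i ≤ i + 1 :=
  Nat.succ_le_succ (countFrom_le f 0 i (f i))

/-- The number of indices below `n` in the component `c` that have position `t + 1` in their class
of `P`. It is the number of classes with more than `t` elements, so that these numbers, taken for
`t = 0, 1, …`, form the partition conjugate to that of the class sizes. -/
def profile (n : ℕ) (C P : ℕ → ℕ) (c t : ℕ) : ℕ :=
  ((Finset.range n).filter fun i => C i = c ∧ position P i = t + 1).card

lemma profile_le (n : ℕ) (C P : ℕ → ℕ) (c t : ℕ) : profile n C P c t ≤ n := by
  simpa only [profile, Finset.card_range] using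
    Finset.card_filter_le (Finset.range n) fun i => C i = c ∧ position P i = t + 1

/-- A pair of a component and a position is coded by one number, so the profile can be computed by
counting. -/
lemma countFrom_key (n : ℕ) (C P : ℕ → ℕ) {c t : ℕ} (ht : t < n) :
    countFrom (fun i => C i * (n + 1) + position P i) 0 n (c * (n + 1) + (t + 1)) =
      profile n C P c t := by
  simp only [countFrom, profile, zero_add]
  congr 1
  refine Finset.filter_congr fun i hi => ?_
  have hi' := Finset.mem_range.1 hi
  have hp := position_le P i
  constructor
  · intro h
    rw [mul_comm, mul_comm c] at h
    exact address_inj (by omega) (by omega) h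
  · rintro ⟨rfl, h⟩
    rw [h]

lemma executes_profileProgram (hI : Reads input n₁ n₂ C P Q R) (hw : 64 * V + 64 ≤ w)
    (hV : (n₁ + n₂ + 1) * (n₁ + n₂) + (n₁ + n₂) + 1 ≤ V) {s : Lanes} (hs : s.Bounded V)
    (hH : Header n₁ n₂ s.erase) (h14 : ∀ i < n₁ + n₂, s.erase 14 i = C i)
    (h15 : ∀ i < n₁ + n₂, s.erase 15 i = P i) (h16 : ∀ i < n₁ + n₂, s.erase 16 i = Q i)
    (h18 : ∀ x ≤ n₁ + n₂, s.erase 18 x = x * (n₁ + n₂ + 1))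
    (hz : ∀ k, k = 9 ∨ 19 ≤ k → s.erase k = 0) :
    ∃ s', Executes V w input profileProgram (440 * (n₁ + n₂ + 1)) s s' ∧
      Header n₁ n₂ s'.erase ∧ s'.erase 14 = s.erase 14 ∧ s'.erase 17 = s.erase 17 ∧
      (∀ i < n₁ + n₂, s'.erase 32 i = profile (n₁ + n₂) C P (C i) (countFrom C 0 i (C i))) ∧
      (∀ i < n₁ + n₂, s'.erase 33 i = profile (n₁ + n₂) C Q (C i) (countFrom C 0 i (C i))) ∧
      ∀ k, k = 9 ∨ 34 ≤ k → s'.erase k = 0 := by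
  obtain ⟨n, hn⟩ : ∃ n, n = n₁ + n₂ := ⟨_, rfl⟩
  have hVn : n₁ + n₂ ≤ V := by
    have := Nat.zero_le ((n₁ + n₂ + 1) * (n₁ + n₂))
    omega
  have hkey : ∀ (F : ℕ → ℕ) i, i < n₁ + n₂ →
      C i * (n₁ + n₂ + 1) + position F i ≤ V := fun F i hi => by
    have h1 := hI.comp_lt i hi
    have h2 := position_le F i
    have h3 : C i * (n₁ + n₂ + 1) ≤ (n₁ + n₂) * (n₁ + n₂ + 1) := Nat.mul_le_mul_right _ h1.le
    rw [mul_comm (n₁ + n₂)] at h3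
    omega
  obtain ⟨s₁, L₁, x₁, g₁, f₁⟩ := hH.executes_count (src := 15) (cnt := 19) (out := 20) hw hs
    (by norm_num) (by norm_num) (by norm_num) (by norm_num) (by norm_num) (by norm_num)
    (by norm_num) (by norm_num) (by norm_num) hVn (hz 19 (by norm_num)) P h15 le_rfl
  have H₁ : Header n₁ n₂ s₁.erase := g₁ ▸ (hH.update (by norm_num) _).update (by norm_num) _
  obtain ⟨s₂, L₂, x₂, g₂, f₂⟩ := H₁.executes_count (src := 16) (cnt := 21) (out := 22) hw x₁.1
    (by norm_num) (by norm_num) (by norm_num) (by norm_num) (by norm_num) (by norm_num)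
    (by norm_num) (by norm_num) (by norm_num) hVn (by simpa [g₁] using hz 21 (by norm_num)) Q
    (by simpa [g₁] using h16) le_rfl
  have H₂ : Header n₁ n₂ s₂.erase := g₂ ▸ (H₁.update (by norm_num) _).update (by norm_num) _
  obtain ⟨s₃, L₃, x₃, g₃, f₃⟩ := H₂.executes_count (src := 14) (cnt := 23) (out := 24) hw x₂.1
    (by norm_num) (by norm_num) (by norm_num) (by norm_num) (by norm_num) (by norm_num)
    (by norm_num) (by norm_num) (by norm_num) hVn
    (by simpa [g₁, g₂] using hz 23 (by norm_num)) C (by simpa [g₁, g₂] using h14) le_rfl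
  have H₃ : Header n₁ n₂ s₃.erase := g₃ ▸ (H₂.update (by norm_num) _).update (by norm_num) _
  obtain ⟨s₄, L₄, x₄, g₄, f₄⟩ := H₃.executes_gather (tbl := 18) (idx := 14) (out := 25) hw x₃.1
    (by norm_num) (by norm_num) (by norm_num) (by norm_num) (by norm_num) (by norm_num)
    (by norm_num) (by norm_num) hVn C (by simpa [g₁, g₂, g₃] using h14) le_rfl
  have H₄ : Header n₁ n₂ s₄.erase := g₄ ▸ H₃.update (by norm_num) _
  have f₄' : ∀ i < n₁ + n₂, L₄ i = C i * (n₁ + n₂ + 1) := fun i hi => by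
    rw [f₄ i hi, ← h18 _ (hI.comp_lt i hi).le]
    simp [g₁, g₂, g₃]
  obtain ⟨s₅, L₅, x₅, g₅, f₅⟩ := H₄.executes_add (x := 25) (y := 20) (out := 26) hw x₄.1
    (by norm_num) (by norm_num) (by norm_num) (by norm_num) (by norm_num) (by norm_num)
    (by norm_num) (by norm_num) hVn (fun i => C i * (n₁ + n₂ + 1)) (position P)
    (by simpa [g₄] using f₄') (by simpa [g₄, g₃, g₂, g₁, position] using f₁) (hkey P) le_rfl
  have H₅ : Header n₁ n₂ s₅.erase := g₅ ▸ H₄.update (by norm_num) _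
  obtain ⟨s₆, L₆, x₆, g₆, f₆⟩ := H₅.executes_add (x := 25) (y := 22) (out := 27) hw x₅.1
    (by norm_num) (by norm_num) (by norm_num) (by norm_num) (by norm_num) (by norm_num)
    (by norm_num) (by norm_num) hVn (fun i => C i * (n₁ + n₂ + 1)) (position Q)
    (by simpa [g₅, g₄] using f₄') (by simpa [g₅, g₄, g₃, g₂, position] using f₂) (hkey Q) le_rfl
  have H₆ : Header n₁ n₂ s₆.erase := g₆ ▸ H₅.update (by norm_num) _
  obtain ⟨s₇, L₇, x₇, g₇, f₇⟩ := H₆.executes_add (x := 25) (y := 24) (out := 28) hw x₆.1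
    (by norm_num) (by norm_num) (by norm_num) (by norm_num) (by norm_num) (by norm_num)
    (by norm_num) (by norm_num) hVn (fun i => C i * (n₁ + n₂ + 1)) (position C)
    (by simpa [g₆, g₅, g₄] using f₄') (by simpa [g₆, g₅, g₄, g₃, position] using f₃) (hkey C) le_rfl
  have H₇ : Header n₁ n₂ s₇.erase := g₇ ▸ H₆.update (by norm_num) _
  obtain ⟨s₈, L₈, x₈, g₈, f₈⟩ := H₇.executes_count (src := 26) (cnt := 29) (out := 31) hw x₇.1
    (by norm_num) (by norm_num) (by norm_num) (by norm_num) (by norm_num) (by norm_num)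
    (by norm_num) (by norm_num) (by norm_num) hVn
    (by simpa [g₁, g₂, g₃, g₄, g₅, g₆, g₇] using hz 29 (by norm_num)) _
    (by simpa [g₇, g₆, g₅] using f₅) le_rfl
  have H₈ : Header n₁ n₂ s₈.erase := g₈ ▸ (H₇.update (by norm_num) _).update (by norm_num) _
  obtain ⟨s₉, L₉, x₉, g₉, f₉⟩ := H₈.executes_count (src := 27) (cnt := 30) (out := 31) hw x₈.1
    (by norm_num) (by norm_num) (by norm_num) (by norm_num) (by norm_num) (by norm_num)
    (by norm_num) (by norm_num) (by norm_num) hVn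
    (by simpa [g₁, g₂, g₃, g₄, g₅, g₆, g₇, g₈] using hz 30 (by norm_num)) _
    (by simpa [g₈, g₇, g₆] using f₆) le_rfl
  have H₉ : Header n₁ n₂ s₉.erase := g₉ ▸ (H₈.update (by norm_num) _).update (by norm_num) _
  obtain ⟨s₁₀, L₁₀, x₁₀, g₁₀, f₁₀⟩ := H₉.executes_gather (tbl := 29) (idx := 28) (out := 32) hw x₉.1
    (by norm_num) (by norm_num) (by norm_num) (by norm_num) (by norm_num) (by norm_num)
    (by norm_num) (by norm_num) hVn _ (by simpa [g₉, g₈, g₇] using f₇) le_rfl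
  have H₁₀ : Header n₁ n₂ s₁₀.erase := g₁₀ ▸ H₉.update (by norm_num) _
  obtain ⟨s₁₁, L₁₁, x₁₁, g₁₁, f₁₁⟩ := H₁₀.executes_gather (tbl := 30) (idx := 28) (out := 33) hw
    x₁₀.1 (by norm_num) (by norm_num) (by norm_num) (by norm_num) (by norm_num) (by norm_num)
    (by norm_num) (by norm_num) hVn _ (by simpa [g₁₀, g₉, g₈, g₇] using f₇) le_rfl
  have H₁₁ : Header n₁ n₂ s₁₁.erase := g₁₁ ▸ H₁₀.update (by norm_num) _
  refine ⟨s₁₁, (x₁.seq (x₂.seq (x₃.seq (x₄.seq (x₅.seq (x₆.seq (x₇.seq (x₈.seq (x₉.seq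
    (x₁₀.seq x₁₁)))))))))).mono (by omega), H₁₁, ?_, ?_, fun i hi => ?_, fun i hi => ?_,
    fun k hk => ?_⟩
  · simp [g₁₁, g₁₀, g₉, g₈, g₇, g₆, g₅, g₄, g₃, g₂, g₁]
  · simp [g₁₁, g₁₀, g₉, g₈, g₇, g₆, g₅, g₄, g₃, g₂, g₁]
  · have hc := countFrom_le C 0 i (C i)
    rw [g₁₁, update_of_ne (by norm_num), g₁₀, update_self, f₁₀ i hi, g₉,
      update_of_ne (by norm_num), update_of_ne (by norm_num), g₈, update_of_ne (by norm_num),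
      update_self, position]
    exact countFrom_key _ C P (by omega)
  · have hc := countFrom_le C 0 i (C i)
    rw [g₁₁, update_self, f₁₁ i hi, g₁₀, update_of_ne (by norm_num), g₉,
      update_of_ne (by norm_num), update_self, position]
    exact countFrom_key _ C Q (by omega)
  · have h' : k ≠ 19 ∧ k ≠ 20 ∧ k ≠ 21 ∧ k ≠ 22 ∧ k ≠ 23 ∧ k ≠ 24 ∧ k ≠ 25 ∧ k ≠ 26 ∧ k ≠ 27 ∧
      k ≠ 28 ∧ k ≠ 29 ∧ k ≠ 30 ∧ k ≠ 31 ∧ k ≠ 32 ∧ k ≠ 33 := by omega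
    rw [← hz k (by omega)]
    simp [g₁₁, g₁₀, g₉, g₈, g₇, g₆, g₅, g₄, g₃, g₂, g₁, h']

end LockedMatroid

namespace LockedMatroid

open Function

variable {V w : ℕ} {input : ℕ → ℕ → ℕ} {n₁ n₂ : ℕ} {C P Q R : ℕ → ℕ}

/-- The sequence that is computed for the component with the name `c`: its rank, repeated as often
as the component has elements, followed by the two partitions conjugate to the sizes of its parallel
and of its coparallel classes, padded with zeros to the number of elements. -/
def signature (n : ℕ) (C P Q ρ : ℕ → ℕ) (c : ℕ) : List ℕ :=
  (List.range (countFrom C 0 n c)).map (fun _ => ρ c) ++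
    (List.range (countFrom C 0 n c)).map (profile n C P c) ++
    (List.range (countFrom C 0 n c)).map (profile n C Q c)

/-- Naming of the components by the trie nodes of their signatures. -/
def namingProgram : Program :=
  .seq (pass 12 7 (trieBody 17)) (.seq (pass 12 7 (trieBody 32)) (.seq (pass 12 7 (trieBody 33))
    (pass 12 7 (gatherBody 34 14 36))))

lemma executes_namingProgram (hw : 64 * V + 64 ≤ w)
    (hV : (n₁ + n₂ + 1) * (3 * (n₁ + n₂) + 2) ≤ V) {s : Lanes} (hs : s.Bounded V)
    (hH : Header n₁ n₂ s.erase) (h14 : ∀ i < n₁ + n₂, s.erase 14 i = C i) {ρ : ℕ → ℕ}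
    (h17 : ∀ i < n₁ + n₂, s.erase 17 i = ρ (C i)) (hρ : ∀ i < n₁ + n₂, ρ (C i) ≤ n₁ + n₂)
    (h32 : ∀ i < n₁ + n₂, s.erase 32 i = profile (n₁ + n₂) C P (C i) (countFrom C 0 i (C i)))
    (h33 : ∀ i < n₁ + n₂, s.erase 33 i = profile (n₁ + n₂) C Q (C i) (countFrom C 0 i (C i)))
    (hz : ∀ k, k = 9 ∨ 34 ≤ k → s.erase k = 0) :
    ∃ s', Executes V w input namingProgram (300 * (n₁ + n₂ + 1)) s s' ∧
      Header n₁ n₂ s'.erase ∧ s'.erase 37 = 0 ∧ s'.erase 38 = 0 ∧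
      ∀ i < n₁ + n₂, ∀ j < n₁ + n₂, s'.erase 36 i = s'.erase 36 j ↔
        signature (n₁ + n₂) C P Q ρ (C i) = signature (n₁ + n₂) C P Q ρ (C j) := by
  have hVn : n₁ + n₂ ≤ V := by nlinarith
  have hcC : ∀ i, i ≤ n₁ + n₂ → countFrom (s.erase 14) 0 i = countFrom C 0 i := fun i hi =>
    countFrom_congr fun t ht => h14 _ (by omega)
  have hT₀ : TrieState (n₁ + n₂ + 1) s.erase 0 fun _ => [] :=
    ⟨0, fun _ => [], le_rfl, by rw [hz 9 (by norm_num)]; rfl,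
      by rw [hz 35 (by norm_num)]; exact isTrie_zero _,
      fun c => ⟨0, le_rfl, by rw [hz 34 (by norm_num)]; rfl, rfl⟩⟩
  obtain ⟨s₁, x₁, f₁, T₁⟩ := executes_trie (V := V) (w := w) (input := input) (sym := 17)
    (T := 84 * (n₁ + n₂ + 1)) (by norm_num [IsArrayLane]) (by norm_num) (by norm_num)
    (by norm_num) hw hs hH.one hH.zero hH.total hH.width hVn hT₀ (fun c _ => ρ c)
    (fun i hi => by rw [h17 i hi, h14 i hi])
    (fun i hi => by rw [h17 i hi]; exact Nat.lt_succ_of_le (hρ i hi))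
    (le_trans (Nat.mul_le_mul_left _ (by omega)) hV) (by omega)
  have H₁ : Header n₁ n₂ s₁.erase := hH.congr fun k hk hk' => f₁ k hk' (by omega) (by omega)
  have e₁ : s₁.erase 14 = s.erase 14 := f₁ 14 (by norm_num) (by norm_num) (by norm_num)
  have d₁ : s₁.erase 32 = s.erase 32 := f₁ 32 (by norm_num) (by norm_num) (by norm_num)
  obtain ⟨s₂, x₂, f₂, T₂⟩ := executes_trie (V := V) (w := w) (input := input) (sym := 32)
    (T := 84 * (n₁ + n₂ + 1)) (by norm_num [IsArrayLane]) (by norm_num) (by norm_num)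
    (by norm_num) hw x₁.1 H₁.one H₁.zero H₁.total H₁.width hVn T₁ (profile (n₁ + n₂) C P)
    (fun i hi => by rw [d₁, h32 i hi, e₁, h14 i hi, hcC i hi.le])
    (fun i hi => by rw [d₁, h32 i hi]; exact Nat.lt_succ_of_le (profile_le _ _ _ _ _))
    (le_trans (Nat.mul_le_mul_left _ (by omega)) hV) (by omega)
  have H₂ : Header n₁ n₂ s₂.erase := H₁.congr fun k hk hk' => f₂ k hk' (by omega) (by omega)
  have e₂ : s₂.erase 14 = s.erase 14 :=
    (f₂ 14 (by norm_num) (by norm_num) (by norm_num)).trans e₁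
  have d₂ : s₂.erase 33 = s.erase 33 := by
    rw [f₂ 33 (by norm_num) (by norm_num) (by norm_num),
      f₁ 33 (by norm_num) (by norm_num) (by norm_num)]
  obtain ⟨s₃, x₃, f₃, T₃⟩ := executes_trie (V := V) (w := w) (input := input) (sym := 33)
    (T := 84 * (n₁ + n₂ + 1)) (by norm_num [IsArrayLane]) (by norm_num) (by norm_num)
    (by norm_num) hw x₂.1 H₂.one H₂.zero H₂.total H₂.width hVn T₂ (profile (n₁ + n₂) C Q)
    (fun i hi => by rw [d₂, h33 i hi, e₂, h14 i hi, hcC i hi.le])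
    (fun i hi => by rw [d₂, h33 i hi]; exact Nat.lt_succ_of_le (profile_le _ _ _ _ _))
    (le_trans (Nat.mul_le_mul_left _ (by omega)) hV) (by omega)
  have H₃ : Header n₁ n₂ s₃.erase := H₂.congr fun k hk hk' => f₃ k hk' (by omega) (by omega)
  have e₃ : s₃.erase 14 = s.erase 14 :=
    (f₃ 14 (by norm_num) (by norm_num) (by norm_num)).trans e₂
  obtain ⟨s₄, L, x₄, g₄, hL⟩ := H₃.executes_gather (input := input) (tbl := 34) (idx := 14)
    (out := 36) hw x₃.1 (by norm_num) (by norm_num) (by norm_num) (by norm_num) (by norm_num)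
    (by norm_num) (by norm_num) (by norm_num) hVn C (by rw [e₃]; exact h14) le_rfl
  have z : ∀ k, 36 ≤ k → s₃.erase k = 0 := fun k hk => by
    rw [f₃ k (by omega) (by omega) (by omega), f₂ k (by omega) (by omega) (by omega),
      f₁ k (by omega) (by omega) (by omega), hz k (by omega)]
  refine ⟨s₄, (x₁.seq (x₂.seq (x₃.seq x₄))).mono (by omega), g₄ ▸ H₃.update (by norm_num) _,
    by rw [g₄, update_of_ne (by norm_num), z 37 (by norm_num)],
    by rw [g₄, update_of_ne (by norm_num), z 38 (by norm_num)], fun i hi j hj => ?_⟩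
  rw [g₄, update_self, hL i hi, hL j hj, T₃.eq_iff (Nat.succ_pos _)]
  simp only [e₁, e₂, hcC _ le_rfl, signature, List.nil_append]

/-- The decision procedure: the elements are named by the signatures of their components, and it is
tested whether every name is equally frequent in both matroids. -/
def decisionProgram : Program :=
  .seq (.seq loadProgram (.seq profileProgram (.seq namingProgram
    (.seq (pass 12 11 (countBody 36 37 31)) (.seq (pass 11 13 (countBody 36 38 31))
      (pass 12 7 (compareBody 36 37 38 10)))))))
    (.cond 10 (.const 0 0) (.const 0 1))

theorem runs_decisionProgram (hI : Reads input n₁ n₂ C P Q R) {ρ : ℕ → ℕ}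
    (hρ : ∀ i < n₁ + n₂, R i = ρ (C i)) (hw : 256 * (n₁ + n₂ + 1) ^ 2 ≤ w) :
    ∃ h : ℕ → ℕ, (∀ i < n₁ + n₂, ∀ j < n₁ + n₂, h i = h j ↔
        signature (n₁ + n₂) C P Q ρ (C i) = signature (n₁ + n₂) C P Q ρ (C j)) ∧
      ∃ t m, Runs w input decisionProgram (fun _ => 0) t m ∧ t ≤ 1100 * (n₁ + n₂ + 1) ∧
        ((∀ i < n₁ + n₂, countFrom h 0 n₁ (h i) = countFrom h n₁ n₂ (h i)) → m 0 = 1) ∧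
        ((¬ ∀ i < n₁ + n₂, countFrom h 0 n₁ (h i) = countFrom h n₁ n₂ (h i)) → m 0 = 0) := by
  obtain ⟨V, hVdef⟩ : ∃ V, V = 3 * (n₁ + n₂ + 1) ^ 2 := ⟨_, rfl⟩
  have hpos : 1 ≤ (n₁ + n₂ + 1) ^ 2 := Nat.one_le_pow _ _ (Nat.succ_pos _)
  have hw' : 64 * V + 64 ≤ w := by omega
  have hV : (n₁ + n₂ + 1) * (n₁ + n₂) + (n₁ + n₂) + 1 ≤ V := by
    have : (n₁ + n₂ + 1) * (n₁ + n₂) + (n₁ + n₂) + 1 = (n₁ + n₂ + 1) ^ 2 := by ring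
    omega
  have hV' : (n₁ + n₂ + 1) * (3 * (n₁ + n₂) + 2) ≤ V := by
    have : (n₁ + n₂ + 1) * (3 * (n₁ + n₂) + 2) + (n₁ + n₂ + 1) = 3 * (n₁ + n₂ + 1) ^ 2 := by ring
    omega
  have hVn : n₁ + n₂ + 1 ≤ V := by
    have := Nat.zero_le ((n₁ + n₂ + 1) * (n₁ + n₂))
    omega
  obtain ⟨s₁, x₁, H₁, a14, a15, a16, a17, a18, z₁⟩ := executes_loadProgram (V := V) hI hw' hV
  obtain ⟨s₂, x₂, H₂, b14, b17, b32, b33, z₂⟩ := executes_profileProgram hI hw' hV x₁.1 H₁ a14 a15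
    a16 a18 z₁
  obtain ⟨s₃, x₃, H₃, z37, z38, hname⟩ := executes_namingProgram (input := input) (P := P) (Q := Q)
    (ρ := ρ) hw' hV' x₂.1 H₂ (by rw [b14]; exact a14)
    (fun i hi => by rw [b17, a17 i hi, hρ i hi])
    (fun i hi => by rw [← hρ i hi]; exact hI.rank_le i hi) b32 b33 z₂
  obtain ⟨h, hh⟩ : ∃ h, h = s₃.erase 36 := ⟨_, rfl⟩
  refine ⟨h, hh ▸ hname, ?_⟩
  obtain ⟨s₄, x₄, g₄⟩ := executes_count (V := V) (w := w) (input := input) (src := 36) (cnt := 37)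
    (out := 31) (lo := 12) (len := 11) (a := 0) (n := n₁) (T := 44 * (n₁ + n₂ + 1))
    (by norm_num [IsArrayLane]) (by norm_num [IsArrayLane]) (by norm_num [IsArrayLane])
    (by norm_num [IsArrayLane]) (by norm_num [IsArrayLane]) (by norm_num) (by norm_num)
    (by norm_num) hw' x₃.1 H₃.one H₃.zero H₃.first (by omega) z37 (by omega)
  have H₄ : Header n₁ n₂ s₄.erase := g₄ ▸ (H₃.update (by norm_num) _).update (by norm_num) _
  obtain ⟨s₅, x₅, g₅⟩ := executes_count (V := V) (w := w) (input := input) (src := 36) (cnt := 38)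
    (out := 31) (lo := 11) (len := 13) (a := n₁) (n := n₂) (T := 44 * (n₁ + n₂ + 1))
    (by norm_num [IsArrayLane]) (by norm_num [IsArrayLane]) (by norm_num [IsArrayLane])
    (by norm_num [IsArrayLane]) (by norm_num [IsArrayLane]) (by norm_num) (by norm_num)
    (by norm_num) hw' x₄.1 H₄.one H₄.first H₄.second (by omega)
    (by rw [g₄, update_of_ne (by norm_num), update_of_ne (by norm_num), z38]) (by omega)
  have H₅ : Header n₁ n₂ s₅.erase := g₅ ▸ (H₄.update (by norm_num) _).update (by norm_num) _
  obtain ⟨s₆, x₆, g₆⟩ := executes_compare (V := V) (w := w) (input := input) (h := 36) (x := 37)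
    (y := 38) (bad := 10) (origin := 12) (len := 7) (n := n₁ + n₂) (T := 64 * (n₁ + n₂ + 1))
    (by norm_num [IsArrayLane]) (by norm_num [IsArrayLane]) (by norm_num [IsArrayLane])
    (by norm_num [IsArrayLane]) (by norm_num [IsArrayLane]) (by norm_num [IsArrayLane])
    (by norm_num) (by norm_num) (by norm_num) hw' x₅.1 H₅.one H₅.zero H₅.total (by omega)
    (by omega) H₅.flag (by omega)
  have e36 : s₅.erase 36 = h := by simp [g₅, g₄, hh]
  have e37 : s₅.erase 37 = countFrom h 0 n₁ := by simp [g₅, g₄, hh]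
  have e38 : s₅.erase 38 = countFrom h n₁ n₂ := by simp [g₅, g₄, hh]
  rw [e36, e37, e38, Lanes.erase_apply _ (by norm_num [IsArrayLane])] at g₆
  have hx := x₁.seq (x₂.seq (x₃.seq (x₄.seq (x₅.seq x₆))))
  obtain ⟨t, m, ht, hr, hm⟩ := hx.2 (fun _ => 0) (fun _ _ _ _ => rfl)
  have h10 : m 10 = s₆ 10 0 := hm.scalar (by norm_num) (by norm_num)
  by_cases hc : ∀ i < n₁ + n₂, countFrom h 0 n₁ (h i) = countFrom h n₁ n₂ (h i)
  · refine ⟨t + (1 + 1), _, hr.seq _ _ _ _ _ _ _ (.cond_else _ _ _ _ _ _ ?_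
      (.const 0 1 m (by omega))), by omega, fun _ => by simp, fun hc' => absurd hc hc'⟩
    rw [h10, g₆.2 hc]
  · refine ⟨t + (1 + 1), _, hr.seq _ _ _ _ _ _ _ (.cond_then _ _ _ _ _ _ ?_
      (.const 0 0 m (by omega))), by omega, fun hc' => absurd hc' hc, fun _ => by simp⟩
    rw [h10]
    exact fun h0 => hc (g₆.1 h0)

end LockedMatroid

namespace LockedMatroid

open Set

/-! ### The meaning of the signatures -/

section Signature

variable {A B X X' Y Y' : Type*}

/-- The number of classes with more than `t` elements of the partition of `A` given by `p`: for
`t = 0, 1, …` these numbers form the partition conjugate to that of the class sizes. -/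
noncomputable def classCount (p : A → X) (t : ℕ) : ℕ := {x | t + 1 ≤ (p ⁻¹' {x}).ncard}.ncard

lemma classCount_eq_zero [Finite A] (p : A → X) {t : ℕ} (ht : Nat.card A ≤ t) :
    classCount p t = 0 := by
  have : {x | t + 1 ≤ (p ⁻¹' {x}).ncard} = ∅ := by
    rw [eq_empty_iff_forall_notMem]
    intro x hx
    have := ncard_le_card (p ⁻¹' {x})
    simp only [mem_ofPred_eq] at hx
    omega
  rw [classCount, this, ncard_empty]

/-- The signature of a block `A` of rank `r` with the partitions `p` and `q`. Each of the three
parts has as many entries as `A` has elements, so the length determines where the parts begin. -/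
noncomputable def blockSignature (A : Type*) {X Y : Type*} (r : ℕ) (p : A → X)
    (q : A → Y) : List ℕ :=
  (List.range (Nat.card A)).map (fun _ => r) ++ (List.range (Nat.card A)).map (classCount p) ++
    (List.range (Nat.card A)).map (classCount q)

/-- The signature of a nonempty block determines the rank and the class sizes. -/
lemma blockSignature_inj [Finite A] [Finite B] [Nonempty A] {r r' : ℕ} {p : A → X} {q : A → Y}
    {p' : B → X'} {q' : B → Y'} (h : blockSignature A r p q = blockSignature B r' p' q') :
    r = r' ∧ classCount p = classCount p' ∧ classCount q = classCount q' := by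
  have hc : Nat.card A = Nat.card B := by
    have := congrArg List.length h
    simp only [blockSignature, List.length_append, List.length_map, List.length_range] at this
    omega
  have hpos : 0 < Nat.card A := Nat.card_pos
  rw [blockSignature, blockSignature, ← hc] at h
  obtain ⟨h1, h2⟩ := List.append_inj' h (by simp)
  obtain ⟨h3, h4⟩ := List.append_inj' h1 (by simp)
  have key : ∀ {f g : ℕ → ℕ}, (List.range (Nat.card A)).map f = (List.range (Nat.card A)).map g →
      ∀ t < Nat.card A, f t = g t := fun h t ht =>
    List.map_inj_left.1 h t (List.mem_range.2 ht)
  have ext : ∀ {f g : ℕ → ℕ}, (List.range (Nat.card A)).map f = (List.range (Nat.card A)).map g →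
      (∀ t, Nat.card A ≤ t → f t = 0) → (∀ t, Nat.card A ≤ t → g t = 0) → f = g :=
    fun h hf hg => funext fun t => by
      rcases Nat.lt_or_ge t (Nat.card A) with ht | ht
      · exact key h t ht
      · rw [hf t ht, hg t ht]
  exact ⟨key h3 0 hpos,
    ext h4 (fun _ ht => classCount_eq_zero p ht) fun _ ht => classCount_eq_zero p' (hc ▸ ht),
    ext h2 (fun _ ht => classCount_eq_zero q ht) fun _ ht => classCount_eq_zero q' (hc ▸ ht)⟩

lemma class_count_eq_of_classCount_eq [Finite A] [Finite B] {p : A → X} {p' : B → X'}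
    (h : classCount p = classCount p') (k : ℕ) (hk : 1 ≤ k) :
    {x | (p ⁻¹' {x}).ncard = k}.ncard = {x | (p' ⁻¹' {x}).ncard = k}.ncard := by
  refine class_count_eq_of_ge_count (fun t ht => ?_) k hk
  obtain ⟨t, rfl⟩ := Nat.exists_eq_add_of_le' ht
  exact congrFun h t

lemma blockSignature_congr {r : ℕ} {p : A → X} {q : A → Y} {p' : B → X'} {q' : B → Y'} (e : A ≃ B)
    (hp : ∀ a b, p a = p b ↔ p' (e a) = p' (e b)) (hq : ∀ a b, q a = q b ↔ q' (e a) = q' (e b)) :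
    blockSignature A r p q = blockSignature B r p' q' := by
  have hp' : classCount p = classCount p' := funext fun t =>
    class_count_congr e hp (fun n => t + 1 ≤ n) (by omega)
  have hq' : classCount q = classCount q' := funext fun t =>
    class_count_congr e hq (fun n => t + 1 ≤ n) (by omega)
  rw [blockSignature, blockSignature, Nat.card_congr e, hp', hq']

variable {n c : ℕ} {C P Q : ℕ → ℕ} {e : A → ℕ}

lemma countFrom_eq_card (he : Function.Injective e) (hr : ∀ i, (i < n ∧ C i = c) ↔ i ∈ range e) :
    countFrom C 0 n c = Nat.card A := by
  have : (((Finset.range n).filter fun i => C i = c : Finset ℕ) : Set ℕ) = range e := by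
    ext i
    simp [← hr]
  simp only [countFrom, zero_add]
  rw [← ncard_coe_finset, this, ← image_univ, ncard_image_of_injective _ he, ncard_univ]

lemma position_eq_ncard [Finite A] (he : Function.Injective e)
    (hr : ∀ i, (i < n ∧ C i = c) ↔ i ∈ range e)
    (hPC : ∀ i < n, ∀ j < n, P i = P j → C i = C j) (a : A) :
    position P (e a) = {b | P (e b) = P (e a) ∧ e b ≤ e a}.ncard := by
  obtain ⟨h1, h2⟩ := (hr (e a)).2 ⟨a, rfl⟩
  have hs : e '' {b | P (e b) = P (e a) ∧ e b ≤ e a} =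
      ((insert (e a) ((Finset.range (e a)).filter fun i => P i = P (e a)) : Finset ℕ) : Set ℕ) := by
    ext i
    simp only [mem_image, mem_ofPred_eq, Finset.coe_insert, Finset.coe_filter, Finset.mem_range,
      mem_insert_iff]
    constructor
    · rintro ⟨b, ⟨hb, hb'⟩, rfl⟩
      rcases hb'.eq_or_lt with h | h
      · exact Or.inl h
      · exact Or.inr ⟨h, hb⟩
    · rintro (rfl | ⟨hi, hP⟩)
      · exact ⟨a, ⟨rfl, le_rfl⟩, rfl⟩
      · obtain ⟨b, rfl⟩ := (hr i).1 ⟨hi.trans h1, (hPC i (hi.trans h1) _ h1 hP).trans h2⟩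
        exact ⟨b, ⟨hP, hi.le⟩, rfl⟩
  rw [← ncard_image_of_injective _ he, hs, ncard_coe_finset,
    Finset.card_insert_of_notMem (by simp)]
  simp [position, countFrom]

/-- The numbers computed from the positions are the class counts. -/
lemma profile_eq_classCount [Finite A] (he : Function.Injective e)
    (hr : ∀ i, (i < n ∧ C i = c) ↔ i ∈ range e)
    (hPC : ∀ i < n, ∀ j < n, P i = P j → C i = C j) {p : A → X}
    (hp : ∀ a b, p a = p b ↔ P (e a) = P (e b)) : profile n C P c = classCount p := by
  funext t
  have hpos := position_eq_ncard he hr hPC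
  have hinj : ∀ a b, p a = p b → position P (e a) = position P (e b) → a = b := by
    have key : ∀ a b, p a = p b → e a < e b → position P (e a) < position P (e b) := by
      intro a b hab hlt
      rw [hpos, hpos]
      refine ncard_lt_ncard ((ssubset_iff_of_subset ?_).2 ⟨b, ⟨rfl, le_rfl⟩, fun h => ?_⟩)
        (toFinite _)
      · rintro x ⟨h1, h2⟩
        exact ⟨h1.trans ((hp a b).1 hab), h2.trans hlt.le⟩
      · exact absurd h.2 (not_le.2 hlt)
    intro a b hab h
    rcases lt_trichotomy (e a) (e b) with hlt | heq | hlt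
    · exact absurd h (key a b hab hlt).ne
    · exact he heq
    · exact absurd h (key b a hab.symm hlt).ne'
  have hle : ∀ a, position P (e a) ≤ (p ⁻¹' {p a}).ncard := fun a => by
    rw [hpos]
    exact ncard_le_ncard (fun x hx => (hp x a).2 hx.1) (toFinite _)
  -- The positions are distinct numbers in the right range, so they exhaust it.
  have hex : ∀ a t, 1 ≤ t → t ≤ (p ⁻¹' {p a}).ncard → ∃ b, p b = p a ∧ position P (e b) = t := by
    intro a t ht ht'
    have himg : (fun b => position P (e b)) '' (p ⁻¹' {p a}) = Icc 1 (p ⁻¹' {p a}).ncard := by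
      refine eq_of_subset_of_ncard_le ?_ ?_ (toFinite _)
      · rintro _ ⟨b, hb, rfl⟩
        have hb' : p b = p a := hb
        exact ⟨Nat.succ_pos _, hb' ▸ hle b⟩
      · have hinj' : InjOn (fun b => position P (e b)) (p ⁻¹' {p a}) := fun b hb d hd h =>
          hinj b d (Eq.trans hb (Eq.symm hd)) h
        rw [hinj'.ncard_image, ← Finset.coe_Icc, ncard_coe_finset, Nat.card_Icc]
        omega
    obtain ⟨b, hb, hbt⟩ := himg.symm.subset (show t ∈ Icc 1 _ from ⟨ht, ht'⟩)
    exact ⟨b, hb, hbt⟩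
  rw [classCount, class_count_eq_pos_count _ hinj hle hex (Nat.succ_pos t),
    ← ncard_image_of_injective _ he, profile, ← ncard_coe_finset]
  congr 1
  ext i
  simp only [Finset.coe_filter, Finset.mem_range, mem_ofPred_eq, mem_image]
  constructor
  · rintro ⟨h1, h2, h3⟩
    obtain ⟨a, rfl⟩ := (hr i).1 ⟨h1, h2⟩
    exact ⟨a, h3, rfl⟩
  · rintro ⟨a, ha, rfl⟩
    obtain ⟨h1, h2⟩ := (hr (e a)).2 ⟨a, rfl⟩
    exact ⟨h1, h2, ha⟩

lemma signature_eq_blockSignature [Finite A] (he : Function.Injective e)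
    (hr : ∀ i, (i < n ∧ C i = c) ↔ i ∈ range e)
    (hPC : ∀ i < n, ∀ j < n, P i = P j → C i = C j)
    (hQC : ∀ i < n, ∀ j < n, Q i = Q j → C i = C j) {p : A → X} {q : A → Y}
    (hp : ∀ a b, p a = p b ↔ P (e a) = P (e b)) (hq : ∀ a b, q a = q b ↔ Q (e a) = Q (e b))
    (ρ : ℕ → ℕ) : signature n C P Q ρ c = blockSignature A (ρ c) p q := by
  rw [signature, blockSignature, countFrom_eq_card he hr, profile_eq_classCount he hr hPC hp,
    profile_eq_classCount he hr hQC hq]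

end Signature

/-! ### Correctness of the comparison -/

section Describes

variable {α : Type u} {β : Type v} {M : Matroid α} {N : Matroid β} {n₁ n₂ n : ℕ}

/-- The signature of the component of the element number `i`. -/
noncomputable def LockedCode.signature (c : LockedCode n) (i : Fin n) : List ℕ :=
  blockSignature {x // c.comp x = c.comp i} (c.rank i) (fun x => c.par x.1) (fun x => c.copar x.1)

variable {num : Fin n ≃ M.E} {c : LockedCode n}

lemma LockedCode.Describes.finite (_ : c.Describes M num) : M.Finite :=
  ⟨(Set.finite_coe_iff.1 (Finite.of_equiv _ num))⟩

lemma LockedCode.Describes.comp_eq_of_par (h : c.Describes M num) {i j : Fin n}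
    (hij : c.par i = c.par j) : c.comp i = c.comp j :=
  (h.1 i j).2 ((h.2.1 i j).1 hij).sameComponent

lemma LockedCode.Describes.comp_eq_of_copar (h : c.Describes M num) {i j : Fin n}
    (hij : c.copar i = c.copar j) : c.comp i = c.comp j :=
  (h.1 i j).2 ((h.2.2.1 i j).1 hij).sameComponent

lemma LockedCode.Describes.rank_congr (h : c.Describes M num) {i j : Fin n}
    (hij : c.comp i = c.comp j) : c.rank i = c.rank j := by
  have := h.finite
  have hs := (h.1 i j).1 hij
  have : component M (num i : α) = component M (num j) := by
    ext x
    exact ⟨fun hx => ⟨hx.1, hs.symm.trans hx.2⟩, fun hx => ⟨hx.1, hs.trans hx.2⟩⟩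
  have h' := h.2.2.2 i
  rw [this, ← h.2.2.2 j] at h'
  exact_mod_cast h'

lemma LockedCode.Describes.rank_le (h : c.Describes M num) (i : Fin n) : c.rank i ≤ n := by
  have h1 : (c.rank i : ℕ∞) ≤ n := by
    rw [h.2.2.2 i]
    refine (M.eRk_le_encard _).trans ((encard_le_encard component_subset_ground).trans ?_)
    rw [← Subtype.range_coe (s := M.E), ← num.surjective.range_comp, ← image_univ]
    refine (encard_image_le _ _).trans ?_
    simp
  exact_mod_cast h1

lemma LockedCode.Describes.signature_congr (h : c.Describes M num) {i j : Fin n}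
    (hij : c.comp i = c.comp j) : c.signature i = c.signature j := by
  rw [LockedCode.signature, LockedCode.signature, h.rank_congr hij, hij]

lemma LockedCode.Describes.nearlyDisjoint (h : c.Describes M num) (i : Fin n) :
    NearlyDisjoint (fun x : {x // c.comp x = c.comp i} => c.par x.1) (fun x => c.copar x.1) := by
  have := h.finite
  exact nearlyDisjoint_of_sameComponent (u := fun x : {x // c.comp x = c.comp i} => (num x.1 : α))
    (fun x y hxy => Subtype.ext (num.injective (Subtype.ext hxy))) (fun a b => h.2.1 _ _)
    (fun a b => h.2.2.1 _ _) fun a b => (h.1 _ _).1 (a.2.trans b.2.symm)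

variable {num₁ : Fin n₁ ≃ M.E} {num₂ : Fin n₂ ≃ N.E} {c₁ : LockedCode n₁} {c₂ : LockedCode n₂}

/-- Matroids without locked subsets are isomorphic if and only if every signature is the signature
of the component of equally many elements. -/
theorem LockedCode.Describes.isomorphic_iff (hM : ZeroLocked M) (hN : ZeroLocked N)
    (h₁ : c₁.Describes M num₁) (h₂ : c₂.Describes N num₂) : Isomorphic M N ↔
    ∀ s, {i | c₁.signature i = s}.ncard = {i | c₂.signature i = s}.ncard := by
  have := h₁.finite
  have := h₂.finite
  rw [isomorphic_iff_exists_sameLockedStructure hM hN]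
  constructor
  · rintro ⟨φ, g1, g2, g3, g4⟩ s
    let e : Fin n₁ ≃ Fin n₂ := num₁.trans (φ.trans num₂.symm)
    have he : ∀ i, num₂ (e i) = φ (num₁ i) := fun i => by simp [e]
    have ec : ∀ i j, c₁.comp i = c₁.comp j ↔ c₂.comp (e i) = c₂.comp (e j) := fun i j => by
      rw [h₁.1, h₂.1, he, he]
      exact g1 _ _
    have ep : ∀ i j, c₁.par i = c₁.par j ↔ c₂.par (e i) = c₂.par (e j) := fun i j => by
      rw [h₁.2.1, h₂.2.1, he, he]
      exact g2 _ _
    have eq : ∀ i j, c₁.copar i = c₁.copar j ↔ c₂.copar (e i) = c₂.copar (e j) := fun i j => by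
      rw [h₁.2.2.1, h₂.2.2.1, he, he]
      exact g3 _ _
    have er : ∀ i, c₁.rank i = c₂.rank (e i) := fun i => by
      have : _ = N.eRk (component N (φ (num₁ i))) := g4 (num₁ i)
      rw [← h₁.2.2.2, ← he, ← h₂.2.2.2] at this
      exact_mod_cast this
    have hsig : ∀ i, c₂.signature (e i) = c₁.signature i := fun i => by
      rw [LockedCode.signature, LockedCode.signature, ← er]
      exact (blockSignature_congr (e.subtypeEquiv fun x => ec x i) (fun a b => ep _ _)
        fun a b => eq _ _).symm
    rw [← ncard_image_of_injective _ e.injective]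
    congr 1
    ext j
    obtain ⟨i, rfl⟩ := e.surjective j
    simp [hsig]
  · intro hcount
    have hH₁ : ∀ i, c₁.signature (rangeFactorization c₁.comp i).2.choose = c₁.signature i :=
      fun i => h₁.signature_congr (rangeFactorization c₁.comp i).2.choose_spec
    have hH₂ : ∀ i, c₂.signature (rangeFactorization c₂.comp i).2.choose = c₂.signature i :=
      fun i => h₂.signature_congr (rangeFactorization c₂.comp i).2.choose_spec
    have hr₁ : ∀ i j, rangeFactorization c₁.comp i = rangeFactorization c₁.comp j ↔
        c₁.comp i = c₁.comp j := fun i j => Subtype.ext_iff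
    have hr₂ : ∀ i j, rangeFactorization c₂.comp i = rangeFactorization c₂.comp j ↔
        c₂.comp i = c₂.comp j := fun i j => Subtype.ext_iff
    obtain ⟨e, ec, ep, eq, es⟩ := exists_equiv_of_blocks
      (c := rangeFactorization c₁.comp) (c' := rangeFactorization c₂.comp) (p := c₁.par)
      (p' := c₂.par) (q := c₁.copar) (q' := c₂.copar)
      rangeFactorization_surjective rangeFactorization_surjective
      (H := fun x => c₁.signature x.2.choose) (H' := fun x => c₂.signature x.2.choose)
      (fun s => by simpa only [hH₁, hH₂] using hcount s)
      (fun i j hij => (hr₁ i j).2 (h₁.comp_eq_of_par hij))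
      (fun i j hij => (hr₁ i j).2 (h₁.comp_eq_of_copar hij))
      (fun i j hij => (hr₂ i j).2 (h₂.comp_eq_of_par hij))
      (fun i j hij => (hr₂ i j).2 (h₂.comp_eq_of_copar hij)) (fun x y hxy => by
        obtain ⟨i, rfl⟩ := rangeFactorization_surjective x
        obtain ⟨j, rfl⟩ := rangeFactorization_surjective y
        simp only [hH₁, hH₂] at hxy
        have : Nonempty {x // c₁.comp x = c₁.comp i} := ⟨⟨i, rfl⟩⟩
        obtain ⟨-, hp, hq⟩ := blockSignature_inj hxy
        obtain ⟨e, ep, eq⟩ := exists_equiv_of_nearlyDisjoint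
          (class_count_eq_of_classCount_eq hp) (class_count_eq_of_classCount_eq hq)
          (h₁.nearlyDisjoint i) (h₂.nearlyDisjoint j)
        exact ⟨(Equiv.subtypeEquivRight fun x => hr₁ x i).trans
          (e.trans (Equiv.subtypeEquivRight fun y => (hr₂ y j).symm)),
          fun a b => ep ⟨a.1, (hr₁ _ _).1 a.2⟩ ⟨b.1, (hr₁ _ _).1 b.2⟩,
          fun a b => eq ⟨a.1, (hr₁ _ _).1 a.2⟩ ⟨b.1, (hr₁ _ _).1 b.2⟩⟩)
    simp only [hH₁, hH₂] at es
    simp only [hr₁, hr₂] at ec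
    have er : ∀ i, c₁.rank i = c₂.rank (e i) := fun i => by
      have : Nonempty {x // c₁.comp x = c₁.comp i} := ⟨⟨i, rfl⟩⟩
      exact (blockSignature_inj (es i).symm).1
    refine ⟨num₁.symm.trans (e.trans num₂), fun x y => ?_, fun x y => ?_, fun x y => ?_,
      fun x => ?_⟩ <;> obtain ⟨i, rfl⟩ := num₁.surjective x
    · obtain ⟨j, rfl⟩ := num₁.surjective y
      simpa [← h₁.1, ← h₂.1] using ec i j
    · obtain ⟨j, rfl⟩ := num₁.surjective y
      simpa [← h₁.2.1, ← h₂.2.1] using ep i j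
    · obtain ⟨j, rfl⟩ := num₁.surjective y
      simpa [← h₁.2.2.1, ← h₂.2.2.1] using eq i j
    · simpa [← h₁.2.2.2, ← h₂.2.2.2] using er i

end Describes

end LockedMatroid

namespace LockedMatroid

open Set

/-! ### The decision procedure applied to a pair of matroids -/

section Decide

variable {n₁ n₂ : ℕ}

lemma toArray_fin {n : ℕ} (f : Fin n → ℕ) (i : Fin n) : toArray f i = f i := by
  rw [toArray, dif_pos i.2]

/-- The values of `f₁`, followed by those of `f₂` increased by `d`. -/
def joinArrays (f₁ : Fin n₁ → ℕ) (f₂ : Fin n₂ → ℕ) (d i : ℕ) : ℕ :=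
  if i < n₁ then toArray f₁ i else toArray f₂ (i - n₁) + d

lemma joinArrays_of_lt {f₁ : Fin n₁ → ℕ} {f₂ : Fin n₂ → ℕ} {d i : ℕ} (hi : i < n₁) :
    joinArrays f₁ f₂ d i = toArray f₁ i := if_pos hi

lemma joinArrays_add {f₁ : Fin n₁ → ℕ} {f₂ : Fin n₂ → ℕ} {d i : ℕ} :
    joinArrays f₁ f₂ d (n₁ + i) = toArray f₂ i + d := by
  rw [joinArrays, if_neg (by omega), Nat.add_sub_cancel_left]

lemma joinArrays_left (f₁ : Fin n₁ → ℕ) (f₂ : Fin n₂ → ℕ) (d : ℕ) (i : Fin n₁) :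
    joinArrays f₁ f₂ d i = f₁ i := by
  rw [joinArrays_of_lt i.2, toArray_fin]

lemma joinArrays_right (f₁ : Fin n₁ → ℕ) (f₂ : Fin n₂ → ℕ) (d : ℕ) (i : Fin n₂) :
    joinArrays f₁ f₂ d (n₁ + i) = f₂ i + d := by
  rw [joinArrays_add, toArray_fin]

/-- An index below `n₁ + n₂` belongs to one of the two parts. -/
lemma forall_lt_add_iff {p : ℕ → Prop} :
    (∀ i < n₁ + n₂, p i) ↔ (∀ i : Fin n₁, p i) ∧ ∀ i : Fin n₂, p (n₁ + i) := by
  refine ⟨fun h => ⟨fun i => h i (by omega), fun i => h (n₁ + i) (by omega)⟩,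
    fun ⟨h1, h2⟩ i hi => ?_⟩
  rcases Nat.lt_or_ge i n₁ with h | h
  · exact h1 ⟨i, h⟩
  · have := h2 ⟨i - n₁, by omega⟩
    rwa [Nat.add_sub_cancel' h] at this

lemma countFrom_eq_ncard (f : ℕ → ℕ) (a n v : ℕ) :
    countFrom f a n v = {i : Fin n | f (a + i) = v}.ncard := by
  rw [countFrom, ← ncard_coe_finset, ← ncard_image_of_injective _ Fin.val_injective]
  congr 1
  ext t
  simp only [Finset.coe_filter, Finset.mem_range, mem_ofPred_eq, mem_image]
  exact ⟨fun h => ⟨⟨t, h.1⟩, h.2, rfl⟩, by rintro ⟨i, h, rfl⟩; exact ⟨i.2, h⟩⟩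

variable (c₁ : LockedCode n₁) (c₂ : LockedCode n₂)

/-- Component names of both matroids. -/
def jointComp : ℕ → ℕ := joinArrays (fun i => (c₁.comp i : ℕ)) (fun i => (c₂.comp i : ℕ)) n₁

/-- Names of the parallel closures of both matroids. -/
def jointPar : ℕ → ℕ := joinArrays (fun i => (c₁.par i : ℕ)) (fun i => (c₂.par i : ℕ)) n₁

/-- Names of the coparallel closures of both matroids. -/
def jointCopar : ℕ → ℕ := joinArrays (fun i => (c₁.copar i : ℕ)) (fun i => (c₂.copar i : ℕ)) n₁

/-- Ranks of the components of both matroids. -/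
def jointRank : ℕ → ℕ := joinArrays c₁.rank c₂.rank 0

variable {c₁ c₂} {α : Type u} {β : Type v} {M : Matroid α} {N : Matroid β} {num₁ : Fin n₁ ≃ M.E}
  {num₂ : Fin n₂ ≃ N.E}

lemma joinArrays_lt (f₁ : Fin n₁ → Fin n₁) (f₂ : Fin n₂ → Fin n₂) :
    ∀ i < n₁ + n₂, joinArrays (fun i => (f₁ i : ℕ)) (fun i => (f₂ i : ℕ)) n₁ i < n₁ + n₂ := by
  rw [forall_lt_add_iff]
  constructor <;> intro i
  · rw [joinArrays_left]
    omega
  · rw [joinArrays_right]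
    omega

lemma reads_pairInput (h₁ : c₁.Describes M num₁) (h₂ : c₂.Describes N num₂) :
    Reads (pairInput c₁ c₂) n₁ n₂ (jointComp c₁ c₂) (jointPar c₁ c₂) (jointCopar c₁ c₂)
      (jointRank c₁ c₂) where
  size₁ := rfl
  size₂ := rfl
  comp₁ i hi := by rw [jointComp, joinArrays_of_lt hi]; rfl
  comp₂ i _ := by rw [jointComp, joinArrays_add]; rfl
  par₁ i hi := by rw [jointPar, joinArrays_of_lt hi]; rfl
  par₂ i _ := by rw [jointPar, joinArrays_add]; rfl
  copar₁ i hi := by rw [jointCopar, joinArrays_of_lt hi]; rfl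
  copar₂ i _ := by rw [jointCopar, joinArrays_add]; rfl
  rank₁ i hi := by rw [jointRank, joinArrays_of_lt hi]; rfl
  rank₂ i _ := by rw [jointRank, joinArrays_add]; rfl
  comp_lt := joinArrays_lt _ _
  par_lt := joinArrays_lt _ _
  copar_lt := joinArrays_lt _ _
  rank_le := by
    rw [forall_lt_add_iff]
    constructor <;> intro i
    · rw [jointRank, joinArrays_left]
      exact (h₁.rank_le i).trans (by omega)
    · rw [jointRank, joinArrays_right]
      exact (h₂.rank_le i).trans (by omega)

/-- A relation between names that holds in both matroids holds for the joint names. -/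
lemma joinArrays_congr {f₁ : Fin n₁ → Fin n₁} {f₂ : Fin n₂ → Fin n₂} {g₁ : Fin n₁ → ℕ}
    {g₂ : Fin n₂ → ℕ} {d : ℕ} (h₁ : ∀ i j, f₁ i = f₁ j → g₁ i = g₁ j)
    (h₂ : ∀ i j, f₂ i = f₂ j → g₂ i = g₂ j) : ∀ i < n₁ + n₂, ∀ j < n₁ + n₂,
    joinArrays (fun i => (f₁ i : ℕ)) (fun i => (f₂ i : ℕ)) n₁ i =
      joinArrays (fun i => (f₁ i : ℕ)) (fun i => (f₂ i : ℕ)) n₁ j →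
    joinArrays g₁ g₂ d i = joinArrays g₁ g₂ d j := by
  simp only [forall_lt_add_iff, joinArrays_left, joinArrays_right]
  refine ⟨fun i => ⟨fun j h => h₁ i j (Fin.ext h), fun j h => ?_⟩,
    fun i => ⟨fun j h => ?_, fun j h => ?_⟩⟩
  · have := (f₁ i).2
    omega
  · have := (f₁ j).2
    omega
  · rw [h₂ i j (Fin.ext (by omega))]

lemma jointComp_eq_of_jointPar (h₁ : c₁.Describes M num₁) (h₂ : c₂.Describes N num₂) :
    ∀ i < n₁ + n₂, ∀ j < n₁ + n₂, jointPar c₁ c₂ i = jointPar c₁ c₂ j →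
      jointComp c₁ c₂ i = jointComp c₁ c₂ j :=
  joinArrays_congr (fun _ _ h => congrArg Fin.val (h₁.comp_eq_of_par h))
    fun _ _ h => congrArg Fin.val (h₂.comp_eq_of_par h)

lemma jointComp_eq_of_jointCopar (h₁ : c₁.Describes M num₁) (h₂ : c₂.Describes N num₂) :
    ∀ i < n₁ + n₂, ∀ j < n₁ + n₂, jointCopar c₁ c₂ i = jointCopar c₁ c₂ j →
      jointComp c₁ c₂ i = jointComp c₁ c₂ j :=
  joinArrays_congr (fun _ _ h => congrArg Fin.val (h₁.comp_eq_of_copar h))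
    fun _ _ h => congrArg Fin.val (h₂.comp_eq_of_copar h)

/-- The program computes the signatures of the components of the first matroid. -/
lemma signature_left (h₁ : c₁.Describes M num₁) (h₂ : c₂.Describes N num₂) {ρ : ℕ → ℕ}
    (hρ : ∀ i < n₁ + n₂, jointRank c₁ c₂ i = ρ (jointComp c₁ c₂ i)) (i : Fin n₁) :
    signature (n₁ + n₂) (jointComp c₁ c₂) (jointPar c₁ c₂) (jointCopar c₁ c₂) ρ
      (jointComp c₁ c₂ i) = c₁.signature i := by
  rw [signature_eq_blockSignature (A := {x // c₁.comp x = c₁.comp i}) (e := fun x => (x.1 : ℕ))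
    (fun x y h => Subtype.ext (Fin.ext h)) ?_
    (jointComp_eq_of_jointPar h₁ h₂) (jointComp_eq_of_jointCopar h₁ h₂)
    (p := fun x => c₁.par x.1) (q := fun x => c₁.copar x.1), LockedCode.signature,
    ← hρ i (by omega), jointRank, joinArrays_left]
  · intro a b
    rw [jointPar, joinArrays_left, joinArrays_left, Fin.ext_iff]
  · intro a b
    rw [jointCopar, joinArrays_left, joinArrays_left, Fin.ext_iff]
  · intro k
    constructor
    · rintro ⟨hk, hC⟩
      rw [jointComp, joinArrays_left] at hC
      have hk' : k < n₁ := by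
        by_contra hk'
        obtain ⟨l, rfl⟩ := Nat.exists_eq_add_of_le (not_lt.1 hk')
        rw [joinArrays_add] at hC
        have := (c₁.comp i).2
        omega
      obtain ⟨k, rfl⟩ : ∃ l : Fin n₁, k = l := ⟨⟨k, hk'⟩, rfl⟩
      rw [joinArrays_left] at hC
      exact ⟨⟨k, Fin.ext hC⟩, rfl⟩
    · rintro ⟨x, rfl⟩
      refine ⟨by have := x.1.2; simp only; omega, ?_⟩
      rw [jointComp, joinArrays_left, joinArrays_left, x.2]

/-- The program computes the signatures of the components of the second matroid. -/
lemma signature_right (h₁ : c₁.Describes M num₁) (h₂ : c₂.Describes N num₂) {ρ : ℕ → ℕ}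
    (hρ : ∀ i < n₁ + n₂, jointRank c₁ c₂ i = ρ (jointComp c₁ c₂ i)) (i : Fin n₂) :
    signature (n₁ + n₂) (jointComp c₁ c₂) (jointPar c₁ c₂) (jointCopar c₁ c₂) ρ
      (jointComp c₁ c₂ (n₁ + i)) = c₂.signature i := by
  rw [signature_eq_blockSignature (A := {x // c₂.comp x = c₂.comp i})
    (e := fun x => n₁ + (x.1 : ℕ))
    (fun x y h => Subtype.ext (Fin.ext (Nat.add_left_cancel h))) ?_
    (jointComp_eq_of_jointPar h₁ h₂) (jointComp_eq_of_jointCopar h₁ h₂)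
    (p := fun x => c₂.par x.1) (q := fun x => c₂.copar x.1), LockedCode.signature,
    ← hρ (n₁ + i) (by omega), jointRank, joinArrays_right, add_zero]
  · intro a b
    rw [jointPar, joinArrays_right, joinArrays_right, Fin.ext_iff, Nat.add_right_cancel_iff]
  · intro a b
    rw [jointCopar, joinArrays_right, joinArrays_right, Fin.ext_iff, Nat.add_right_cancel_iff]
  · intro k
    constructor
    · rintro ⟨hk, hC⟩
      rw [jointComp, joinArrays_right] at hC
      have hk' : n₁ ≤ k := by
        by_contra hk'
        obtain ⟨k, rfl⟩ : ∃ l : Fin n₁, k = l := ⟨⟨k, not_le.1 hk'⟩, rfl⟩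
        rw [joinArrays_left] at hC
        have := (c₁.comp k).2
        omega
      obtain ⟨k, rfl⟩ : ∃ l : Fin n₂, k = n₁ + l := ⟨⟨k - n₁, by omega⟩, by simp; omega⟩
      rw [joinArrays_right] at hC
      exact ⟨⟨k, Fin.ext (by omega)⟩, rfl⟩
    · rintro ⟨x, rfl⟩
      refine ⟨by have := x.1.2; simp only; omega, ?_⟩
      rw [jointComp, joinArrays_right, joinArrays_right, x.2]

/-- The decision program is correct, with linear running time. -/
theorem runs_decisionProgram_pairInput (hM : ZeroLocked M) (hN : ZeroLocked N)
    (h₁ : c₁.Describes M num₁) (h₂ : c₂.Describes N num₂) {w : ℕ}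
    (hw : 256 * (n₁ + n₂ + 1) ^ 2 ≤ w) :
    ∃ t m, Runs w (pairInput c₁ c₂) decisionProgram (fun _ => 0) t m ∧
      t ≤ 1100 * (n₁ + n₂ + 1) ∧ (Isomorphic M N → m 0 = 1) ∧ (¬ Isomorphic M N → m 0 = 0) := by
  classical
  -- The rank is a function of the component.
  obtain ⟨ρ, hρ⟩ : ∃ ρ : ℕ → ℕ, ∀ i < n₁ + n₂, jointRank c₁ c₂ i = ρ (jointComp c₁ c₂ i) := by
    refine ⟨fun c => if h : ∃ i < n₁ + n₂, jointComp c₁ c₂ i = c then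
      jointRank c₁ c₂ h.choose else 0, fun i hi => ?_⟩
    have hex : ∃ j < n₁ + n₂, jointComp c₁ c₂ j = jointComp c₁ c₂ i := ⟨i, hi, rfl⟩
    simp only
    rw [dif_pos hex]
    exact (joinArrays_congr (fun _ _ => h₁.rank_congr) (fun _ _ => h₂.rank_congr) _
      hex.choose_spec.1 _ hi hex.choose_spec.2).symm
  obtain ⟨h, hh, t, m, hr, ht, hm, hm'⟩ :=
    runs_decisionProgram (reads_pairInput h₁ h₂) hρ hw
  suffices key : Isomorphic M N ↔
      ∀ i < n₁ + n₂, countFrom h 0 n₁ (h i) = countFrom h n₁ n₂ (h i) from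
    ⟨t, m, hr, ht, fun H => hm (key.1 H), fun H => hm' (mt key.2 H)⟩
  rw [h₁.isomorphic_iff hM hN h₂]
  have k₁ : ∀ i < n₁ + n₂, countFrom h 0 n₁ (h i) = {j : Fin n₁ | c₁.signature j =
      signature (n₁ + n₂) (jointComp c₁ c₂) (jointPar c₁ c₂) (jointCopar c₁ c₂) ρ
        (jointComp c₁ c₂ i)}.ncard := fun i hi => by
    rw [countFrom_eq_ncard]
    congr 1
    ext j
    rw [mem_ofPred_eq, mem_ofPred_eq, zero_add, hh j (by omega) i hi, signature_left h₁ h₂ hρ]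
  have k₂ : ∀ i < n₁ + n₂, countFrom h n₁ n₂ (h i) = {j : Fin n₂ | c₂.signature j =
      signature (n₁ + n₂) (jointComp c₁ c₂) (jointPar c₁ c₂) (jointCopar c₁ c₂) ρ
        (jointComp c₁ c₂ i)}.ncard := fun i hi => by
    rw [countFrom_eq_ncard]
    congr 1
    ext j
    rw [mem_ofPred_eq, mem_ofPred_eq, hh (n₁ + j) (by omega) i hi, signature_right h₁ h₂ hρ]
  constructor
  · intro H i hi
    rw [k₁ i hi, k₂ i hi, H]
  · intro H s
    by_cases hs : (∃ i, c₁.signature i = s) ∨ ∃ i, c₂.signature i = s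
    · rcases hs with ⟨i, rfl⟩ | ⟨i, rfl⟩
      · have := H i (by omega)
        rwa [k₁ i (by omega), k₂ i (by omega), signature_left h₁ h₂ hρ] at this
      · have := H (n₁ + i) (by omega)
        rwa [k₁ _ (by omega), k₂ _ (by omega), signature_right h₁ h₂ hρ] at this
    · push Not at hs
      simp [hs.1, hs.2]

end Decide

end LockedMatroid

namespace LockedMatroid

open Set

/-! ### Rank and closure sizes as a complete invariant -/

section Sizes

variable {α : Type u} {β : Type v} {M : Matroid α} {N : Matroid β}

lemma TwoConnected.component_eq (hM : TwoConnected M) {e : α} (he : e ∈ M.E) :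
    component M e = M.E :=
  Subset.antisymm component_subset_ground fun f hf => ⟨hf, hM e he f hf⟩

lemma parallelClosure_eq_iff {e f : α} (hf : f ∈ M.E) :
    parallelClosure M e = parallelClosure M f ↔ Parallel M e f := by
  constructor
  · intro h
    have : f ∈ parallelClosure M f := ⟨hf, Or.inl rfl⟩
    rw [← h] at this
    exact this.2
  · intro h
    ext x
    exact ⟨fun hx => ⟨hx.1, h.symm.trans hx.2⟩, fun hx => ⟨hx.1, h.trans hx.2⟩⟩

lemma coparallelClosure_eq_iff {e f : α} (hf : f ∈ M.E) :
    coparallelClosure M e = coparallelClosure M f ↔ Coparallel M e f :=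
  parallelClosure_eq_iff (M := M.dual) hf

lemma fiber_parallelClosure {X : Set α} (hX : X ∈ parallelClosures M) :
    Subtype.val '' ((fun x : M.E => parallelClosure M (x : α)) ⁻¹' {X}) = X := by
  obtain ⟨e, he, rfl⟩ := hX
  ext f
  constructor
  · rintro ⟨x, hx, rfl⟩
    exact ⟨x.2, ((parallelClosure_eq_iff he).1 hx).symm⟩
  · rintro ⟨hf, h⟩
    exact ⟨⟨f, hf⟩, (parallelClosure_eq_iff he).2 h.symm, rfl⟩

lemma ncard_fiber_eq_iff {k : ℕ} (hk : 1 ≤ k) (X : Set α) :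
    ((fun x : M.E => parallelClosure M (x : α)) ⁻¹' {X}).ncard = k ↔
      X ∈ parallelClosures M ∧ X.ncard = k := by
  have h : ∀ hX : X ∈ parallelClosures M,
      ((fun x : M.E => parallelClosure M (x : α)) ⁻¹' {X}).ncard = X.ncard := fun hX => by
    rw [← ncard_image_of_injective _ Subtype.val_injective, fiber_parallelClosure hX]
  constructor
  · intro hX
    obtain ⟨x, rfl⟩ := exists_eq_of_one_le_ncard_fiber (hk.trans_eq hX.symm)
    have hx : parallelClosure M (x : α) ∈ parallelClosures M := ⟨x, x.2, rfl⟩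
    exact ⟨hx, (h hx).symm.trans hX⟩
  · rintro ⟨hX, hc⟩
    rw [h hX, hc]

lemma class_count_parallelClosure {k : ℕ} (hk : 1 ≤ k) :
    {X | ((fun x : M.E => parallelClosure M (x : α)) ⁻¹' {X}).ncard = k}.ncard =
      closureSizes (parallelClosures M) k := by
  simp only [ncard_fiber_eq_iff hk, closureSizes]

lemma closureSizes_parallelClosures_zero [M.Finite] :
    closureSizes (parallelClosures M) 0 = 0 := by
  rw [closureSizes, ncard_eq_zero ((M.ground_finite.finite_subsets).subset ?_),
    eq_empty_iff_forall_notMem]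
  · rintro X ⟨⟨e, he, rfl⟩, h0⟩
    rw [ncard_eq_zero (M.set_finite _ fun x hx => hx.1)] at h0
    exact (eq_empty_iff_forall_notMem.1 h0) e ⟨he, Or.inl rfl⟩
  · rintro X ⟨⟨e, he, rfl⟩, -⟩
    exact fun x hx => hx.1

lemma closureSizes_parallelClosures_eq_iff [M.Finite] [N.Finite] :
    closureSizes (parallelClosures M) = closureSizes (parallelClosures N) ↔ ∀ k, 1 ≤ k →
      {X | ((fun x : M.E => parallelClosure M (x : α)) ⁻¹' {X}).ncard = k}.ncard =
      {X | ((fun x : N.E => parallelClosure N (x : β)) ⁻¹' {X}).ncard = k}.ncard := by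
  constructor
  · intro h k hk
    rw [class_count_parallelClosure hk, class_count_parallelClosure hk, h]
  · intro h
    funext k
    rcases Nat.eq_zero_or_pos k with rfl | hk
    · rw [closureSizes_parallelClosures_zero, closureSizes_parallelClosures_zero]
    · have := h k hk
      rwa [class_count_parallelClosure hk, class_count_parallelClosure hk] at this

lemma closureSizes_coparallelClosures_eq_iff [M.Finite] [N.Finite] :
    closureSizes (coparallelClosures M) = closureSizes (coparallelClosures N) ↔ ∀ k, 1 ≤ k →
      {X | ((fun x : M.E => coparallelClosure M (x : α)) ⁻¹' {X}).ncard = k}.ncard =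
      {X | ((fun x : N.E => coparallelClosure N (x : β)) ⁻¹' {X}).ncard = k}.ncard :=
  closureSizes_parallelClosures_eq_iff (M := M.dual) (N := N.dual)

lemma TwoConnected.nearlyDisjoint [M.Finite] (hM : TwoConnected M) :
    NearlyDisjoint (fun x : M.E => parallelClosure M (x : α))
      (fun x : M.E => coparallelClosure M (x : α)) :=
  nearlyDisjoint_of_sameComponent Subtype.val_injective
    (fun _ b => parallelClosure_eq_iff b.2) (fun _ b => coparallelClosure_eq_iff b.2)
    fun a b => hM a a.2 b b.2

/-- Rank and closure sizes form a complete invariant of connected matroids without locked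
subsets. -/
theorem isomorphic_iff_closureSizes [M.Finite] [N.Finite] (hM : TwoConnected M)
    (hN : TwoConnected N) (hM' : ZeroLocked M) (hN' : ZeroLocked N) : Isomorphic M N ↔
    M.eRank = N.eRank ∧
      closureSizes (parallelClosures M) = closureSizes (parallelClosures N) ∧
      closureSizes (coparallelClosures M) = closureSizes (coparallelClosures N) := by
  rw [isomorphic_iff_exists_sameLockedStructure hM' hN', closureSizes_parallelClosures_eq_iff,
    closureSizes_coparallelClosures_eq_iff]
  have : Finite M.E := M.ground_finite
  have : Finite N.E := N.ground_finite
  constructor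
  · rintro ⟨φ, -, h2, h3, h4⟩
    refine ⟨?_, fun k hk => class_count_congr φ (fun a b => ?_) (fun n => n = k) (by omega),
      fun k hk => class_count_congr φ (fun a b => ?_) (fun n => n = k) (by omega)⟩
    · rcases isEmpty_or_nonempty M.E with h | ⟨⟨x⟩⟩
      · have hN₀ : IsEmpty N.E := φ.symm.isEmpty
        rw [isEmpty_coe_sort] at h hN₀
        rw [← M.eRk_ground, ← N.eRk_ground, h, hN₀, M.eRk_empty, N.eRk_empty]
      · have := h4 x
        rwa [hM.component_eq x.2, hN.component_eq (φ x).2, M.eRk_ground, N.eRk_ground] at this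
    · rw [parallelClosure_eq_iff b.2, parallelClosure_eq_iff (φ b).2]
      exact h2 a b
    · rw [coparallelClosure_eq_iff b.2, coparallelClosure_eq_iff (φ b).2]
      exact h3 a b
  · rintro ⟨hr, hp, hq⟩
    obtain ⟨φ, h2, h3⟩ := exists_equiv_of_nearlyDisjoint hp hq hM.nearlyDisjoint hN.nearlyDisjoint
    refine ⟨φ, fun x y => iff_of_true (hM x x.2 y y.2) (hN _ (φ x).2 _ (φ y).2), fun x y => ?_,
      fun x y => ?_, fun x => ?_⟩
    · have := h2 x y
      rwa [parallelClosure_eq_iff y.2, parallelClosure_eq_iff (φ y).2] at this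
    · have := h3 x y
      rwa [coparallelClosure_eq_iff y.2, coparallelClosure_eq_iff (φ y).2] at this
    · rw [hM.component_eq x.2, hN.component_eq (φ x).2, M.eRk_ground, N.eRk_ground, hr]

end Sizes

/-! ### Locked lattices -/

section Lattice

variable {α : Type u} {β : Type v} {M : Matroid α} {N : Matroid β}

/-- The length of the paths from the root to a vertex, if there are no locked vertices; locked
vertices get the junk value `0`. -/
def LatticeVertex.level : LatticeVertex M → ℕ
  | .root => 0
  | .coparallel _ _ => 1
  | .parallel _ _ => 2
  | .locked _ _ => 0
  | .sink => 3

lemma ZeroLocked.level_of_arc (hM : ZeroLocked M) {x y : LatticeVertex M} (h : x.Arc y) :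
    y.level = x.level + 1 := by
  have hL : ∀ L, L ∉ lockedSubsets M := eq_empty_iff_forall_notMem.1 hM
  cases x with
  | locked L hL' => exact absurd hL' (hL L)
  | _ => cases y with
    | locked L hL' => exact absurd hL' (hL L)
    | _ => first | rfl | exact absurd h (by simp [LatticeVertex.Arc])

lemma exists_arc_coparallel (S : Set α) (hS : S ∈ coparallelClosures M) :
    ∃ P hP, (LatticeVertex.coparallel S hS : LatticeVertex M).Arc (.parallel P hP) := by
  obtain ⟨e, he, rfl⟩ := hS
  exact ⟨parallelClosure M e, ⟨e, he, rfl⟩, e, ⟨he, Or.inl rfl⟩, he, Or.inl rfl⟩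

lemma exists_arc_parallel (P : Set α) (hP : P ∈ parallelClosures M) :
    ∃ S hS, (LatticeVertex.coparallel S hS : LatticeVertex M).Arc (.parallel P hP) := by
  obtain ⟨e, he, rfl⟩ := hP
  exact ⟨coparallelClosure M e, ⟨e, he, rfl⟩, e, ⟨he, Or.inl rfl⟩, he, Or.inl rfl⟩

lemma ZeroLocked.arc_sink (hM : ZeroLocked M) (P : Set α) (hP : P ∈ parallelClosures M) :
    (LatticeVertex.parallel P hP : LatticeVertex M).Arc .sink :=
  fun L hL => absurd hL (eq_empty_iff_forall_notMem.1 hM L)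

/-- The coparallel closures are the second vertices of the paths with three arcs. -/
lemma ZeroLocked.exists_coparallel_iff (hM : ZeroLocked M) (x : LatticeVertex M) :
    (∃ y z t : LatticeVertex M, y.Arc x ∧ x.Arc z ∧ z.Arc t) ↔ ∃ S hS, x = .coparallel S hS := by
  constructor
  · rintro ⟨y, z, t, h1, h2, h3⟩
    have h1 := hM.level_of_arc h1
    have h2 := hM.level_of_arc h2
    have h3 := hM.level_of_arc h3
    cases x with
    | coparallel S hS => exact ⟨S, hS, rfl⟩
    | _ => cases t <;> simp only [LatticeVertex.level] at h1 h2 h3 <;> omega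
  · rintro ⟨S, hS, rfl⟩
    obtain ⟨P, hP, h⟩ := exists_arc_coparallel S hS
    exact ⟨.root, _, .sink, trivial, h, hM.arc_sink P hP⟩

/-- The parallel closures are the third vertices of the paths with three arcs. -/
lemma ZeroLocked.exists_parallel_iff (hM : ZeroLocked M) (x : LatticeVertex M) :
    (∃ y z t : LatticeVertex M, y.Arc z ∧ z.Arc x ∧ x.Arc t) ↔ ∃ P hP, x = .parallel P hP := by
  constructor
  · rintro ⟨y, z, t, h1, h2, h3⟩
    have h1 := hM.level_of_arc h1
    have h2 := hM.level_of_arc h2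
    have h3 := hM.level_of_arc h3
    cases x with
    | parallel S hS => exact ⟨S, hS, rfl⟩
    | _ => cases t <;> simp only [LatticeVertex.level] at h1 h2 h3 <;> omega
  · rintro ⟨P, hP, rfl⟩
    obtain ⟨S, hS, h⟩ := exists_arc_parallel P hP
    exact ⟨.root, .coparallel S hS, .sink, trivial, h, hM.arc_sink P hP⟩

lemma ZeroLocked.eq_sink (hM : ZeroLocked M) {x y z t : LatticeVertex M} (h1 : y.Arc z)
    (h2 : z.Arc t) (h3 : t.Arc x) : x = .sink := by
  have h1 := hM.level_of_arc h1
  have h2 := hM.level_of_arc h2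
  have h3 := hM.level_of_arc h3
  have h4 : 3 ≤ x.level := by omega
  cases x with
  | sink => rfl
  | _ => simp [LatticeVertex.level] at h4

lemma ZeroLocked.exists_path_sink (hM : ZeroLocked M) (h : M.E.Nonempty) :
    ∃ y z t : LatticeVertex M, y.Arc z ∧ z.Arc t ∧ t.Arc .sink := by
  obtain ⟨e, he⟩ := h
  obtain ⟨P, hP, h⟩ := exists_arc_coparallel (coparallelClosure M e) ⟨e, he, rfl⟩
  exact ⟨.root, .coparallel (coparallelClosure M e) ⟨e, he, rfl⟩, .parallel P hP, trivial, h,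
    hM.arc_sink P hP⟩

lemma encard_eq_iff_ncard_eq {X : Set α} (hX : X.Finite) (k : ℕ) :
    X.encard = k ↔ X.ncard = k := by
  rw [← hX.cast_ncard_eq]
  exact Nat.cast_inj

lemma ncard_coparallel_vertices [M.Finite] (hM : ZeroLocked M) (k : ℕ) :
    {x : LatticeVertex M |
      (∃ y z t : LatticeVertex M, y.Arc x ∧ x.Arc z ∧ z.Arc t) ∧ x.label.1 = k}.ncard =
      closureSizes (coparallelClosures M) k := by
  have hfin : ∀ S ∈ coparallelClosures M, S.Finite := by
    rintro _ ⟨e, he, rfl⟩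
    exact M.set_finite _ fun x hx => hx.1
  symm
  refine ncard_congr (fun S hS => .coparallel S hS.1) (fun S hS => ?_) (fun S S' hS hS' h => ?_)
    fun x hx => ?_
  · exact ⟨(hM.exists_coparallel_iff _).2 ⟨S, hS.1, rfl⟩,
      (encard_eq_iff_ncard_eq (hfin S hS.1) k).2 hS.2⟩
  · simpa using h
  · obtain ⟨S, hS, rfl⟩ := (hM.exists_coparallel_iff _).1 hx.1
    exact ⟨S, ⟨hS, (encard_eq_iff_ncard_eq (hfin S hS) k).1 hx.2⟩, rfl⟩

lemma ncard_parallel_vertices [M.Finite] (hM : ZeroLocked M) (k : ℕ) :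
    {x : LatticeVertex M |
      (∃ y z t : LatticeVertex M, y.Arc z ∧ z.Arc x ∧ x.Arc t) ∧ x.label.1 = k}.ncard =
      closureSizes (parallelClosures M) k := by
  have hfin : ∀ P ∈ parallelClosures M, P.Finite := by
    rintro _ ⟨e, he, rfl⟩
    exact M.set_finite _ fun x hx => hx.1
  symm
  refine ncard_congr (fun S hS => .parallel S hS.1) (fun S hS => ?_) (fun S S' hS hS' h => ?_)
    fun x hx => ?_
  · exact ⟨(hM.exists_parallel_iff _).2 ⟨S, hS.1, rfl⟩,
      (encard_eq_iff_ncard_eq (hfin S hS.1) k).2 hS.2⟩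
  · simpa using h
  · obtain ⟨S, hS, rfl⟩ := (hM.exists_parallel_iff _).1 hx.1
    exact ⟨S, ⟨hS, (encard_eq_iff_ncard_eq (hfin S hS) k).1 hx.2⟩, rfl⟩

/-- The locked lattice determines the rank and the sizes of the closures. -/
lemma sizes_eq_of_lockedLatticesIsomorphic [M.Finite] [N.Finite] (hM : ZeroLocked M)
    (hN : ZeroLocked N) (h : LockedLatticesIsomorphic M N) : M.eRank = N.eRank ∧
      closureSizes (parallelClosures M) = closureSizes (parallelClosures N) ∧
      closureSizes (coparallelClosures M) = closureSizes (coparallelClosures N) := by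
  obtain ⟨f, hl, ha⟩ := h
  refine ⟨?_, ?_, ?_⟩
  -- Unless both ground sets are empty, `f` takes the sink to the sink.
  · rw [← M.eRk_ground, ← N.eRk_ground]
    rcases M.E.eq_empty_or_nonempty with hE | hE
    · rcases N.E.eq_empty_or_nonempty with hE' | hE'
      · rw [hE, hE', M.eRk_empty, N.eRk_empty]
      · obtain ⟨y, z, t, h1, h2, h3⟩ := hN.exists_path_sink hE'
        obtain ⟨y, rfl⟩ := f.surjective y
        obtain ⟨z, rfl⟩ := f.surjective z
        obtain ⟨t, rfl⟩ := f.surjective t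
        obtain ⟨x, hx⟩ := f.surjective .sink
        rw [← hx] at h3
        obtain rfl := hM.eq_sink ((ha _ _).1 h1) ((ha _ _).1 h2) ((ha _ _).1 h3)
        have := hl .sink
        rw [hx] at this
        exact (congrArg Prod.snd this).symm
    · obtain ⟨y, z, t, h1, h2, h3⟩ := hM.exists_path_sink hE
      have hx := hN.eq_sink ((ha _ _).2 h1) ((ha _ _).2 h2) ((ha _ _).2 h3)
      have := hl .sink
      rw [hx] at this
      exact (congrArg Prod.snd this).symm
  · funext k
    rw [← ncard_parallel_vertices hM, ← ncard_parallel_vertices hN,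
      ← ncard_image_of_injective _ f.injective]
    congr 1
    ext x
    obtain ⟨x, rfl⟩ := f.surjective x
    simp only [f.injective.mem_set_image, mem_ofPred_eq, hl, ← f.exists_congr_right, ha]
  · funext k
    rw [← ncard_coparallel_vertices hM, ← ncard_coparallel_vertices hN,
      ← ncard_image_of_injective _ f.injective]
    congr 1
    ext x
    obtain ⟨x, rfl⟩ := f.surjective x
    simp only [f.injective.mem_set_image, mem_ofPred_eq, hl, ← f.exists_congr_right, ha]

/-- The image of `S ∩ M.E` under a bijection of the ground sets. -/
def imageOn (φ : M.E ≃ N.E) (S : Set α) : Set β :=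
  (fun x : M.E => (φ x : β)) '' (Subtype.val ⁻¹' S)

lemma mem_imageOn {φ : M.E ≃ N.E} {S : Set α} {x : M.E} :
    (φ x : β) ∈ imageOn φ S ↔ (x : α) ∈ S := by
  constructor
  · rintro ⟨y, hy, h⟩
    rwa [← φ.injective (Subtype.ext h)]
  · exact fun h => ⟨x, h, rfl⟩

lemma imageOn_subset (φ : M.E ≃ N.E) (S : Set α) : imageOn φ S ⊆ N.E := by
  rintro _ ⟨x, -, rfl⟩
  exact (φ x).2

lemma imageOn_symm (φ : M.E ≃ N.E) {S : Set α} (hS : S ⊆ M.E) :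
    imageOn φ.symm (imageOn φ S) = S := by
  ext x
  constructor
  · rintro ⟨y, ⟨z, hz, hzy⟩, rfl⟩
    obtain rfl : φ z = y := Subtype.ext hzy
    simpa using hz
  · intro hx
    exact ⟨φ ⟨x, hS hx⟩, ⟨⟨x, hS hx⟩, hx, rfl⟩, by simp⟩

lemma imageOn_ground (φ : M.E ≃ N.E) : imageOn φ M.E = N.E := by
  refine Subset.antisymm (imageOn_subset φ _) fun y hy => ?_
  obtain ⟨x, hx⟩ := φ.surjective ⟨y, hy⟩
  exact ⟨x, x.2, congrArg Subtype.val hx⟩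

lemma imageOn_inter_nonempty (φ : M.E ≃ N.E) {S P : Set α} (hS : S ⊆ M.E) :
    (imageOn φ S ∩ imageOn φ P).Nonempty ↔ (S ∩ P).Nonempty := by
  constructor
  · rintro ⟨_, ⟨x, hx, rfl⟩, h⟩
    exact ⟨x, hx, mem_imageOn.1 h⟩
  · rintro ⟨x, hx, hx'⟩
    exact ⟨φ ⟨x, hS hx⟩, mem_imageOn.2 hx, mem_imageOn.2 hx'⟩

lemma encard_imageOn (φ : M.E ≃ N.E) {S : Set α} (hS : S ⊆ M.E) :
    (imageOn φ S).encard = S.encard := by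
  have hw : Function.Injective (fun x : M.E => (φ x : β)) :=
    Subtype.val_injective.comp φ.injective
  rw [imageOn, hw.encard_image, ← Subtype.val_injective.encard_image,
    image_preimage_eq_of_subset (by simpa using hS)]

lemma subset_ground_of_mem_parallelClosures {P : Set α} (hP : P ∈ parallelClosures M) :
    P ⊆ M.E := by
  obtain ⟨e, -, rfl⟩ := hP
  exact fun x hx => hx.1

lemma subset_ground_of_mem_coparallelClosures {S : Set α} (hS : S ∈ coparallelClosures M) :
    S ⊆ M.E := subset_ground_of_mem_parallelClosures (M := M.dual) hS

lemma imageOn_mem_parallelClosures {φ : M.E ≃ N.E}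
    (h : ∀ x y : M.E, Parallel M (x : α) y ↔ Parallel N (φ x : β) (φ y)) {P : Set α}
    (hP : P ∈ parallelClosures M) : imageOn φ P ∈ parallelClosures N := by
  obtain ⟨e, he, rfl⟩ := hP
  refine ⟨φ ⟨e, he⟩, (φ _).2, ?_⟩
  ext y
  constructor
  · rintro ⟨hy, hp⟩
    obtain ⟨x, hx⟩ := φ.surjective ⟨y, hy⟩
    obtain rfl : (φ x : β) = y := by rw [hx]
    exact mem_imageOn.2 ⟨x.2, (h ⟨e, he⟩ x).2 hp⟩
  · rintro ⟨x, hx, rfl⟩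
    exact ⟨(φ x).2, (h ⟨e, he⟩ x).1 hx.2⟩

lemma imageOn_mem_coparallelClosures {φ : M.E ≃ N.E}
    (h : ∀ x y : M.E, Coparallel M (x : α) y ↔ Coparallel N (φ x : β) (φ y)) {S : Set α}
    (hS : S ∈ coparallelClosures M) : imageOn φ S ∈ coparallelClosures N :=
  imageOn_mem_parallelClosures (M := M.dual) (N := N.dual) h hS

/-- The map of vertices induced by a bijection that respects the closures, if there are no locked
subsets. -/
def LatticeVertex.map (hM : ZeroLocked M) (φ : M.E ≃ N.E)
    (hp : ∀ P ∈ parallelClosures M, imageOn φ P ∈ parallelClosures N)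
    (hq : ∀ S ∈ coparallelClosures M, imageOn φ S ∈ coparallelClosures N) :
    LatticeVertex M → LatticeVertex N
  | .root => .root
  | .coparallel S hS => .coparallel (imageOn φ S) (hq S hS)
  | .parallel P hP => .parallel (imageOn φ P) (hp P hP)
  | .locked L hL => (eq_empty_iff_forall_notMem.1 hM L hL).elim
  | .sink => .sink

lemma LatticeVertex.map_symm_map (hM : ZeroLocked M) (hN : ZeroLocked N) (φ : M.E ≃ N.E)
    (hp : ∀ P ∈ parallelClosures M, imageOn φ P ∈ parallelClosures N)
    (hq : ∀ S ∈ coparallelClosures M, imageOn φ S ∈ coparallelClosures N)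
    (hp' : ∀ P ∈ parallelClosures N, imageOn φ.symm P ∈ parallelClosures M)
    (hq' : ∀ S ∈ coparallelClosures N, imageOn φ.symm S ∈ coparallelClosures M)
    (x : LatticeVertex M) : (x.map hM φ hp hq).map hN φ.symm hp' hq' = x := by
  cases x with
  | root => rfl
  | sink => rfl
  | coparallel S hS =>
    simp only [map, imageOn_symm φ (subset_ground_of_mem_coparallelClosures hS)]
  | parallel P hP => simp only [map, imageOn_symm φ (subset_ground_of_mem_parallelClosures hP)]
  | locked L hL => exact (eq_empty_iff_forall_notMem.1 hM L hL).elim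

lemma LatticeVertex.carrier_map (hM : ZeroLocked M) (φ : M.E ≃ N.E)
    (hp : ∀ P ∈ parallelClosures M, imageOn φ P ∈ parallelClosures N)
    (hq : ∀ S ∈ coparallelClosures M, imageOn φ S ∈ coparallelClosures N)
    (x : LatticeVertex M) : (x.map hM φ hp hq).carrier = imageOn φ x.carrier := by
  cases x with
  | root => simp [map, carrier, imageOn]
  | sink => exact (imageOn_ground φ).symm
  | coparallel S hS => rfl
  | parallel P hP => rfl
  | locked L hL => exact (eq_empty_iff_forall_notMem.1 hM L hL).elim

lemma LatticeVertex.carrier_subset (hM : ZeroLocked M) (x : LatticeVertex M) :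
    x.carrier ⊆ M.E := by
  cases x with
  | root => exact empty_subset _
  | sink => exact subset_rfl
  | coparallel S hS => exact subset_ground_of_mem_coparallelClosures hS
  | parallel P hP => exact subset_ground_of_mem_parallelClosures hP
  | locked L hL => exact (eq_empty_iff_forall_notMem.1 hM L hL).elim

lemma LatticeVertex.arc_map (hM : ZeroLocked M) (hN : ZeroLocked N) (φ : M.E ≃ N.E)
    (hp : ∀ P ∈ parallelClosures M, imageOn φ P ∈ parallelClosures N)
    (hq : ∀ S ∈ coparallelClosures M, imageOn φ S ∈ coparallelClosures N)
    (x y : LatticeVertex M) : (x.map hM φ hp hq).Arc (y.map hM φ hp hq) ↔ x.Arc y := by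
  cases x with
  | locked L hL => exact (eq_empty_iff_forall_notMem.1 hM L hL).elim
  | coparallel S hS =>
    cases y with
    | locked L hL => exact (eq_empty_iff_forall_notMem.1 hM L hL).elim
    | parallel P hP => exact imageOn_inter_nonempty φ (subset_ground_of_mem_coparallelClosures hS)
    | _ => exact Iff.rfl
  | parallel P hP =>
    cases y with
    | locked L hL => exact (eq_empty_iff_forall_notMem.1 hM L hL).elim
    | sink => exact iff_of_true (hN.arc_sink _ _) (hM.arc_sink _ _)
    | _ => exact Iff.rfl
  | _ =>
    cases y with
    | locked L hL => exact (eq_empty_iff_forall_notMem.1 hM L hL).elim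
    | _ => exact Iff.rfl

lemma lockedLatticesIsomorphic_of_isomorphic (hM : ZeroLocked M) (hN : ZeroLocked N)
    (h : Isomorphic M N) : LockedLatticesIsomorphic M N := by
  obtain ⟨φ, hφ⟩ := h
  have hu : Function.Injective (fun x : M.E => (x : α)) := Subtype.val_injective
  have hu' : range (fun x : M.E => (x : α)) = M.E := Subtype.range_coe
  have hw : Function.Injective (fun x : M.E => (φ x : β)) :=
    Subtype.val_injective.comp φ.injective
  have hw' : range (fun x : M.E => (φ x : β)) = N.E := by
    rw [show (fun x : M.E => (φ x : β)) = Subtype.val ∘ φ from rfl, φ.surjective.range_comp,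
      Subtype.range_coe]
  obtain ⟨-, h2, h3, -⟩ := sameLockedStructure_of_isBase_iff hu hu' hw hw' hφ
  have hp := fun P => imageOn_mem_parallelClosures (P := P) h2
  have hq := fun S => imageOn_mem_coparallelClosures (S := S) h3
  have hp' := fun P => imageOn_mem_parallelClosures (P := P) (φ := φ.symm)
    fun x y => by simp [h2]
  have hq' := fun S => imageOn_mem_coparallelClosures (S := S) (φ := φ.symm)
    fun x y => by simp [h3]
  refine ⟨⟨LatticeVertex.map hM φ hp hq, LatticeVertex.map hN φ.symm hp' hq',
    LatticeVertex.map_symm_map hM hN φ hp hq hp' hq',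
    LatticeVertex.map_symm_map hN hM φ.symm hp' hq' hp hq⟩, fun x => ?_,
    LatticeVertex.arc_map hM hN φ hp hq⟩
  have hx := x.carrier_subset hM
  have hr := eRk_image_eq hu hu' hw hw' hφ (Subtype.val ⁻¹' x.carrier)
  rw [image_preimage_eq_of_subset (by simpa using hx)] at hr
  simp only [LatticeVertex.label, Equiv.coe_fn_mk, LatticeVertex.carrier_map, encard_imageOn φ hx]
  rw [hr, imageOn]

end Lattice

end LockedMatroid


theorem theorem3p4 :
    -- a linear-time decision procedure for isomorphism of matroids without locked subsets
    (∃ (p : Program) (c : ℕ), ∀ (α : Type u) (β : Type v) (M : Matroid α) (N : Matroid β),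
      ZeroLocked M → ZeroLocked N →
      ∀ (n₁ n₂ : ℕ) (num₁ : Fin n₁ ≃ M.E) (num₂ : Fin n₂ ≃ N.E)
        (c₁ : LockedCode n₁) (c₂ : LockedCode n₂),
        c₁.Describes M num₁ → c₂.Describes N num₂ →
        ∃ (t : ℕ) (m : ℕ → ℕ),
          Runs (c * (n₁ + n₂ + 1) ^ c) (pairInput c₁ c₂) p (fun _ => 0) t m ∧
          t ≤ c * (n₁ + n₂ + 1) ∧
          (Isomorphic M N → m 0 = 1) ∧ (¬ Isomorphic M N → m 0 = 0)) ∧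
    -- 2-connected matroids without locked subsets: isomorphism, the locked lattice, closure sizes
    (∀ (α : Type u) (β : Type v) (M : Matroid α) (N : Matroid β), M.Finite → N.Finite →
      TwoConnected M → TwoConnected N → ZeroLocked M → ZeroLocked N →
      (Isomorphic M N ↔ LockedLatticesIsomorphic M N) ∧
      (Isomorphic M N ↔
        M.eRank = N.eRank ∧
        closureSizes (parallelClosures M) = closureSizes (parallelClosures N) ∧
        closureSizes (coparallelClosures M) = closureSizes (coparallelClosures N))) ∧
    -- every element has a trivial parallel closure or a trivial coparallel closure
    (∀ (α : Type u) (M : Matroid α), M.Finite → TwoConnected M → ZeroLocked M →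
      M.E.ncard ≠ 2 →
      ∀ e ∈ M.E, parallelClosure M e = {e} ∨ coparallelClosure M e = {e}) := by
  
  have hbound : ∀ c k : ℕ, 256 ≤ c → 1 ≤ k → 256 * k ^ 2 ≤ c * k ^ c := fun c k hc hk =>
    Nat.mul_le_mul hc (Nat.pow_le_pow_right hk (by omega))
  refine ⟨⟨decisionProgram, 1100, fun α β M N hM hN n₁ n₂ num₁ num₂ c₁ c₂ h₁ h₂ =>
    runs_decisionProgram_pairInput hM hN h₁ h₂ (hbound 1100 _ (by norm_num) (Nat.succ_pos _))⟩,
    fun α β M N _ _ hM hN hM' hN' => ?_,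
    fun α M _ hM _ hE e he => parallelClosure_or_coparallelClosure_eq_singleton hM hE he⟩
  have hsizes := isomorphic_iff_closureSizes hM hN hM' hN'
  exact ⟨⟨lockedLatticesIsomorphic_of_isomorphic hM' hN', fun h =>
    hsizes.2 (sizes_eq_of_lockedLatticesIsomorphic hM' hN' h)⟩, hsizes⟩
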